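/- Let $d\ge 0$, $n\ge 1$ be integers and $L,\tau,\mu,\nu>0$. Let $f_1,\dots,f_n:\mathbb{R}^d\to\mathbb{R}$ be convex, differentiable and $L$-smooth ($\|\nabla f_i(x)-\nabla f_i(y)\|\le L\|x-y\|$), and let $f=\frac1n\sum_{i=1}^n f_i$ be $\tau$-strongly convex: $f(y)\ge f(x)+\langle\nabla f(x),y-x\rangle+\frac{\tau}{2}\|y-x\|^2$ for all $x,y$. Define $$f_\mu(x)=\mathbb{E}_{u\sim\mathcal{N}(0,I_d)}[f(x+\mu u)],\qquad g_\mu(x,u,i)=\frac{f_i(x+\mu u)-f_i(x)}{\mu}\,u,\qquad g_\nu(x)=\sum_{j=1}^d\frac{f(x+\nu e_j)-f(x-\nu e_j)}{2\nu}\,e_j .$$ **Algorithm (ZO-Varag).** Given $x^0\in\mathbb{R}^d$, put $\tilde x^0=x^0$. In epoch $s=1,2,\dots$ set $\tilde x=\tilde x^{s-1}$, $x_0=x^{s-1}$, $\bar x_0=\tilde x$, $\tilde g^s=g_\nu(\tilde x)$, and for $t=1,\dots,T_s$ draw $i_t$ uniformly from $\{1,\dots,n\}$ and $u_t\sim\mathcal{N}(0,I_d)$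 (all draws independent, within and across epochs) and compute $$\underline x_t=\frac{(1+\tau\gamma_s)(1-\alpha_s-p_s)\bar x_{t-1}+\alpha_s x_{t-1}+(1+\tau\gamma_s)p_s\tilde x}{1+\tau\gamma_s(1-\alpha_s)},\qquad G_t=g_\mu(\underline x_t,u_t,i_t)-g_\mu(\tilde x,u_t,i_t)+\tilde g^s,$$ $$x_t=\arg\min_{x}\Big\{\gamma_s\big[\langle G_t,x\rangle+\tfrac{\tau}{2}\|\underline x_t-x\|^2\big]+\tfrac12\|x_{t-1}-x\|^2\Big\}=\frac{x_{t-1}+\gamma_s\tau\underline x_t-\gamma_sG_t}{1+\gamma_s\tau},$$ $$\bar x_t=(1-\alpha_s-p_s)\bar x_{t-1}+\alpha_s x_t+p_s\tilde x .$$ Then set $x^s=x_{T_s}$ and $\tilde x^s=\sum_{t=1}^{T_s}\theta_t\bar x_t\big/\sum_{t=1}^{T_s}\theta_t$. **Parameters.** Let $s_0=\lfloor\log_2((d+4)n)\rfloor+1$, $p_s=\frac12$, $\gamma_s=\frac{1}{12(d+4)L\alpha_s}$, $T_s=2^{s-1}$ for $s\le s_0$ and $T_s=T_{s_0}$ for $s>s_0$,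 $\alpha_s=\frac12$ for $s\le s_0$ and $\alpha_s=\min\{\sqrt{n\tau/(24L)},\frac12\}$ for $s>s_0$. For $s\le s_0$ the weights are $\theta_t=\frac{\gamma_s}{\alpha_s}(\alpha_s+p_s)$ if $1\le t\le T_s-1$ and $\theta_{T_s}=\frac{\gamma_s}{\alpha_s}$. For $s>s_0$ they are $\theta_t=\Gamma_{t-1}-(1-\alpha_s-p_s)\Gamma_t$ if $1\le t\le T_s-1$ and $\theta_{T_s}=\Gamma_{T_s-1}$, where $\Gamma_t=(1+\frac{\tau\gamma_s}{2})^t$. **Theorem.** The function $f_\mu$ has a minimizer $x_\mu^*$. With $f_\mu^*=f_\mu(x_\mu^*)$, $$D_0=\tfrac{2}{d+4}\,[f_\mu(x^0)-f_\mu(x_\mu^*)]+6L\|x^0-x_\mu^*\|^2,\qquad \varsigma_1=\mu^2L(d+4)^2,\qquad \varsigma_2=\frac{E}{\tau},\qquad E=2L^2d\nu^2+\tfrac12\mu^2L^2(d+3)^3,$$ for every $s\ge1$ the random variable $f_\mu(\tilde x^s)-f_\mu^*$ is integrable and $$\mathbb{E}[f_\mu(\tilde x^s)-f_\mu^*]\le\begin{cases}\dfrac{(d+4)D_0}{2^{s+1}}+2\varsigma_1+\frac12\varsigma_2,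 & 1\le s\le s_0,\\[2mm] \left(\frac45\right)^{s-s_0}\dfrac{D_0}{n}+12\varsigma_1+5\varsigma_2, & s>s_0\text{ and }n\ge\frac{6L}{\tau},\\[2mm] \left(1+\frac14\sqrt{\frac{n\tau}{6L}}\right)^{-(s-s_0)}\dfrac{D_0}{n}+\left(8\sqrt{\frac{6L}{n\tau}}+4\right)\varsigma_1+5\varsigma_2, & s>s_0\text{ and }n<\frac{6L}{\tau}.\end{cases}$$ In particular the error terms do not depend on $s$ within each case. -/

import Mathlib

open MeasureTheory ProbabilityTheory

noncomputable section

namespace ZOVarag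

/-- The space `ℝ^d` with its Euclidean norm and inner product. -/
abbrev Space (d : ℕ) : Type := EuclideanSpace ℝ (Fin d)

/-- The finite-sum objective `f = (1/n) ∑ᵢ fᵢ`. -/
def objective {d n : ℕ} (f : Fin n → Space d → ℝ) (x : Space d) : ℝ :=
  (1 / (n : ℝ)) * ∑ i, f i x

/-- The Gaussian smoothing `g_μ(x) = E[g(x + μ u)]`, where `u ∼ N(0, I_d)`. -/
def smoothed {d : ℕ} (μ : ℝ) (g : Space d → ℝ) (x : Space d) : ℝ :=
  ∫ u, g (x + μ • u) ∂(stdGaussian (Space d))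

/-- The two-point Gaussian estimator `((g(x + μ u) - g(x)) / μ) u`. -/
def gaussEst {d : ℕ} (μ : ℝ) (g : Space d → ℝ) (x u : Space d) : Space d :=
  ((g (x + μ • u) - g x) / μ) • u

/-- The coordinate-wise central finite difference
`∑ⱼ ((g(x + ν eⱼ) - g(x - ν eⱼ)) / (2ν)) eⱼ`. -/
def coordEst {d : ℕ} (ν : ℝ) (g : Space d → ℝ) (x : Space d) : Space d :=
  ∑ j : Fin d,
    ((g (x + ν • EuclideanSpace.single j (1 : ℝ)) - g (x - ν • EuclideanSpace.single j (1 : ℝ)))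
      / (2 * ν)) • EuclideanSpace.single j (1 : ℝ)

/-- The parameter sequences of the method; epochs `s` and inner iterations `t` start at `1`. -/
structure Params where
  /-- number of inner iterations of epoch `s` -/
  T : ℕ → ℕ
  /-- step size `γ_s` -/
  γ : ℕ → ℝ
  /-- momentum parameter `α_s` -/
  α : ℕ → ℝ
  /-- weight `p_s` of the pivotal point -/
  p : ℕ → ℝ
  /-- averaging weight `θ_t` used in epoch `s` -/
  θ : ℕ → ℕ → ℝ

/-- One inner iteration with parameters `α, γ, p`: from the pivotal point `xt`, the pivotal gradient
`gt`, the pair `(x_{t-1}, x̄_{t-1})` and the sample `(u_t, i_t)`, compute `(x_t, x̄_t)`.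
The new `x_t` is the minimizer of
`γ (⟪G, x⟫ + (τ/2) ‖x_under - x‖²) + (1/2) ‖x_{t-1} - x‖²`. -/
def innerStep {d n : ℕ} (f : Fin n → Space d → ℝ) (τ μ α γ p : ℝ) (xt gt : Space d)
    (z : Space d × Space d) (u : Space d) (i : Fin n) : Space d × Space d :=
  let xUnder : Space d := (1 / (1 + τ * γ * (1 - α))) •
    (((1 + τ * γ) * (1 - α - p)) • z.2 + α • z.1 + ((1 + τ * γ) * p) • xt)
  let G : Space d := gaussEst μ (f i) xUnder u - gaussEst μ (f i) xt u + gt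
  let xNew : Space d := (1 / (1 + γ * τ)) • (z.1 + (γ * τ) • xUnder - γ • G)
  (xNew, (1 - α - p) • z.2 + α • xNew + p • xt)

/-- The inner loop of one epoch, started at `(x_0, x̄_0) = (xstart, xt)`: the pair `(x_t, x̄_t)` after
`t` iterations. Iteration `t` uses the sample `(u t, i t)`. -/
def inner {d n : ℕ} (f : Fin n → Space d → ℝ) (τ μ α γ p : ℝ) (xt gt xstart : Space d)
    (u : ℕ → Space d) (i : ℕ → Fin n) : ℕ → Space d × Space d
  | 0 => (xstart, xt)
  | t + 1 =>
      innerStep f τ μ α γ p xt gt (inner f τ μ α γ p xt gt xstart u i t) (u (t + 1)) (i (t + 1))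

/-- ZO-Varag: the pair `(x^s, x̃^s)` after `s` epochs, where iteration `t` of epoch `s` uses the
sample `(u s t, i s t)`. The pivotal point of an epoch is the weighted average `x̃^{s-1}` returned by
the previous epoch, and its gradient is estimated by coordinate-wise finite differences. -/
def varag {d n : ℕ} (f : Fin n → Space d → ℝ) (τ μ ν : ℝ) (P : Params) (x0 : Space d)
    (u : ℕ → ℕ → Space d) (i : ℕ → ℕ → Fin n) : ℕ → Space d × Space d
  | 0 => (x0, x0)
  | s + 1 =>
      let z := varag f τ μ ν P x0 u i s
      let traj := inner f τ μ (P.α (s + 1)) (P.γ (s + 1)) (P.p (s + 1)) z.2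
        (coordEst ν (objective f) z.2) z.1 (u (s + 1)) (i (s + 1))
      ((traj (P.T (s + 1))).1,
        (1 / ∑ t ∈ Finset.Icc 1 (P.T (s + 1)), P.θ (s + 1) t) •
          ∑ t ∈ Finset.Icc 1 (P.T (s + 1)), P.θ (s + 1) t • (traj t).2)

/-- `s₀ = ⌊log₂ ((d + 4) n)⌋ + 1`. -/
def sZero (d n : ℕ) : ℕ := Nat.log 2 ((d + 4) * n) + 1

/-- `T_s = 2^{s-1}` for `s ≤ s₀`, and `T_s = T_{s₀}` for `s > s₀`. -/
def epochLength (d n s : ℕ) : ℕ :=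
  if s ≤ sZero d n then 2 ^ (s - 1) else 2 ^ (sZero d n - 1)

/-- `α_s = 1/2` for `s ≤ s₀`, and `α_s = min {√(nτ / (24L)), 1/2}` for `s > s₀`. -/
def alphaSC (d n : ℕ) (L τ : ℝ) (s : ℕ) : ℝ :=
  if s ≤ sZero d n then 1 / 2 else min (√((n : ℝ) * τ / (24 * L))) (1 / 2)

/-- `γ_s = 1 / (12 (d + 4) L α_s)`. -/
def gammaSC (d n : ℕ) (L τ : ℝ) (s : ℕ) : ℝ :=
  1 / (12 * ((d : ℝ) + 4) * L * alphaSC d n L τ s)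

/-- `Γ_t = (1 + τ γ_s / 2)^t` (for epoch `s`). -/
def GammaSC (d n : ℕ) (L τ : ℝ) (s t : ℕ) : ℝ :=
  (1 + τ * gammaSC d n L τ s / 2) ^ t

/-- The averaging weights `θ_t` of epoch `s`, for `1 ≤ t ≤ T_s`, with `p_s = 1/2`. -/
def thetaSC (d n : ℕ) (L τ : ℝ) (s t : ℕ) : ℝ :=
  if s ≤ sZero d n then
    if t < epochLength d n s then
      gammaSC d n L τ s / alphaSC d n L τ s * (alphaSC d n L τ s + 1 / 2)
    else gammaSC d n L τ s / alphaSC d n L τ s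
  else
    if t < epochLength d n s then
      GammaSC d n L τ s (t - 1) - (1 - alphaSC d n L τ s - 1 / 2) * GammaSC d n L τ s t
    else GammaSC d n L τ s (t - 1)

/-- The parameters used for strongly convex objectives. -/
def paramsSC (d n : ℕ) (L τ : ℝ) : Params where
  T := epochLength d n
  γ := gammaSC d n L τ
  α := alphaSC d n L τ
  p := fun _ => 1 / 2
  θ := thetaSC d n L τ

/-- `D₀ = (2 / (d + 4)) (f_μ(x⁰) - f_μ(x*)) + 6 L ‖x⁰ - x*‖²`. -/
def initialGap {d n : ℕ} (f : Fin n → Space d → ℝ) (L μ : ℝ) (x0 xs : Space d) : ℝ :=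
  2 / ((d : ℝ) + 4) * (smoothed μ (objective f) x0 - smoothed μ (objective f) xs)
    + 6 * L * ‖x0 - xs‖ ^ 2

/-- `ς₁ = μ² L (d + 4)²`. -/
def errOne (d : ℕ) (L μ : ℝ) : ℝ := μ ^ 2 * L * ((d : ℝ) + 4) ^ 2

/-- `E = 2 L² d ν² + μ² L² (d + 3)³ / 2`. -/
def pivotErr (d : ℕ) (L μ ν : ℝ) : ℝ :=
  2 * L ^ 2 * (d : ℝ) * ν ^ 2 + μ ^ 2 * L ^ 2 * ((d : ℝ) + 3) ^ 3 / 2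

/-- `ς₂ = E / τ`. -/
def errTwo (d : ℕ) (L τ μ ν : ℝ) : ℝ := pivotErr d L μ ν / τ

end ZOVarag

end

/-! ZO-Varag is accelerated variance-reduced gradient descent on f_μ, which inherits L-smoothness
and τ-strong convexity from f. Gaussian integration by parts (`stein`) shows that the two-point
difference is unbiased for ∇f_μ. Hence G_t is ∇f_μ(x_under), plus mean-zero noise, plus the bias of
the finite-difference gradient at the pivot, whose squared norm is at most `pivotErr`.

Noise: Gaussian moments bound the second moment of the difference of the two estimators by 8L(d+2) D
+ O(μ²), where D is the Bregman divergence of f_μ between pivot and x_under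
(`integral_gaussEst_sub_sq_le`). Convexity at the pivot, which enters the average with weight 1/2,
leaves a slack (γ/α)D/2, and 12(d+4)Lαγ = 1 makes this slack absorb the noise. Only the O(μ²) term
survives. Bias: Young's inequality with a parameter c in (0, τ] pays for it by giving up the part c
of the strong convexity. The outcome is the one-step recursion `integral_potential_le` for the
expected gap and the expected squared distance.

Summing the recursion with weights ρ^t, ρ = 1 + (τ - c)γ, produces the averaging weights θ_t by Abel
summation (`epoch_le`). In the early epochs c = τ and ρ = 1; doubling the epoch length makes the
epoch inequalities telescope, so the gap decays like 2^{-s} down to the scale D₀/n, up to error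
terms. In the late epochs c = τ/2, and since an epoch is longer than (d+4)n/2, Bernoulli's
inequality bounds ρ^T below by 5/4 or by 1 + α/2. This gives a fixed contraction per epoch
(`linear_rate_half`, `linear_rate_small`). -/

noncomputable section

namespace ZerothOrder

/-! ### Inequalities for smooth convex functions. -/

/-- Convex differentiable functions with `L`-Lipschitz gradient. -/
structure SmoothConvex {E : Type*} [NormedAddCommGroup E] [InnerProductSpace ℝ E] [CompleteSpace E]
    (L : ℝ) (g : E → ℝ) : Prop where
  convex : ConvexOn ℝ Set.univ g
  differentiable : Differentiable ℝ g
  lipschitz : ∀ x y, ‖gradient g x - gradient g y‖ ≤ L * ‖x - y‖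

namespace SmoothConvex

variable {E : Type*} [NormedAddCommGroup E] [InnerProductSpace ℝ E] [CompleteSpace E]
  {L : ℝ} {g : E → ℝ}

theorem hasGradientAt (hg : SmoothConvex L g) (x : E) : HasGradientAt g (gradient g x) x :=
  (hg.differentiable x).hasGradientAt

theorem hasDerivAt_line (hg : SmoothConvex L g) (x v : E) (t : ℝ) :
    HasDerivAt (fun t : ℝ => g (x + t • v)) (inner ℝ (gradient g (x + t • v)) v) t := by
  have h1 : HasDerivAt (fun t : ℝ => x + t • v) v t := by
    simpa using ((hasDerivAt_id t).smul_const v).const_add x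
  have h2 := (hg.hasGradientAt (x + t • v)).hasFDerivAt.comp_hasDerivAt t h1
  rw [InnerProductSpace.toDual_apply_apply] at h2
  exact h2

theorem continuous_gradient (hg : SmoothConvex L g) : Continuous (gradient g) := by
  refine (LipschitzWith.of_dist_le_mul (K := L.toNNReal) fun x y => ?_).continuous
  rw [dist_eq_norm, dist_eq_norm]
  exact (hg.lipschitz x y).trans
    (mul_le_mul_of_nonneg_right (Real.le_coe_toNNReal L) (norm_nonneg _))

/-- Along the segment, g minus its quadratic model has nonpositive derivative by the Lipschitz bound
and Cauchy–Schwarz. -/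
theorem descent (hg : SmoothConvex L g) (x y : E) :
    g y ≤ g x + inner ℝ (gradient g x) (y - x) + L / 2 * ‖y - x‖ ^ 2 := by
  set v := y - x with hv
  let φ : ℝ → ℝ := fun t =>
    g (x + t • v) - t * inner ℝ (gradient g x) v - L / 2 * t ^ 2 * ‖v‖ ^ 2
  have hd : ∀ t, HasDerivAt φ
      (inner ℝ (gradient g (x + t • v)) v - inner ℝ (gradient g x) v - L * t * ‖v‖ ^ 2) t := by
    intro t
    have h2 : HasDerivAt (fun t : ℝ => t * inner ℝ (gradient g x) v)
        (inner ℝ (gradient g x) v) t := by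
      simpa using (hasDerivAt_id t).mul_const (inner ℝ (gradient g x) v)
    have h3 : HasDerivAt (fun t : ℝ => L / 2 * t ^ 2 * ‖v‖ ^ 2) (L * t * ‖v‖ ^ 2) t := by
      convert! (((hasDerivAt_id t).pow 2).const_mul (L / 2)).mul_const (‖v‖ ^ 2) using 1
      simp only [id_eq, Nat.cast_ofNat]; ring
    exact ((hg.hasDerivAt_line x v t).sub h2).sub h3
  have hanti : AntitoneOn φ (Set.Ici 0) := by
    refine antitoneOn_of_deriv_nonpos (convex_Ici 0)
      (fun t _ => (hd t).continuousAt.continuousWithinAt)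
      (fun t _ => (hd t).differentiableAt.differentiableWithinAt) fun t ht => ?_
    have ht0 : 0 ≤ t := by
      rw [interior_Ici] at ht; exact le_of_lt ht
    rw [(hd t).deriv, ← inner_sub_left]
    have h1 := real_inner_le_norm (gradient g (x + t • v) - gradient g x) v
    have h2 := hg.lipschitz (x + t • v) x
    rw [add_sub_cancel_left, norm_smul, Real.norm_of_nonneg ht0] at h2
    have h3 := mul_le_mul_of_nonneg_right h2 (norm_nonneg v)
    nlinarith
  have h01 := hanti (Set.mem_Ici.2 le_rfl) (Set.mem_Ici.2 zero_le_one) zero_le_one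
  simp only [φ, one_smul, zero_smul, hv, add_sub_cancel, add_zero] at h01
  simp only [← hv] at h01
  linarith

theorem gradient_le (hg : SmoothConvex L g) (x y : E) :
    g x + inner ℝ (gradient g x) (y - x) ≤ g y := by
  have hc : ConvexOn ℝ Set.univ (fun t : ℝ => g (x + t • (y - x))) := by
    have := hg.convex.comp_affineMap (AffineMap.lineMap x y : ℝ →ᵃ[ℝ] E)
    simp only [Set.preimage_univ] at this
    convert! this using 2 with t
    simp [AffineMap.lineMap_apply, add_comm]
  have hd := hg.hasDerivAt_line x (y - x) 0
  have h := hc.le_slope_of_hasDerivAt (Set.mem_univ (0 : ℝ)) (Set.mem_univ (1 : ℝ)) zero_lt_one hd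
  rw [slope_def_field] at h
  simp only [zero_smul, one_smul, add_zero, sub_zero, div_one, add_sub_cancel] at h
  linarith

/-- At the point y - δ/L, with δ the difference of the gradients, the descent bound from y and the
tangent at x bound g from above and from below; comparing them gives the claim. -/
theorem cocoercive (hL : 0 < L) (hg : SmoothConvex L g) (x y : E) :
    ‖gradient g x - gradient g y‖ ^ 2
      ≤ 2 * L * (g y - g x - inner ℝ (gradient g x) (y - x)) := by
  set δ := gradient g y - gradient g x with hδ
  have h1 := hg.descent y (y - (1 / L) • δ)
  have h2 := hg.gradient_le x (y - (1 / L) • δ)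
  have e1 : y - (1 / L) • δ - y = -((1 / L) • δ) := by abel
  have e2 : y - (1 / L) • δ - x = (y - x) - (1 / L) • δ := by abel
  rw [e1, inner_neg_right, inner_smul_right, norm_neg, norm_smul] at h1
  rw [e2, inner_sub_right, inner_smul_right] at h2
  have h3 : inner ℝ (gradient g y) δ - inner ℝ (gradient g x) δ = ‖δ‖ ^ 2 := by
    rw [← inner_sub_left, real_inner_self_eq_norm_sq]
  rw [norm_sub_rev, ← hδ]
  have h4 : L / 2 * (‖1 / L‖ * ‖δ‖) ^ 2 = 1 / (2 * L) * ‖δ‖ ^ 2 := by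
    rw [Real.norm_of_nonneg (by positivity)]; field_simp
  have h5 : 1 / L * ‖δ‖ ^ 2 - 1 / (2 * L) * ‖δ‖ ^ 2
      ≤ g y - g x - inner ℝ (gradient g x) (y - x) := by
    rw [← h3, mul_sub]; rw [h4, ← h3] at h1; linarith
  have h6 : 1 / L * ‖δ‖ ^ 2 - 1 / (2 * L) * ‖δ‖ ^ 2 = ‖δ‖ ^ 2 / (2 * L) := by field_simp; ring
  rw [h6, div_le_iff₀ (by positivity)] at h5
  linarith

theorem norm_gradient_le (hg : SmoothConvex L g) (x : E) :
    ‖gradient g x‖ ≤ ‖gradient g 0‖ + L * ‖x‖ := by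
  have := hg.lipschitz x 0
  rw [sub_zero] at this
  linarith [norm_sub_norm_le (gradient g x) (gradient g 0)]

/-- Quadratic growth, from which every Gaussian integrability claim below follows. -/
theorem abs_le (hL : 0 < L) (hg : SmoothConvex L g) (x : E) :
    |g x| ≤ |g 0| + ‖gradient g 0‖ * ‖x‖ + L / 2 * ‖x‖ ^ 2 := by
  have h1 := hg.descent 0 x
  have h2 := hg.gradient_le 0 x
  rw [sub_zero] at h1 h2
  have h3 := _root_.abs_le.1 (abs_real_inner_le_norm (gradient g 0) x)
  have : 0 ≤ L / 2 * ‖x‖ ^ 2 := by positivity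
  rw [_root_.abs_le]
  constructor
  · linarith [neg_abs_le (g 0)]
  · linarith [le_abs_self (g 0)]

theorem continuous (hg : SmoothConvex L g) : Continuous g := hg.differentiable.continuous

end SmoothConvex

/-! ### Gaussian integration by parts. -/

section Stein

variable {E : Type*} [NormedAddCommGroup E] [InnerProductSpace ℝ E] [FiniteDimensional ℝ E]
  [MeasurableSpace E] [BorelSpace E]

theorem integrable_one_add_norm_pow {F : Type*} [NormedAddCommGroup F] [NormedSpace ℝ F]
    [CompleteSpace F] [SecondCountableTopology F] [MeasurableSpace F] [BorelSpace F] (m : Measure F)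
    [IsGaussian m] (k : ℕ) : Integrable (fun u : F => (1 + ‖u‖) ^ k) m := by
  have h0 : MemLp (fun u : F => ‖u‖) k m := (IsGaussian.memLp_id m k (by simp)).norm
  have h : MemLp (fun u : F => 1 + ‖u‖) k m := (memLp_const (1 : ℝ)).add h0
  refine (h.integrable_norm_pow').congr (.of_forall fun u => ?_)
  simp only [Real.norm_eq_abs]
  rw [abs_of_nonneg (by positivity)]

/-- Functions of polynomial growth are integrable for a Gaussian measure. -/
theorem integrable_of_polynomial_growth {F G : Type*} [NormedAddCommGroup F] [NormedSpace ℝ F]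
    [CompleteSpace F] [SecondCountableTopology F] [MeasurableSpace F] [BorelSpace F]
    [NormedAddCommGroup G] {m : Measure F} [IsGaussian m] {h : F → G}
    (hm : AEStronglyMeasurable h m) (C : ℝ) (k : ℕ) (hb : ∀ u, ‖h u‖ ≤ C * (1 + ‖u‖) ^ k) :
    Integrable h m :=
  ((integrable_one_add_norm_pow m k).const_mul C).mono' hm (.of_forall hb)

theorem integral_inner_mul_inner_stdGaussian (a w : E) :
    ∫ v, inner ℝ a v * inner ℝ w v ∂(stdGaussian E) = inner ℝ a w := by
  have h := covarianceBilin_apply_eq_cov (μ := stdGaussian E) IsGaussian.memLp_two_id a w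
  rw [covarianceBilin_stdGaussian, innerSL_apply_apply] at h
  rw [h, covariance_eq_sub]
  · have h0 : ∀ b : E, ∫ v, inner ℝ b v ∂(stdGaussian E) = 0 := fun b => by
      have := integral_strongDual_stdGaussian (E := E) (innerSL ℝ b)
      simpa using this
    simp [h0]
  · exact (innerSL ℝ a).comp_memLp' IsGaussian.memLp_two_id
  · exact (innerSL ℝ w).comp_memLp' IsGaussian.memLp_two_id

/-- Gaussian integration by parts. -/
theorem stein {F : E → ℝ} {F' : E → E} (hF : ∀ u, HasGradientAt F (F' u) u)
    (hF' : Continuous F') {C : ℝ} {k : ℕ} (hb : ∀ u, |F u| ≤ C * (1 + ‖u‖) ^ k)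
    (hb' : ∀ u, ‖F' u‖ ≤ C * (1 + ‖u‖) ^ k) (w : E) :
    ∫ u, F u * inner ℝ w u ∂(stdGaussian E) = ∫ u, inner ℝ (F' u) w ∂(stdGaussian E) := by
  set γ := stdGaussian E
  have hC : 0 ≤ C := by
    have := (abs_nonneg _).trans (hb 0); simpa using this
  have hFc : Continuous F := continuous_iff_continuousAt.2 fun u => (hF u).continuousAt
  -- Rotate two independent copies (z₁, z₂). The rotated pair (X, Y) has the same law for every θ,
  -- so E[F(X)⟨w, Y⟩] is constant in θ. Its derivative at θ = 0, which must vanish, is the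
  -- integration-by-parts identity.
  let X : ℝ → E × E → E := fun θ z => Real.cos θ • z.1 + Real.sin θ • z.2
  let Y : ℝ → E × E → E := fun θ z => -Real.sin θ • z.1 + Real.cos θ • z.2
  let H : ℝ → E × E → ℝ := fun θ z => F (X θ z) * inner ℝ w (Y θ z)
  let H' : ℝ → E × E → ℝ := fun θ z =>
    inner ℝ (F' (X θ z)) (Y θ z) * inner ℝ w (Y θ z) - F (X θ z) * inner ℝ w (X θ z)
  have hXn : ∀ θ z, ‖X θ z‖ ≤ 2 * ‖z‖ := fun θ z => by
    refine (norm_add_le _ _).trans ?_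
    rw [norm_smul, norm_smul]
    have h1 := mul_le_mul (Real.abs_cos_le_one θ) (norm_fst_le z) (norm_nonneg _) zero_le_one
    have h2 := mul_le_mul (Real.abs_sin_le_one θ) (norm_snd_le z) (norm_nonneg _) zero_le_one
    simp only [Real.norm_eq_abs]; linarith
  have hYn : ∀ θ z, ‖Y θ z‖ ≤ 2 * ‖z‖ := fun θ z => by
    refine (norm_add_le _ _).trans ?_
    rw [norm_smul, norm_smul, norm_neg]
    have h1 := mul_le_mul (Real.abs_sin_le_one θ) (norm_fst_le z) (norm_nonneg _) zero_le_one
    have h2 := mul_le_mul (Real.abs_cos_le_one θ) (norm_snd_le z) (norm_nonneg _) zero_le_one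
    simp only [Real.norm_eq_abs]; linarith
  have hXc : ∀ θ, Continuous (X θ) := fun θ => by fun_prop
  have hYc : ∀ θ, Continuous (Y θ) := fun θ => by fun_prop
  have hHc : ∀ θ, Continuous (H θ) := fun θ => by fun_prop
  have hH'c : ∀ θ, Continuous (H' θ) := fun θ => by fun_prop
  have hpow : ∀ x : E, ∀ z : E × E, ‖x‖ ≤ 2 * ‖z‖ →
      C * (1 + ‖x‖) ^ k ≤ C * 2 ^ k * (1 + ‖z‖) ^ k := fun x z hx => by
    rw [mul_assoc, ← mul_pow]
    gcongr
    linarith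
  have hrot : ∀ θ, ∫ z, H θ z ∂(γ.prod γ) = ∫ z, H 0 z ∂(γ.prod γ) := fun θ => by
    have h := IsGaussian.map_rotation_eq_self (μ := γ) (by simp [γ]) θ
    conv_rhs => rw [← h]
    rw [integral_map (by fun_prop) (hHc 0).aestronglyMeasurable]
    simp [H, X, Y, ContinuousLinearMap.rotation_apply]
  have hderiv : ∀ θ z, HasDerivAt (fun θ => H θ z) (H' θ z) θ := fun θ z => by
    have hX : HasDerivAt (fun θ => X θ z) (Y θ z) θ :=
      ((Real.hasDerivAt_cos θ).smul_const z.1).add ((Real.hasDerivAt_sin θ).smul_const z.2)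
    have hY : HasDerivAt (fun θ => Y θ z) (-X θ z) θ := by
      have := ((Real.hasDerivAt_sin θ).neg.smul_const z.1).add
        ((Real.hasDerivAt_cos θ).smul_const z.2)
      convert! this using 1
      simp only [X, neg_smul, neg_add]
    have h1 := (hF (X θ z)).hasFDerivAt.comp_hasDerivAt θ hX
    rw [InnerProductSpace.toDual_apply_apply] at h1
    have h2 : HasDerivAt (fun θ => inner ℝ w (Y θ z)) (inner ℝ w (-X θ z)) θ :=
      (innerSL ℝ w).hasFDerivAt.comp_hasDerivAt θ hY
    have h3 := h1.mul h2
    convert! h3 using 1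
    simp only [H', inner_neg_right, Function.comp]; ring
  -- A polynomial bound on the θ-derivative that is uniform in θ, as needed to differentiate under
  -- the integral.
  let B : E × E → ℝ := fun z => (C * 2 ^ k * (4 * ‖w‖ + 2 * ‖w‖)) * (1 + ‖z‖) ^ (k + 2)
  have hBint : Integrable B (γ.prod γ) := (integrable_one_add_norm_pow _ _).const_mul _
  have hbound : ∀ θ z, ‖H' θ z‖ ≤ B z := fun θ z => by
    have h1 := norm_inner_le_norm (𝕜 := ℝ) (F' (X θ z)) (Y θ z)
    have h2 := norm_inner_le_norm (𝕜 := ℝ) w (Y θ z)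
    have h3 := norm_inner_le_norm (𝕜 := ℝ) w (X θ z)
    have hz := norm_nonneg z
    calc ‖H' θ z‖ ≤ ‖inner ℝ (F' (X θ z)) (Y θ z)‖ * ‖inner ℝ w (Y θ z)‖
          + ‖F (X θ z)‖ * ‖inner ℝ w (X θ z)‖ := by
          refine (norm_sub_le _ _).trans ?_
          rw [norm_mul, norm_mul]
      _ ≤ (C * 2 ^ k * (1 + ‖z‖) ^ k * (2 * (1 + ‖z‖))) * (‖w‖ * (2 * (1 + ‖z‖)))
          + (C * 2 ^ k * (1 + ‖z‖) ^ k) * (‖w‖ * (2 * (1 + ‖z‖)) * (1 + ‖z‖)) := by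
          gcongr
          · exact h1.trans (mul_le_mul ((hb' _).trans (hpow _ _ (hXn θ z)))
              ((hYn θ z).trans (by linarith)) (norm_nonneg _) (by positivity))
          · exact h2.trans (mul_le_mul_of_nonneg_left ((hYn θ z).trans (by linarith))
              (norm_nonneg _))
          · exact (hb _).trans (hpow _ _ (hXn θ z))
          · refine h3.trans ?_
            have : ‖X θ z‖ ≤ 2 * (1 + ‖z‖) := (hXn θ z).trans (by linarith)
            calc ‖w‖ * ‖X θ z‖ ≤ ‖w‖ * (2 * (1 + ‖z‖)) := by gcongr
              _ ≤ ‖w‖ * (2 * (1 + ‖z‖)) * (1 + ‖z‖) :=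
                le_mul_of_one_le_right (by positivity) (by linarith)
      _ = B z := by simp only [B]; ring
  have hH0 : Integrable (H 0) (γ.prod γ) := by
    refine integrable_of_polynomial_growth (hHc 0).aestronglyMeasurable
      (C * 2 ^ k * (‖w‖ * 2)) (k + 1) fun z => ?_
    have hz := norm_nonneg z
    calc ‖H 0 z‖ ≤ (C * 2 ^ k * (1 + ‖z‖) ^ k) * (‖w‖ * (2 * (1 + ‖z‖))) := by
          rw [norm_mul]
          gcongr
          · exact (hb _).trans (hpow _ _ (hXn 0 z))
          · exact (norm_inner_le_norm (𝕜 := ℝ) w (Y 0 z)).trans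
              (mul_le_mul_of_nonneg_left ((hYn 0 z).trans (by linarith)) (norm_nonneg _))
      _ = _ := by ring
  have hD := (hasDerivAt_integral_of_dominated_loc_of_deriv_le (μ := γ.prod γ) (F := H) (F' := H')
    (x₀ := 0) (s := Set.univ) (bound := B) Filter.univ_mem
    (.of_forall fun θ => (hHc θ).aestronglyMeasurable) hH0 (hH'c 0).aestronglyMeasurable
    (.of_forall fun z θ _ => hbound θ z) hBint (.of_forall fun z θ _ => hderiv θ z)).2
  have hconst : HasDerivAt (fun θ => ∫ z, H θ z ∂(γ.prod γ)) 0 0 := by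
    rw [show (fun θ => ∫ z, H θ z ∂(γ.prod γ)) = fun _ => ∫ z, H 0 z ∂(γ.prod γ) from funext hrot]
    exact hasDerivAt_const _ _
  have hzero := hD.unique hconst
  have hI1 : Integrable (fun z : E × E => inner ℝ (F' z.1) z.2 * inner ℝ w z.2) (γ.prod γ) := by
    refine integrable_of_polynomial_growth (by fun_prop) (C * ‖w‖) (k + 2) fun z => ?_
    rw [norm_mul]
    calc _ ≤ (C * (1 + ‖z‖) ^ k * (1 + ‖z‖)) * (‖w‖ * (1 + ‖z‖)) := by
          have h1 := norm_fst_le z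
          have h2 : ‖z.2‖ ≤ 1 + ‖z‖ := (norm_snd_le z).trans (by linarith)
          gcongr
          · refine (norm_inner_le_norm (𝕜 := ℝ) _ _).trans (mul_le_mul ((hb' _).trans ?_) h2
              (norm_nonneg _) (by positivity))
            gcongr
          · exact (norm_inner_le_norm (𝕜 := ℝ) _ _).trans (by gcongr)
      _ = _ := by ring
  have hI2 : Integrable (fun z : E × E => F z.1 * inner ℝ w z.1) (γ.prod γ) := by
    refine integrable_of_polynomial_growth (by fun_prop) (C * ‖w‖) (k + 1) fun z => ?_
    rw [norm_mul]
    calc _ ≤ (C * (1 + ‖z‖) ^ k) * (‖w‖ * (1 + ‖z‖)) := by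
          have h1 := norm_fst_le z
          have h2 : ‖z.1‖ ≤ 1 + ‖z‖ := (norm_fst_le z).trans (by linarith)
          gcongr
          · refine (hb _).trans ?_
            gcongr
          · exact (norm_inner_le_norm (𝕜 := ℝ) _ _).trans (by gcongr)
      _ = _ := by ring
  have hsplit : ∫ z, H' 0 z ∂(γ.prod γ)
      = (∫ z : E × E, inner ℝ (F' z.1) z.2 * inner ℝ w z.2 ∂(γ.prod γ))
        - ∫ z : E × E, F z.1 * inner ℝ w z.1 ∂(γ.prod γ) := by
    rw [← integral_sub hI1 hI2]
    simp [H', X, Y]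
  -- Integrating z₂ out of ⟨F'(z₁), z₂⟩⟨w, z₂⟩ with the identity covariance leaves ⟨F'(z₁), w⟩.
  rw [hsplit, integral_prod _ hI1, integral_prod _ hI2] at hzero
  simp only [γ, integral_inner_mul_inner_stdGaussian, integral_const, probReal_univ, one_smul]
    at hzero
  linarith

end Stein

/-! ### Gaussian moments. -/

section Moments

variable {d : ℕ}

local notation "𝔼" => EuclideanSpace ℝ (Fin d)

theorem integral_inner_sq (a : 𝔼) : ∫ u, inner ℝ a u ^ 2 ∂(stdGaussian 𝔼) = ‖a‖ ^ 2 := by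
  simp_rw [sq (inner ℝ a _)]
  rw [integral_inner_mul_inner_stdGaussian, real_inner_self_eq_norm_sq]

theorem integrable_norm_pow (k : ℕ) : Integrable (fun u : 𝔼 => ‖u‖ ^ k) (stdGaussian 𝔼) :=
  integrable_of_polynomial_growth (by fun_prop) 1 k fun u => by
    rw [norm_pow, norm_norm, one_mul]; gcongr; linarith

theorem norm_sq_eq_sum_inner_single (u : 𝔼) :
    ‖u‖ ^ 2 = ∑ j, inner ℝ (EuclideanSpace.single j (1 : ℝ)) u ^ 2 := by
  rw [EuclideanSpace.real_norm_sq_eq]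
  refine Finset.sum_congr rfl fun j _ => ?_
  rw [EuclideanSpace.inner_single_left]
  simp

theorem integral_norm_sq : ∫ u, ‖u‖ ^ 2 ∂(stdGaussian 𝔼) = d := by
  simp_rw [norm_sq_eq_sum_inner_single]
  rw [integral_finsetSum]
  · simp [integral_inner_sq]
  · intro j _
    refine integrable_of_polynomial_growth (by fun_prop) 1 2 fun u => ?_
    have := norm_inner_le_norm (𝕜 := ℝ) (EuclideanSpace.single j (1 : ℝ)) u
    rw [norm_pow, one_mul]
    gcongr
    simp at this ⊢
    linarith

theorem hasGradientAt_norm_pow_mul_inner (a : 𝔼) (m : ℕ) (u : 𝔼) :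
    HasGradientAt (fun u : 𝔼 => (‖u‖ ^ 2) ^ m * inner ℝ a u)
      ((‖u‖ ^ 2) ^ m • a + (2 * m * (‖u‖ ^ 2) ^ (m - 1) * inner ℝ a u) • u) u := by
  have h1 : HasFDerivAt (fun u : 𝔼 => ‖u‖ ^ 2) (2 • innerSL ℝ u) u :=
    (hasStrictFDerivAt_norm_sq u).hasFDerivAt
  have h2 := (h1.pow m).mul (innerSL ℝ a).hasFDerivAt
  rw [hasGradientAt_iff_hasFDerivAt]
  refine h2.congr_fderiv ?_
  ext v
  simp
  ring

/-- Integration by parts for F(u) = ‖u‖^(2m) ⟨a, u⟩ in direction a. At m = 0 the truncated exponent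
`m - 1` is harmless because its coefficient vanishes. -/
theorem integral_norm_pow_mul_inner_sq (a : 𝔼) (m : ℕ) :
    ∫ u, (‖u‖ ^ 2) ^ m * inner ℝ a u ^ 2 ∂(stdGaussian 𝔼)
      = ‖a‖ ^ 2 * ∫ u, (‖u‖ ^ 2) ^ m ∂(stdGaussian 𝔼)
        + 2 * m * ∫ u, (‖u‖ ^ 2) ^ (m - 1) * inner ℝ a u ^ 2 ∂(stdGaussian 𝔼) := by
  have hC : Continuous fun u : 𝔼 =>
      (‖u‖ ^ 2) ^ m • a + (2 * m * (‖u‖ ^ 2) ^ (m - 1) * inner ℝ a u) • u := by fun_prop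
  have hin : ∀ u : 𝔼, |inner ℝ a u| ≤ ‖a‖ * (1 + ‖u‖) := fun u =>
    (abs_real_inner_le_norm a u).trans (by gcongr; linarith)
  have hin0 : ∀ u : 𝔼, ‖u‖ ^ 2 ≤ (1 + ‖u‖) ^ 2 := fun u => by gcongr; linarith
  have h1le : ∀ u : 𝔼, 1 ≤ 1 + ‖u‖ := fun u => by linarith [norm_nonneg u]
  have hb : ∀ u : 𝔼, |(‖u‖ ^ 2) ^ m * inner ℝ a u|
      ≤ (‖a‖ + 2 * m * ‖a‖) * (1 + ‖u‖) ^ (2 * m + 2) := fun u => by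
    rw [abs_mul, abs_of_nonneg (by positivity)]
    calc _ ≤ ((1 + ‖u‖) ^ 2) ^ m * (‖a‖ * (1 + ‖u‖)) := by
          exact mul_le_mul (pow_le_pow_left₀ (by positivity) (hin0 u) m) (hin u) (abs_nonneg _)
            (by positivity)
      _ = ‖a‖ * (1 + ‖u‖) ^ (2 * m + 1) := by rw [← pow_mul]; ring
      _ ≤ _ := by
          gcongr
          · have : 0 ≤ 2 * (m : ℝ) * ‖a‖ := by positivity
            linarith
          · exact h1le u
          · omega
  have hb' : ∀ u : 𝔼, ‖(‖u‖ ^ 2) ^ m • a + (2 * m * (‖u‖ ^ 2) ^ (m - 1) * inner ℝ a u) • u‖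
      ≤ (‖a‖ + 2 * m * ‖a‖) * (1 + ‖u‖) ^ (2 * m + 2) := fun u => by
    refine (norm_add_le _ _).trans ?_
    rw [norm_smul, norm_smul, norm_mul, add_mul]
    rw [Real.norm_of_nonneg (by positivity), Real.norm_of_nonneg (by positivity)]
    refine add_le_add ?_ ?_
    · calc _ ≤ ((1 + ‖u‖) ^ 2) ^ m * ‖a‖ :=
            mul_le_mul_of_nonneg_right (pow_le_pow_left₀ (by positivity) (hin0 u) m) (norm_nonneg _)
        _ = ‖a‖ * (1 + ‖u‖) ^ (2 * m) := by rw [← pow_mul]; ring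
        _ ≤ _ := by
          refine mul_le_mul_of_nonneg_left (pow_le_pow_right₀ (h1le u) (by omega)) (norm_nonneg _)
    · calc _ ≤ 2 * m * ((1 + ‖u‖) ^ 2) ^ (m - 1) * (‖a‖ * (1 + ‖u‖)) * (1 + ‖u‖) := by
            refine mul_le_mul (mul_le_mul (mul_le_mul_of_nonneg_left
              (pow_le_pow_left₀ (by positivity) (hin0 u) _) (by positivity)) (hin u)
              (abs_nonneg _) (by positivity)) (by linarith) (norm_nonneg _) (by positivity)
        _ = 2 * m * ‖a‖ * (1 + ‖u‖) ^ (2 * (m - 1) + 2) := by rw [← pow_mul]; ring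
        _ ≤ _ := by
          refine mul_le_mul_of_nonneg_left (pow_le_pow_right₀ (h1le u) (by omega)) (by positivity)
  have h := stein (fun u => hasGradientAt_norm_pow_mul_inner a m u) hC hb hb' a
  have hint : ∀ l, Integrable (fun u : 𝔼 => (‖u‖ ^ 2) ^ l) (stdGaussian 𝔼) := fun l => by
    simpa [← pow_mul] using integrable_norm_pow (d := d) (2 * l)
  have hint2 : ∀ l, Integrable (fun u : 𝔼 => (‖u‖ ^ 2) ^ l * inner ℝ a u ^ 2) (stdGaussian 𝔼) :=
    fun l => by
      refine ((hint (l + 1)).mul_const (‖a‖ ^ 2)).mono' (by fun_prop) (.of_forall fun u => ?_)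
      rw [Real.norm_of_nonneg (by positivity), pow_succ (‖u‖ ^ 2), mul_assoc, ← mul_pow]
      refine mul_le_mul_of_nonneg_left ?_ (by positivity)
      rw [sq_le_sq, abs_of_nonneg (by positivity : 0 ≤ ‖u‖ * ‖a‖), mul_comm]
      exact abs_real_inner_le_norm a u
  calc _ = ∫ u, (‖u‖ ^ 2) ^ m * inner ℝ a u * inner ℝ a u ∂(stdGaussian 𝔼) := by
        congr 1; ext u; ring
    _ = _ := by
        rw [h, ← integral_const_mul, ← integral_const_mul, ← integral_add]
        · congr 1; ext u
          rw [inner_add_left, inner_smul_left, inner_smul_left, real_inner_self_eq_norm_sq,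
            real_inner_comm]
          simp; ring
        · exact (hint m).const_mul _
        · exact (hint2 _).const_mul _

/-- The previous identity summed over the standard basis; it yields all even moments of ‖u‖
recursively. -/
theorem integral_norm_pow_succ (m : ℕ) :
    ∫ u, (‖u‖ ^ 2) ^ (m + 1) ∂(stdGaussian 𝔼)
      = (d + 2 * m) * ∫ u, (‖u‖ ^ 2) ^ m ∂(stdGaussian 𝔼) := by
  have hn := norm_sq_eq_sum_inner_single (d := d)
  have hint2 : ∀ l, ∀ j : Fin d, Integrable (fun u : 𝔼 => (‖u‖ ^ 2) ^ l
      * inner ℝ (EuclideanSpace.single j (1 : ℝ)) u ^ 2) (stdGaussian 𝔼) := fun l j => by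
    have : Integrable (fun u : 𝔼 => (‖u‖ ^ 2) ^ (l + 1)) (stdGaussian 𝔼) := by
      simpa [← pow_mul] using integrable_norm_pow (d := d) (2 * (l + 1))
    refine this.mono' (by fun_prop) (.of_forall fun u => ?_)
    rw [Real.norm_of_nonneg (by positivity), pow_succ (‖u‖ ^ 2)]
    refine mul_le_mul_of_nonneg_left ?_ (by positivity)
    rw [hn]
    exact Finset.single_le_sum
      (f := fun j : Fin d => inner ℝ (EuclideanSpace.single j (1 : ℝ)) u ^ 2)
      (fun _ _ => sq_nonneg _) (Finset.mem_univ j)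
  have hsum : ∀ l, ∫ u : 𝔼, (‖u‖ ^ 2) ^ (l + 1) ∂(stdGaussian 𝔼)
      = ∑ j, ∫ u : 𝔼, (‖u‖ ^ 2) ^ l * inner ℝ (EuclideanSpace.single j (1 : ℝ)) u ^ 2
        ∂(stdGaussian 𝔼) := fun l => by
    rw [← integral_finsetSum _ fun j _ => hint2 l j]
    congr 1; ext u
    rw [← Finset.mul_sum, ← hn, pow_succ]
  rw [hsum]
  rw [Finset.sum_congr rfl fun j _ => integral_norm_pow_mul_inner_sq _ m]
  rw [Finset.sum_add_distrib, ← Finset.mul_sum]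
  rcases m with _ | m
  · simp
  · rw [Nat.add_sub_cancel, ← hsum]
    simp
    ring

theorem integral_norm_sq_mul_inner_sq (a : 𝔼) :
    ∫ u, ‖u‖ ^ 2 * inner ℝ a u ^ 2 ∂(stdGaussian 𝔼) = (d + 2) * ‖a‖ ^ 2 := by
  have h := integral_norm_pow_mul_inner_sq a 1
  simp only [pow_one, integral_norm_sq] at h
  rw [h]
  simp [integral_inner_sq]
  ring

theorem integral_norm_pow_six :
    ∫ u, ‖u‖ ^ 6 ∂(stdGaussian 𝔼) = d * (d + 2) * (d + 4) := by
  have h2 := integral_norm_pow_succ (d := d) 2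
  rw [integral_norm_pow_succ 1] at h2
  simp only [pow_one, integral_norm_sq] at h2
  calc _ = ∫ u, (‖u‖ ^ 2) ^ (2 + 1) ∂(stdGaussian 𝔼) := by simp_rw [← pow_mul]
    _ = _ := by rw [h2]; push_cast; ring

end Moments

/-! ### Gaussian smoothing and the zeroth-order gradient estimators. -/

open ZOVarag (Space objective smoothed gaussEst coordEst)

/-- The Gaussian average `E[∇g(x + μ u)]` of the gradient. -/
def smoothedGradient {d : ℕ} (μ : ℝ) (g : Space d → ℝ) (x : Space d) : Space d :=
  ∫ u, gradient g (x + μ • u) ∂(stdGaussian (Space d))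

namespace SmoothConvex

variable {d : ℕ} {L μ : ℝ} {g : Space d → ℝ}

/-- One constant and one exponent serve both the function and its gradient, the format required by
`stein`. -/
theorem exists_growth (hL : 0 < L) (hg : SmoothConvex L g) (x : Space d) (μ : ℝ) :
    ∃ C, ∀ u, |g (x + μ • u)| ≤ C * (1 + ‖u‖) ^ 2 ∧ ‖gradient g (x + μ • u)‖ ≤ C * (1 + ‖u‖) ^ 2 := by
  set A := |g 0| + ‖gradient g 0‖ + L with hA
  have hA0 : 0 ≤ A := by positivity
  set M := 1 + ‖x‖ + |μ| with hM
  refine ⟨A * M ^ 2, fun u => ?_⟩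
  have h1 : 1 + ‖x + μ • u‖ ≤ M * (1 + ‖u‖) := by
    have := norm_add_le x (μ • u)
    rw [norm_smul, Real.norm_eq_abs] at this
    nlinarith [norm_nonneg x, norm_nonneg u, abs_nonneg μ,
      mul_nonneg (norm_nonneg x) (norm_nonneg u)]
  have h2 : A * (1 + ‖x + μ • u‖) ^ 2 ≤ A * M ^ 2 * (1 + ‖u‖) ^ 2 := by
    rw [mul_assoc, ← mul_pow]; gcongr
  have hz := norm_nonneg (x + μ • u)
  have hg0 := norm_nonneg (gradient g 0)
  have ha0 := abs_nonneg (g 0)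
  refine ⟨(hg.abs_le hL _).trans (le_trans ?_ h2), (hg.norm_gradient_le _).trans (le_trans ?_ h2)⟩
  · nlinarith [mul_nonneg ha0 hz, mul_nonneg hg0 hz, mul_nonneg hL.le hz,
      mul_nonneg ha0 (sq_nonneg ‖x + μ • u‖), mul_nonneg hg0 (sq_nonneg ‖x + μ • u‖),
      mul_nonneg hL.le (sq_nonneg ‖x + μ • u‖)]
  · nlinarith [mul_nonneg ha0 hz, mul_nonneg hg0 hz, mul_nonneg hL.le hz,
      mul_nonneg ha0 (sq_nonneg ‖x + μ • u‖), mul_nonneg hg0 (sq_nonneg ‖x + μ • u‖),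
      mul_nonneg hL.le (sq_nonneg ‖x + μ • u‖)]

theorem integrable_shift (hL : 0 < L) (hg : SmoothConvex L g) (μ : ℝ) (x : Space d) :
    Integrable (fun u => g (x + μ • u)) (stdGaussian (Space d)) := by
  obtain ⟨C, hC⟩ := hg.exists_growth hL x μ
  have := hg.continuous
  exact integrable_of_polynomial_growth (by fun_prop) C 2 fun u => (hC u).1

theorem integrable_gradient_shift (hL : 0 < L) (hg : SmoothConvex L g) (μ : ℝ) (x : Space d) :
    Integrable (fun u => gradient g (x + μ • u)) (stdGaussian (Space d)) := by
  obtain ⟨C, hC⟩ := hg.exists_growth hL x μ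
  have := hg.continuous_gradient
  exact integrable_of_polynomial_growth (by fun_prop) C 2 fun u => (hC u).2

theorem integral_inner_gradient_shift (hL : 0 < L) (hg : SmoothConvex L g) (μ : ℝ)
    (x w : Space d) :
    ∫ u, inner ℝ (gradient g (x + μ • u)) w ∂(stdGaussian (Space d))
      = inner ℝ (smoothedGradient μ g x) w := by
  have h := integral_inner (𝕜 := ℝ) (hg.integrable_gradient_shift hL μ x) w
  rw [real_inner_comm, smoothedGradient, ← h]
  simp_rw [real_inner_comm]

theorem integrable_inner_gradient_shift (hL : 0 < L) (hg : SmoothConvex L g) (μ : ℝ)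
    (x w : Space d) :
    Integrable (fun u => inner ℝ (gradient g (x + μ • u)) w) (stdGaussian (Space d)) :=
  (hg.integrable_gradient_shift hL μ x).inner_const w

/-- The shifted points x + μu and y + μu have the same difference for every u, so the pointwise
bound integrates directly. The next results use the same principle. -/
theorem smoothed_descent (hL : 0 < L) (hg : SmoothConvex L g) (μ : ℝ) (x y : Space d) :
    smoothed μ g y ≤ smoothed μ g x + inner ℝ (smoothedGradient μ g x) (y - x)
      + L / 2 * ‖y - x‖ ^ 2 := by
  rw [← hg.integral_inner_gradient_shift hL]
  have h1 := hg.integrable_shift hL μ x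
  have h2 := hg.integrable_inner_gradient_shift hL μ x (y - x)
  have h3 : Integrable (fun _ : Space d => L / 2 * ‖y - x‖ ^ 2) (stdGaussian (Space d)) :=
    integrable_const _
  have h12 : Integrable (fun u => g (x + μ • u) + inner ℝ (gradient g (x + μ • u)) (y - x))
      (stdGaussian (Space d)) := h1.add h2
  have h : smoothed μ g y ≤ ∫ u, (g (x + μ • u) + inner ℝ (gradient g (x + μ • u)) (y - x)
      + L / 2 * ‖y - x‖ ^ 2) ∂(stdGaussian (Space d)) := by
    refine integral_mono (hg.integrable_shift hL μ y) (h12.add h3) fun u => ?_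
    have := hg.descent (x + μ • u) (y + μ • u)
    rwa [add_sub_add_right_eq_sub] at this
  rw [integral_add h12 h3, integral_add h1 h2, integral_const, probReal_univ, one_smul] at h
  exact h

/-- A quadratic lower bound on `g` passes to its Gaussian smoothing. -/
theorem smoothed_quadratic_le (hL : 0 < L) (hg : SmoothConvex L g) (μ : ℝ) {τ : ℝ}
    (hs : ∀ x y, g x + inner ℝ (gradient g x) (y - x) + τ / 2 * ‖y - x‖ ^ 2 ≤ g y)
    (x y : Space d) :
    smoothed μ g x + inner ℝ (smoothedGradient μ g x) (y - x) + τ / 2 * ‖y - x‖ ^ 2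
      ≤ smoothed μ g y := by
  rw [← hg.integral_inner_gradient_shift hL]
  have h1 := hg.integrable_shift hL μ x
  have h2 := hg.integrable_inner_gradient_shift hL μ x (y - x)
  have h3 : Integrable (fun _ : Space d => τ / 2 * ‖y - x‖ ^ 2) (stdGaussian (Space d)) :=
    integrable_const _
  have h12 : Integrable (fun u => g (x + μ • u) + inner ℝ (gradient g (x + μ • u)) (y - x))
      (stdGaussian (Space d)) := h1.add h2
  have h : ∫ u, (g (x + μ • u) + inner ℝ (gradient g (x + μ • u)) (y - x)
      + τ / 2 * ‖y - x‖ ^ 2) ∂(stdGaussian (Space d)) ≤ smoothed μ g y := by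
    refine integral_mono (h12.add h3) (hg.integrable_shift hL μ y) fun u => ?_
    have := hs (x + μ • u) (y + μ • u)
    rwa [add_sub_add_right_eq_sub] at this
  rw [integral_add h12 h3, integral_add h1 h2, integral_const, probReal_univ, one_smul] at h
  exact h

theorem smoothed_gradient_le (hL : 0 < L) (hg : SmoothConvex L g) (μ : ℝ) (x y : Space d) :
    smoothed μ g x + inner ℝ (smoothedGradient μ g x) (y - x) ≤ smoothed μ g y := by
  have := hg.smoothed_quadratic_le hL μ (τ := 0)
    (fun x y => by simpa using hg.gradient_le x y) x y
  simpa using this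

theorem integrable_gradient_shift_sub_sq (hg : SmoothConvex L g) (μ : ℝ)
    (x y : Space d) :
    Integrable (fun u => ‖gradient g (x + μ • u) - gradient g (y + μ • u)‖ ^ 2)
      (stdGaussian (Space d)) := by
  have := hg.continuous_gradient
  refine (integrable_const ((L * ‖x - y‖) ^ 2)).mono' (by fun_prop) (.of_forall fun u => ?_)
  rw [norm_pow, norm_norm]
  have := hg.lipschitz (x + μ • u) (y + μ • u)
  rw [add_sub_add_right_eq_sub] at this
  gcongr

theorem integral_gradient_shift_sub_sq_le (hL : 0 < L) (hg : SmoothConvex L g) (μ : ℝ)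
    (x y : Space d) :
    ∫ u, ‖gradient g (x + μ • u) - gradient g (y + μ • u)‖ ^ 2 ∂(stdGaussian (Space d))
      ≤ 2 * L * (smoothed μ g y - smoothed μ g x
        - inner ℝ (smoothedGradient μ g x) (y - x)) := by
  rw [← hg.integral_inner_gradient_shift hL]
  have h1 := hg.integrable_shift hL μ x
  have h2 := hg.integrable_inner_gradient_shift hL μ x (y - x)
  have h3 := hg.integrable_shift hL μ y
  have h31 : Integrable (fun u => g (y + μ • u) - g (x + μ • u)) (stdGaussian (Space d)) :=
    h3.sub h1
  have h : ∫ u, ‖gradient g (x + μ • u) - gradient g (y + μ • u)‖ ^ 2 ∂(stdGaussian (Space d))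
      ≤ ∫ u, (2 * L * (g (y + μ • u) - g (x + μ • u) - inner ℝ (gradient g (x + μ • u)) (y - x)))
        ∂(stdGaussian (Space d)) := by
    refine integral_mono (hg.integrable_gradient_shift_sub_sq μ x y)
      ((h31.sub h2).const_mul _) fun u => ?_
    have := hg.cocoercive hL (x + μ • u) (y + μ • u)
    rwa [add_sub_add_right_eq_sub] at this
  rw [integral_const_mul, integral_sub h31 h2, integral_sub h3 h1] at h
  exact h

/-- The tangent lower bound and the quadratic upper bound at x squeeze the function to its value
there. -/
theorem continuous_smoothed (hL : 0 < L) (hg : SmoothConvex L g) (μ : ℝ) :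
    Continuous (smoothed μ g) := by
  refine continuous_iff_continuousAt.2 fun x => ?_
  have h1 : Filter.Tendsto (fun y => smoothed μ g x + inner ℝ (smoothedGradient μ g x) (y - x))
      (nhds x) (nhds (smoothed μ g x)) := by
    have : Continuous fun y => smoothed μ g x + inner ℝ (smoothedGradient μ g x) (y - x) := by
      fun_prop
    simpa using this.tendsto x
  have h2 : Filter.Tendsto (fun y => smoothed μ g x + inner ℝ (smoothedGradient μ g x) (y - x)
      + L / 2 * ‖y - x‖ ^ 2) (nhds x) (nhds (smoothed μ g x)) := by
    have : Continuous fun y => smoothed μ g x + inner ℝ (smoothedGradient μ g x) (y - x)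
      + L / 2 * ‖y - x‖ ^ 2 := by fun_prop
    simpa using this.tendsto x
  exact tendsto_of_tendsto_of_tendsto_of_le_of_le h1 h2 (hg.smoothed_gradient_le hL μ x)
    (hg.smoothed_descent hL μ x)

theorem integrable_gaussEst (hL : 0 < L) (hg : SmoothConvex L g) (μ : ℝ) (x : Space d) :
    Integrable (gaussEst μ g x) (stdGaussian (Space d)) := by
  obtain ⟨C, hC⟩ := hg.exists_growth hL x μ
  have := hg.continuous
  refine integrable_of_polynomial_growth (by unfold gaussEst; fun_prop)
    (|μ⁻¹| * (C + |g x|)) 3 fun u => ?_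
  have h1 := (hC u).1
  have hu := norm_nonneg u
  have hC0 : 0 ≤ C := by
    have := (abs_nonneg _).trans (hC 0).1
    simpa using this
  rw [gaussEst, norm_smul, Real.norm_eq_abs, div_eq_inv_mul, abs_mul]
  calc _ ≤ |μ⁻¹| * (C * (1 + ‖u‖) ^ 2 + |g x| * (1 + ‖u‖) ^ 2) * (1 + ‖u‖) := by
        gcongr
        · refine (abs_sub _ _).trans (add_le_add h1 (le_mul_of_one_le_right (abs_nonneg _) ?_))
          nlinarith
        · linarith
    _ = _ := by ring

/-- The two-point estimator is unbiased for the smoothed gradient. -/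
theorem integral_gaussEst (hL : 0 < L) (hg : SmoothConvex L g) (hμ : μ ≠ 0) (x : Space d) :
    ∫ u, gaussEst μ g x u ∂(stdGaussian (Space d)) = smoothedGradient μ g x := by
  refine ext_inner_left ℝ fun w => ?_
  obtain ⟨C, hC⟩ := hg.exists_growth hL x μ
  have hgc := hg.continuous
  have hC0 : 0 ≤ C := by
    have := (abs_nonneg _).trans (hC 0).1
    simpa using this
  have hgrad : ∀ u, HasGradientAt (fun u => g (x + μ • u)) (μ • gradient g (x + μ • u)) u := by
    intro u
    have h1 : HasFDerivAt (fun u : Space d => x + μ • u) (μ • ContinuousLinearMap.id ℝ _) u :=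
      ((hasFDerivAt_id u).const_smul μ).const_add x
    have h2 := (hg.hasGradientAt (x + μ • u)).hasFDerivAt.comp u h1
    rw [hasGradientAt_iff_hasFDerivAt]
    refine h2.congr_fderiv ?_
    ext v
    simp
  have hcg := hg.continuous_gradient
  -- The factor 1 + |μ| makes one constant bound both u ↦ g(x + μu) and its gradient, which carries
  -- the chain-rule factor μ.
  have hst := stein (C := (1 + |μ|) * C) (k := 2) hgrad (by fun_prop)
    (fun u => (hC u).1.trans (by
      have : 0 ≤ C * (1 + ‖u‖) ^ 2 := by positivity
      nlinarith [abs_nonneg μ, mul_nonneg (abs_nonneg μ) this]))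
    (fun u => by
      rw [norm_smul, Real.norm_eq_abs]
      have h1 := (hC u).2
      have : 0 ≤ C * (1 + ‖u‖) ^ 2 := by positivity
      nlinarith [mul_le_mul_of_nonneg_left h1 (abs_nonneg μ)]) w
  simp_rw [inner_smul_left] at hst
  rw [integral_const_mul, hg.integral_inner_gradient_shift hL] at hst
  rw [← integral_inner (hg.integrable_gaussEst hL μ x)]
  -- The subtracted term g(x) contributes nothing to the mean; it only serves to reduce the
  -- variance.
  have hw : ∫ u, inner ℝ w u ∂(stdGaussian (Space d)) = 0 := by
    have := integral_strongDual_stdGaussian (E := Space d) (innerSL ℝ w)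
    simpa using this
  have hwi : Integrable (fun u => inner ℝ w u) (stdGaussian (Space d)) :=
    IsGaussian.integrable_id.const_inner w
  have hgi : Integrable (fun u => g (x + μ • u) * inner ℝ w u) (stdGaussian (Space d)) := by
    refine integrable_of_polynomial_growth (by fun_prop) (C * ‖w‖) 3 fun u => ?_
    have hu := norm_nonneg u
    rw [norm_mul]
    calc _ ≤ (C * (1 + ‖u‖) ^ 2) * (‖w‖ * (1 + ‖u‖)) := by
          refine mul_le_mul (hC u).1 ((norm_inner_le_norm (𝕜 := ℝ) w u).trans ?_) (norm_nonneg _)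
            (by positivity)
          gcongr; linarith
      _ = _ := by ring
  have he : ∀ u, inner ℝ w (gaussEst μ g x u)
      = μ⁻¹ * (g (x + μ • u) * inner ℝ w u - g x * inner ℝ w u) := fun u => by
    rw [gaussEst, inner_smul_right]; ring
  simp_rw [he]
  rw [integral_const_mul, integral_sub hgi (hwi.const_mul _), integral_const_mul, hw, hst,
    real_inner_comm]
  simp [hμ]

/-- Pair the error e with itself, write one copy as a Gaussian mean, and apply Young; half of ‖e‖²
is absorbed on the left. -/
theorem norm_smoothedGradient_sub_sq_le (hL : 0 < L) (hg : SmoothConvex L g) (μ : ℝ)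
    (x : Space d) :
    ‖smoothedGradient μ g x - gradient g x‖ ^ 2 ≤ L ^ 2 * μ ^ 2 * d := by
  set e := smoothedGradient μ g x - gradient g x with he
  have h1 : ‖e‖ ^ 2 = ∫ u, inner ℝ (gradient g (x + μ • u) - gradient g x) e
      ∂(stdGaussian (Space d)) := by
    simp_rw [inner_sub_left]
    rw [integral_sub (hg.integrable_inner_gradient_shift hL μ x e) (integrable_const _),
      hg.integral_inner_gradient_shift hL]
    rw [integral_const, probReal_univ, one_smul, ← inner_sub_left, ← he,
      real_inner_self_eq_norm_sq]
  have hi : Integrable (fun u : Space d => L ^ 2 * μ ^ 2 * ‖u‖ ^ 2 / 2 + ‖e‖ ^ 2 / 2)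
      (stdGaussian (Space d)) :=
    (((integrable_norm_pow 2).const_mul _).div_const _).add (integrable_const _)
  have h2 : ∫ u, inner ℝ (gradient g (x + μ • u) - gradient g x) e ∂(stdGaussian (Space d))
      ≤ ∫ u, (L ^ 2 * μ ^ 2 * ‖u‖ ^ 2 / 2 + ‖e‖ ^ 2 / 2) ∂(stdGaussian (Space d)) := by
    refine integral_mono (((hg.integrable_gradient_shift hL μ x).sub
      (integrable_const _)).inner_const e) hi fun u => ?_
    have h3 := real_inner_le_norm (gradient g (x + μ • u) - gradient g x) e
    have h4 := hg.lipschitz (x + μ • u) x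
    rw [add_sub_cancel_left, norm_smul, Real.norm_eq_abs] at h4
    have h5 : ‖gradient g (x + μ • u) - gradient g x‖ ^ 2 ≤ (L * (|μ| * ‖u‖)) ^ 2 := by gcongr
    have h6 : (L * (|μ| * ‖u‖)) ^ 2 = L ^ 2 * μ ^ 2 * ‖u‖ ^ 2 := by
      rw [mul_pow, mul_pow, sq_abs]; ring
    nlinarith [sq_nonneg (‖gradient g (x + μ • u) - gradient g x‖ - ‖e‖)]
  rw [integral_add (((integrable_norm_pow 2).const_mul _).div_const _) (integrable_const _),
    integral_div, integral_const_mul, integral_norm_sq] at h2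
  simp at h2
  linarith

theorem integrable_gaussEst_sub_sq (hg : SmoothConvex L g) (hL : 0 < L) (μ : ℝ) (x y : Space d) :
    Integrable (fun u => ‖gaussEst μ g x u - gaussEst μ g y u‖ ^ 2) (stdGaussian (Space d)) := by
  obtain ⟨C, hC⟩ := hg.exists_growth hL x μ
  obtain ⟨C', hC'⟩ := hg.exists_growth hL y μ
  have := hg.continuous
  refine integrable_of_polynomial_growth (by unfold gaussEst; fun_prop)
    ((|μ⁻¹| * (C + |g x| + (C' + |g y|))) ^ 2) 6 fun u => ?_
  have h1 := (hC u).1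
  have h1' := (hC' u).1
  have hu := norm_nonneg u
  have hC0 : 0 ≤ C := by
    have := (abs_nonneg _).trans (hC 0).1
    simpa using this
  have hC0' : 0 ≤ C' := by
    have := (abs_nonneg _).trans (hC' 0).1
    simpa using this
  have h2 : 1 ≤ (1 + ‖u‖) ^ 2 := by nlinarith
  rw [norm_pow, norm_norm, gaussEst, gaussEst, ← sub_smul, norm_smul, Real.norm_eq_abs, ← sub_div,
    div_eq_inv_mul, abs_mul]
  calc _ ≤ (|μ⁻¹| * (C * (1 + ‖u‖) ^ 2 + |g x| * (1 + ‖u‖) ^ 2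
        + (C' * (1 + ‖u‖) ^ 2 + |g y| * (1 + ‖u‖) ^ 2)) * (1 + ‖u‖)) ^ 2 := by
        gcongr
        · exact (abs_sub _ _).trans (add_le_add ((abs_sub _ _).trans
            (add_le_add h1 (le_mul_of_one_le_right (abs_nonneg _) h2))) ((abs_sub _ _).trans
            (add_le_add h1' (le_mul_of_one_le_right (abs_nonneg _) h2))))
        · linarith
    _ = _ := by ring

/-- Moving both gradients to the shifted points costs at most 2L|μ|‖u‖, after which averaged
cocoercivity applies. The point is to have the divergence of the smoothed function on the right,
since the potential is measured with that function. -/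
theorem norm_gradient_sub_sq_le (hL : 0 < L) (hg : SmoothConvex L g) (μ : ℝ) (x y : Space d) :
    ‖gradient g x - gradient g y‖ ^ 2
      ≤ 4 * L * (smoothed μ g y - smoothed μ g x - inner ℝ (smoothedGradient μ g x) (y - x))
        + 8 * L ^ 2 * μ ^ 2 * d := by
  have h1 := hg.integral_gradient_shift_sub_sq_le hL μ x y
  have hi1 := (hg.integrable_gradient_shift_sub_sq μ x y).const_mul 2
  have hi2 := (integrable_norm_pow (d := d) 2).const_mul (8 * L ^ 2 * μ ^ 2)
  have h2 : ∫ _u : Space d, ‖gradient g x - gradient g y‖ ^ 2 ∂(stdGaussian (Space d))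
      ≤ ∫ u, (2 * ‖gradient g (x + μ • u) - gradient g (y + μ • u)‖ ^ 2
        + 8 * L ^ 2 * μ ^ 2 * ‖u‖ ^ 2) ∂(stdGaussian (Space d)) := by
    refine integral_mono (integrable_const _) (hi1.add hi2) fun u => ?_
    have hx := hg.lipschitz x (x + μ • u)
    have hy := hg.lipschitz (y + μ • u) y
    rw [sub_add_cancel_left, norm_neg, norm_smul, Real.norm_eq_abs] at hx
    rw [add_sub_cancel_left, norm_smul, Real.norm_eq_abs] at hy
    have ht : ‖gradient g x - gradient g y‖ ≤ L * (|μ| * ‖u‖)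
        + ‖gradient g (x + μ • u) - gradient g (y + μ • u)‖ + L * (|μ| * ‖u‖) := by
      calc _ = ‖(gradient g x - gradient g (x + μ • u))
            + (gradient g (x + μ • u) - gradient g (y + μ • u))
            + (gradient g (y + μ • u) - gradient g y)‖ := by congr 1; abel
        _ ≤ _ := (norm_add₃_le).trans (by gcongr)
    set A := ‖gradient g (x + μ • u) - gradient g (y + μ • u)‖
    have h4 : ‖gradient g x - gradient g y‖ ^ 2 ≤ (A + 2 * (L * (|μ| * ‖u‖))) ^ 2 := by
      gcongr; linarith
    have h6 : (L * (|μ| * ‖u‖)) ^ 2 = L ^ 2 * μ ^ 2 * ‖u‖ ^ 2 := by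
      rw [mul_pow, mul_pow, sq_abs]; ring
    nlinarith [sq_nonneg (A - 2 * (L * (|μ| * ‖u‖)))]
  rw [integral_add hi1 hi2, integral_const_mul, integral_const_mul, integral_norm_sq] at h2
  simp at h2
  linarith

/-- The second moment of the difference of two-point estimators is controlled by the Bregman
divergence of the smoothed function. -/
theorem integral_gaussEst_sub_sq_le (hL : 0 < L) (hg : SmoothConvex L g) (hμ : 0 < μ)
    (x y : Space d) :
    ∫ u, ‖gaussEst μ g x u - gaussEst μ g y u‖ ^ 2 ∂(stdGaussian (Space d))
      ≤ 8 * L * (d + 2) * (smoothed μ g y - smoothed μ g x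
          - inner ℝ (smoothedGradient μ g x) (y - x))
        + (16 * L ^ 2 * μ ^ 2 * d * (d + 2) + μ ^ 2 * L ^ 2 / 2 * (d * (d + 2) * (d + 4))) := by
  set δ := gradient g x - gradient g y with hδ
  have hint : Integrable (fun u : Space d => ‖u‖ ^ 2 * inner ℝ δ u ^ 2) (stdGaussian (Space d)) := by
    refine ((integrable_norm_pow 4).mul_const (‖δ‖ ^ 2)).mono' (by fun_prop)
      (.of_forall fun u => ?_)
    rw [Real.norm_of_nonneg (by positivity)]
    have := abs_real_inner_le_norm δ u
    have h2 : inner ℝ δ u ^ 2 ≤ (‖δ‖ * ‖u‖) ^ 2 := by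
      rw [← sq_abs]; gcongr
    calc _ ≤ ‖u‖ ^ 2 * (‖δ‖ * ‖u‖) ^ 2 := by gcongr
      _ = _ := by ring
  have hi1 := hint.const_mul 2
  have hi2 := (integrable_norm_pow (d := d) 6).const_mul (μ ^ 2 * L ^ 2 / 2)
  have h : ∫ u, ‖gaussEst μ g x u - gaussEst μ g y u‖ ^ 2 ∂(stdGaussian (Space d))
      ≤ ∫ u, (2 * (‖u‖ ^ 2 * inner ℝ δ u ^ 2) + μ ^ 2 * L ^ 2 / 2 * ‖u‖ ^ 6)
        ∂(stdGaussian (Space d)) := by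
    refine integral_mono (hg.integrable_gaussEst_sub_sq hL μ x y) (hi1.add hi2) fun u => ?_
    -- Convexity makes the Taylor remainder nonnegative and smoothness bounds it above. Both
    -- remainders lie in the same interval [0, μL‖u‖²/2], so their difference is bounded by its
    -- length, without a factor 2.
    have rem : ∀ z, 0 ≤ (g (z + μ • u) - g z) / μ - inner ℝ (gradient g z) u ∧
        (g (z + μ • u) - g z) / μ - inner ℝ (gradient g z) u ≤ μ * L / 2 * ‖u‖ ^ 2 := fun z => by
      have h1 := hg.gradient_le z (z + μ • u)
      have h2 := hg.descent z (z + μ • u)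
      rw [add_sub_cancel_left, inner_smul_right] at h1 h2
      rw [norm_smul, Real.norm_of_nonneg hμ.le] at h2
      constructor
      · rw [sub_nonneg, le_div_iff₀ hμ]; linarith
      · rw [sub_le_iff_le_add, div_le_iff₀ hμ]; nlinarith
    obtain ⟨hx1, hx2⟩ := rem x
    obtain ⟨hy1, hy2⟩ := rem y
    set a := (g (x + μ • u) - g x) / μ - inner ℝ (gradient g x) u with ha
    set b := (g (y + μ • u) - g y) / μ - inner ℝ (gradient g y) u with hb
    have he : (g (x + μ • u) - g x) / μ - (g (y + μ • u) - g y) / μ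
        = inner ℝ δ u + (a - b) := by
      rw [hδ, inner_sub_left, ha, hb]; ring
    have hab : (a - b) ^ 2 ≤ (μ * L / 2 * ‖u‖ ^ 2) ^ 2 :=
      sq_le_sq' (by linarith) (by linarith)
    simp only
    rw [gaussEst, gaussEst, ← sub_smul, he, norm_smul, mul_pow, Real.norm_eq_abs, sq_abs]
    calc (inner ℝ δ u + (a - b)) ^ 2 * ‖u‖ ^ 2
        ≤ (2 * inner ℝ δ u ^ 2 + 2 * (μ * L / 2 * ‖u‖ ^ 2) ^ 2) * ‖u‖ ^ 2 := by
          gcongr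
          nlinarith [sq_nonneg (inner ℝ δ u - (a - b))]
      _ = _ := by ring
  rw [integral_add hi1 hi2, integral_const_mul, integral_const_mul, integral_norm_pow_six,
    integral_norm_sq_mul_inner_sq] at h
  -- The factor 2(d+2) is what the moment E[‖u‖²⟨δ, u⟩²] = (d+2)‖δ‖² leaves in front of ‖δ‖².
  have h3 := mul_le_mul_of_nonneg_left (hg.norm_gradient_sub_sq_le hL μ x y)
    (by positivity : (0 : ℝ) ≤ 2 * (d + 2))
  rw [← hδ] at h3
  linarith

theorem coordEst_apply (ν : ℝ) (g : Space d → ℝ) (x : Space d) (j : Fin d) :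
    coordEst ν g x j = (g (x + ν • EuclideanSpace.single j (1 : ℝ))
      - g (x - ν • EuclideanSpace.single j (1 : ℝ))) / (2 * ν) := by
  rw [coordEst, WithLp.ofLp_sum, Finset.sum_apply, Finset.sum_eq_single j]
  · simp
  · intro b _ hb
    simp [hb.symm]
  · simp

/-- In each coordinate, the tangent and descent bounds at x ± νe_j confine the central difference to
a window around the partial derivative. -/
theorem norm_coordEst_sub_sq_le (hg : SmoothConvex L g) {ν : ℝ} (hν : 0 < ν)
    (x : Space d) :
    ‖coordEst ν g x - gradient g x‖ ^ 2 ≤ L ^ 2 * d * ν ^ 2 / 4 := by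
  rw [EuclideanSpace.real_norm_sq_eq]
  have h : ∀ j, (coordEst ν g x - gradient g x) j ^ 2 ≤ (L * ν / 2) ^ 2 := fun j => by
    set e : Space d := EuclideanSpace.single j (1 : ℝ) with he
    have hg' : (gradient g x) j = inner ℝ (gradient g x) e := by
      rw [he, EuclideanSpace.inner_single_right]; simp
    have hen : ‖e‖ = 1 := by simp [he]
    have a1 := hg.gradient_le x (x + ν • e)
    have a2 := hg.descent x (x + ν • e)
    have b1 := hg.gradient_le x (x - ν • e)
    have b2 := hg.descent x (x - ν • e)
    have e2 : x - ν • e - x = -(ν • e) := by abel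
    rw [add_sub_cancel_left, inner_smul_right] at a1 a2
    rw [e2, inner_neg_right, inner_smul_right] at b1 b2
    rw [norm_smul, hen, Real.norm_of_nonneg hν.le, mul_one] at a2
    rw [norm_neg, norm_smul, hen, Real.norm_of_nonneg hν.le, mul_one] at b2
    rw [PiLp.sub_apply, coordEst_apply, hg', ← he]
    refine sq_le_sq' ?_ ?_
    · rw [neg_le_sub_iff_le_add, ← sub_le_iff_le_add, le_div_iff₀ (by positivity)]; nlinarith
    · rw [sub_le_iff_le_add, div_le_iff₀ (by positivity)]; nlinarith
  calc _ ≤ ∑ _j : Fin d, (L * ν / 2) ^ 2 := Finset.sum_le_sum fun j _ => h j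
    _ = _ := by simp; ring

theorem norm_coordEst_sub_smoothedGradient_sq_le (hL : 0 < L) (hg : SmoothConvex L g) (μ : ℝ)
    {ν : ℝ} (hν : 0 < ν) (x : Space d) :
    ‖coordEst ν g x - smoothedGradient μ g x‖ ^ 2 ≤ ZOVarag.pivotErr d L μ ν := by
  have h1 := hg.norm_coordEst_sub_sq_le hν x
  have h2 := hg.norm_smoothedGradient_sub_sq_le hL μ x
  have h3 : ‖coordEst ν g x - smoothedGradient μ g x‖
      ≤ ‖coordEst ν g x - gradient g x‖ + ‖smoothedGradient μ g x - gradient g x‖ := by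
    rw [norm_sub_rev (smoothedGradient μ g x)]
    exact norm_sub_le_norm_sub_add_norm_sub _ _ _
  have h4 : ‖coordEst ν g x - smoothedGradient μ g x‖ ^ 2
      ≤ (‖coordEst ν g x - gradient g x‖ + ‖smoothedGradient μ g x - gradient g x‖) ^ 2 := by
    gcongr
  -- Fits the smoothing error 2L²μ²d into the term μ²L²(d+3)³/2 of `pivotErr`.
  have h5 : (d : ℝ) * 4 ≤ (d + 3) ^ 3 := by
    have : (0 : ℝ) ≤ d := by positivity
    nlinarith [pow_nonneg this 3, pow_nonneg this 2]
  have h6 : L ^ 2 * μ ^ 2 * (d * 4) ≤ L ^ 2 * μ ^ 2 * ((d : ℝ) + 3) ^ 3 :=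
    mul_le_mul_of_nonneg_left h5 (by positivity)
  have h7 : 0 ≤ L ^ 2 * d * ν ^ 2 := by positivity
  rw [ZOVarag.pivotErr]
  nlinarith [sq_nonneg (‖coordEst ν g x - gradient g x‖ - ‖smoothedGradient μ g x - gradient g x‖)]

end SmoothConvex

/-! ### The finite average of smooth convex functions. -/

section Objective

variable {d n : ℕ} {f : Fin n → Space d → ℝ} {L μ : ℝ}

theorem hasGradientAt_objective (hf : ∀ i, SmoothConvex L (f i)) (x : Space d) :
    HasGradientAt (objective f) ((1 / (n : ℝ)) • ∑ i, gradient (f i) x) x := by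
  have h := (HasFDerivAt.fun_sum (u := Finset.univ) fun i _ =>
    ((hf i).hasGradientAt x).hasFDerivAt).const_mul (1 / (n : ℝ))
  rw [hasGradientAt_iff_hasFDerivAt]
  refine h.congr_fderiv ?_
  rw [map_smul, map_sum]

theorem smoothConvex_objective (hn : 0 < n) (hf : ∀ i, SmoothConvex L (f i)) :
    SmoothConvex L (objective f) := by
  have hn' : (0 : ℝ) < n := by exact_mod_cast hn
  refine ⟨?_, fun x => (hasGradientAt_objective hf x).differentiableAt, fun x y => ?_⟩
  · have h : ConvexOn ℝ Set.univ (fun x => ∑ i, f i x) := by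
      refine ⟨convex_univ, fun x _ y _ a b ha hb hab => ?_⟩
      simp only [smul_eq_mul, Finset.mul_sum, ← Finset.sum_add_distrib]
      exact Finset.sum_le_sum fun i _ => (hf i).convex.2 trivial trivial ha hb hab
    exact h.smul (by positivity : (0 : ℝ) ≤ 1 / n)
  · rw [(hasGradientAt_objective hf x).gradient, (hasGradientAt_objective hf y).gradient, ← smul_sub,
      ← Finset.sum_sub_distrib, norm_smul, Real.norm_of_nonneg (by positivity)]
    have : ‖∑ i, (gradient (f i) x - gradient (f i) y)‖ ≤ ∑ _i : Fin n, L * ‖x - y‖ :=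
      norm_sum_le_of_le _ fun i _ => (hf i).lipschitz x y
    simp only [Finset.sum_const, Finset.card_univ, Fintype.card_fin, nsmul_eq_mul] at this
    rw [div_mul_eq_mul_div, one_mul, div_le_iff₀ hn']
    linarith

theorem smoothed_objective (hL : 0 < L) (hf : ∀ i, SmoothConvex L (f i)) (x : Space d) :
    smoothed μ (objective f) x = (1 / (n : ℝ)) * ∑ i, smoothed μ (f i) x := by
  unfold smoothed objective
  rw [integral_const_mul, integral_finsetSum _ fun i _ => (hf i).integrable_shift hL μ x]

theorem smoothedGradient_objective (hL : 0 < L) (hf : ∀ i, SmoothConvex L (f i)) (x : Space d) :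
    smoothedGradient μ (objective f) x = (1 / (n : ℝ)) • ∑ i, smoothedGradient μ (f i) x := by
  unfold smoothedGradient
  simp_rw [fun z => (hasGradientAt_objective hf z).gradient]
  rw [integral_smul, integral_finsetSum _ fun i _ => (hf i).integrable_gradient_shift hL μ x]

end Objective

/-! ### One random sample: mean and second moment of the variance-reduced estimator. -/

section Sampling

variable {d n : ℕ}

/-- The law of one sample: a standard Gaussian vector and an independent uniform index. -/
abbrev sampleLaw (d n : ℕ) : Measure (Space d × Fin n) :=
  (stdGaussian (Space d)).prod (uniformOn (Set.univ : Set (Fin n)))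

theorem integrable_sampleLaw (hn : 0 < n) {G : Type*} [NormedAddCommGroup G]
    {h : Space d × Fin n → G} (hm : AEStronglyMeasurable h (sampleLaw d n))
    (hi : ∀ i, Integrable (fun u => h (u, i)) (stdGaussian (Space d))) :
    Integrable h (sampleLaw d n) := by
  have : Nonempty (Fin n) := ⟨⟨0, hn⟩⟩
  exact (integrable_prod_iff' hm).2 ⟨.of_forall hi, .of_finite⟩

theorem integral_sampleLaw (hn : 0 < n) {G : Type*} [NormedAddCommGroup G] [NormedSpace ℝ G]
    [CompleteSpace G] {h : Space d × Fin n → G} (hi : Integrable h (sampleLaw d n)) :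
    ∫ z, h z ∂(sampleLaw d n)
      = (1 / (n : ℝ)) • ∑ i, ∫ u, h (u, i) ∂(stdGaussian (Space d)) := by
  have : Nonempty (Fin n) := ⟨⟨0, hn⟩⟩
  rw [integral_prod_symm _ hi, integral_fintype .of_finite, Finset.smul_sum]
  refine Finset.sum_congr rfl fun i _ => ?_
  congr 1
  rw [Measure.real, uniformOn_univ]
  simp

/-- Recentred variance-reduced gradient estimator. -/
def reducedEst {d n : ℕ} (f : Fin n → Space d → ℝ) (μ : ℝ) (y xt : Space d)
    (z : Space d × Fin n) : Space d :=
  gaussEst μ (f z.2) y z.1 - gaussEst μ (f z.2) xt z.1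

variable {f : Fin n → Space d → ℝ} {L μ : ℝ}

/-- Joint measurability reduces to continuity for each fixed index, because the index set is finite.
-/
theorem measurable_reducedEst (hf : ∀ i, Continuous (f i)) :
    Measurable fun w : (Space d × Space d) × (Space d × Fin n) =>
      reducedEst f μ w.1.1 w.1.2 w.2 := by
  have hg : ∀ i, Measurable fun v : Space d × Space d => gaussEst μ (f i) v.1 v.2 := fun i => by
    have := hf i
    unfold gaussEst
    fun_prop
  have h : Measurable fun w : (Space d × Space d) × Fin n => gaussEst μ (f w.2) w.1.1 w.1.2 :=
    measurable_from_prod_countable_left hg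
  have h1 := h.comp (f := fun w : (Space d × Space d) × (Space d × Fin n) =>
    ((w.1.1, w.2.1), w.2.2)) (by fun_prop)
  have h2 := h.comp (f := fun w : (Space d × Space d) × (Space d × Fin n) =>
    ((w.1.2, w.2.1), w.2.2)) (by fun_prop)
  exact h1.sub h2

theorem measurable_reducedEst_right (hf : ∀ i, Continuous (f i)) (y xt : Space d) :
    Measurable (reducedEst f μ y xt) := by
  have h := (measurable_reducedEst (μ := μ) hf).comp
    (f := fun z : Space d × Fin n => ((y, xt), z)) (by fun_prop)
  exact h

theorem integrable_reducedEst (hn : 0 < n) (hL : 0 < L) (hf : ∀ i, SmoothConvex L (f i))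
    (y xt : Space d) : Integrable (reducedEst f μ y xt) (sampleLaw d n) :=
  integrable_sampleLaw hn
    (measurable_reducedEst_right (fun i => (hf i).continuous) y xt).aestronglyMeasurable
    fun i => ((hf i).integrable_gaussEst hL μ y).sub ((hf i).integrable_gaussEst hL μ xt)

theorem integral_reducedEst (hn : 0 < n) (hL : 0 < L) (hμ : 0 < μ)
    (hf : ∀ i, SmoothConvex L (f i)) (y xt : Space d) :
    ∫ z, reducedEst f μ y xt z ∂(sampleLaw d n)
      = smoothedGradient μ (objective f) y - smoothedGradient μ (objective f) xt := by
  rw [integral_sampleLaw hn (integrable_reducedEst hn hL hf y xt), smoothedGradient_objective hL hf,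
    smoothedGradient_objective hL hf, ← smul_sub, ← Finset.sum_sub_distrib]
  congr 1
  refine Finset.sum_congr rfl fun i _ => ?_
  simp only [reducedEst]
  rw [integral_sub ((hf i).integrable_gaussEst hL μ y) ((hf i).integrable_gaussEst hL μ xt),
    (hf i).integral_gaussEst hL hμ.ne', (hf i).integral_gaussEst hL hμ.ne']

theorem integrable_reducedEst_sq (hn : 0 < n) (hL : 0 < L) (hf : ∀ i, SmoothConvex L (f i))
    (y xt : Space d) : Integrable (fun z => ‖reducedEst f μ y xt z‖ ^ 2) (sampleLaw d n) :=
  integrable_sampleLaw hn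
    ((measurable_reducedEst_right (fun i => (hf i).continuous) y xt).norm.pow_const
      2).aestronglyMeasurable
    fun i => (hf i).integrable_gaussEst_sub_sq hL μ y xt

/-- The Bregman divergence is linear in the function, so the componentwise bounds average to the
divergence of the smoothed objective. -/
theorem integral_reducedEst_sq_le (hn : 0 < n) (hL : 0 < L) (hμ : 0 < μ)
    (hf : ∀ i, SmoothConvex L (f i)) (y xt : Space d) :
    ∫ z, ‖reducedEst f μ y xt z‖ ^ 2 ∂(sampleLaw d n)
      ≤ 8 * L * (d + 2) * (smoothed μ (objective f) xt - smoothed μ (objective f) y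
          - inner ℝ (smoothedGradient μ (objective f) y) (xt - y))
        + (16 * L ^ 2 * μ ^ 2 * d * (d + 2) + μ ^ 2 * L ^ 2 / 2 * (d * (d + 2) * (d + 4))) := by
  have hn' : (0 : ℝ) < n := by exact_mod_cast hn
  rw [integral_sampleLaw hn (integrable_reducedEst_sq hn hL hf y xt), smoothed_objective hL hf,
    smoothed_objective hL hf, smoothedGradient_objective hL hf, inner_smul_left, sum_inner,
    smul_eq_mul]
  have h := Finset.sum_le_sum fun i (_ : i ∈ Finset.univ) =>
    (hf i).integral_gaussEst_sub_sq_le hL hμ y xt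
  have h' := mul_le_mul_of_nonneg_left h (by positivity : (0 : ℝ) ≤ 1 / n)
  refine h'.trans_eq ?_
  simp only [Finset.sum_add_distrib, ← Finset.mul_sum, Finset.sum_sub_distrib, Finset.sum_const,
    Finset.card_univ, Fintype.card_fin, nsmul_eq_mul]
  simp
  field_simp

end Sampling

open ZOVarag (innerStep pivotErr errOne)

/-! ### One accelerated step with an inexact variance-reduced gradient, in a Hilbert space. -/

section Abstract

variable {E : Type*} [NormedAddCommGroup E] [InnerProductSpace ℝ E]

/-- Pointwise quadratic upper bound, in terms of the gradient estimate `G`, for the potential after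
one accelerated step. -/
theorem potential_le_quadratic {φy φnew φs L α γ τ c : ℝ} {m e y wp xs G xbar xnew : E}
    (hα : 0 < α) (hγ : 0 < γ) (hτ : 0 < τ) (hc : 0 < c)
    (hxbar : xbar = y - (α * γ / (1 + τ * γ)) • G) (hxnew : xnew = wp - (γ / (1 + τ * γ)) • G)
    (hdesc : φnew ≤ φy + inner ℝ m (xbar - y) + L / 2 * ‖xbar - y‖ ^ 2) :
    γ / α * (φnew - φs) + 1 / 2 * (1 + (τ - c) * γ) * ‖xnew - xs‖ ^ 2
      ≤ (γ / α * (φy - φs) + (1 + τ * γ) / 2 * ‖wp - xs‖ ^ 2 + γ * inner ℝ e (wp - xs)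
          + γ * ‖e‖ ^ 2 / (2 * c))
        + inner ℝ (-(γ ^ 2 / (1 + τ * γ)) • (m + e) - γ • (wp - xs)) G
        + γ ^ 2 / (2 * (1 + τ * γ)) * (1 + L * α * γ / (1 + τ * γ)) * ‖G‖ ^ 2 := by
  set β := 1 + τ * γ with hβ
  have hβ0 : 0 < β := by positivity
  set w := wp - xs with hw
  have e1 : xbar - y = -((α * γ / β) • G) := by rw [hxbar]; abel
  have e2 : xnew - xs = w - (γ / β) • G := by rw [hxnew, hw]; abel
  rw [e1, inner_neg_right, inner_smul_right, norm_neg, norm_smul, mul_pow, Real.norm_eq_abs,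
    sq_abs] at hdesc
  have hv : ‖xnew - xs‖ ^ 2 = ‖w‖ ^ 2 - 2 * (γ / β) * inner ℝ w G + (γ / β) ^ 2 * ‖G‖ ^ 2 := by
    rw [e2, norm_sub_sq_real, inner_smul_right, norm_smul, mul_pow, Real.norm_eq_abs, sq_abs]; ring
  have hev : inner ℝ e (xnew - xs) = inner ℝ e w - γ / β * inner ℝ e G := by
    rw [e2, inner_sub_right, inner_smul_right]
  -- The bias e is paired with the new iterate; this is why the potential carries τ - c instead of
  -- τ.
  have young : 0 ≤ c / 2 * ‖xnew - xs‖ ^ 2 + inner ℝ e (xnew - xs) + ‖e‖ ^ 2 / (2 * c) := by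
    have h0 : 0 ≤ ‖c • (xnew - xs) + e‖ ^ 2 := by positivity
    rw [norm_add_sq_real, inner_smul_left, norm_smul, mul_pow, Real.norm_eq_abs, sq_abs,
      real_inner_comm e] at h0
    have h1 : c / 2 * ‖xnew - xs‖ ^ 2 + inner ℝ e (xnew - xs) + ‖e‖ ^ 2 / (2 * c)
        = (c ^ 2 * ‖xnew - xs‖ ^ 2 + 2 * (c * inner ℝ e (xnew - xs)) + ‖e‖ ^ 2) / (2 * c) := by
      field_simp
    rw [h1]
    exact div_nonneg h0 (by positivity)
  have hy := mul_le_mul_of_nonneg_left young hγ.le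
  have hd := mul_le_mul_of_nonneg_left hdesc (by positivity : 0 ≤ γ / α)
  have hb : inner ℝ (-(γ ^ 2 / β) • (m + e) - γ • w) G
      = -(γ ^ 2 / β) * (inner ℝ m G + inner ℝ e G) - γ * inner ℝ w G := by
    rw [inner_sub_left, inner_smul_left, inner_smul_left, inner_add_left]; simp
  rw [hb]
  have i1 : γ / α * (φy + -(α * γ / β * inner ℝ m G) + L / 2 * ((α * γ / β) ^ 2 * ‖G‖ ^ 2))
      = γ / α * φy - γ ^ 2 / β * inner ℝ m G + γ ^ 2 / (2 * β) * (L * α * γ / β) * ‖G‖ ^ 2 := by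
    field_simp; ring
  rw [i1] at hd
  have i2 : β / 2 * ‖xnew - xs‖ ^ 2
      = β / 2 * ‖w‖ ^ 2 - γ * inner ℝ w G + γ ^ 2 / (2 * β) * ‖G‖ ^ 2 := by
    rw [hv]; field_simp
  have i3 : γ * inner ℝ e (xnew - xs) = γ * inner ℝ e w - γ ^ 2 / β * inner ℝ e G := by
    rw [hev]; field_simp
  have i4 : γ * (‖e‖ ^ 2 / (2 * c)) = γ * ‖e‖ ^ 2 / (2 * c) := by ring
  have i5 : 1 / 2 * (1 + (τ - c) * γ) * ‖xnew - xs‖ ^ 2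
      = β / 2 * ‖xnew - xs‖ ^ 2 - γ * (c / 2 * ‖xnew - xs‖ ^ 2) := by rw [hβ]; ring
  rw [i5, i2]
  linarith

/-- Bias–variance decomposition, with the variance of Δ replaced by its larger second moment. -/
theorem integral_norm_add_sq_le [CompleteSpace E] {Ω : Type*} [MeasurableSpace Ω] {Q : Measure Ω}
    [IsProbabilityMeasure Q]
    {Δ : Ω → E} (hi : Integrable Δ Q) (hi2 : Integrable (fun z => ‖Δ z‖ ^ 2) Q) (g : E) :
    Integrable (fun z => ‖Δ z + g‖ ^ 2) Q ∧
      ∫ z, ‖Δ z + g‖ ^ 2 ∂Q ≤ ‖(∫ z, Δ z ∂Q) + g‖ ^ 2 + ∫ z, ‖Δ z‖ ^ 2 ∂Q := by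
  have h1 : ∀ z, ‖Δ z + g‖ ^ 2 = ‖Δ z‖ ^ 2 + 2 * inner ℝ g (Δ z) + ‖g‖ ^ 2 := fun z => by
    rw [norm_add_sq_real, real_inner_comm]
  have hin : Integrable (fun z => 2 * inner ℝ g (Δ z)) Q := (hi.const_inner g).const_mul 2
  have h12 : Integrable (fun z => ‖Δ z‖ ^ 2 + 2 * inner ℝ g (Δ z)) Q := hi2.add hin
  simp_rw [h1]
  refine ⟨h12.add (integrable_const _), ?_⟩
  rw [integral_add h12 (integrable_const _), integral_add hi2 hin, integral_const_mul,
    integral_inner hi, norm_add_sq_real, real_inner_comm]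
  simp only [integral_const, probReal_univ, one_smul]
  have := sq_nonneg ‖∫ z, Δ z ∂Q‖
  linarith

/-- Convexity of the squared distance: wp is a convex combination of x and y. -/
theorem prox_dist_sq_le {b : ℝ} (hb : 0 < b) {wp x y : E}
    (hwp : wp = (1 / (1 + b)) • (x + b • y)) (xs : E) :
    (1 + b) / 2 * ‖wp - xs‖ ^ 2 ≤ 1 / 2 * ‖x - xs‖ ^ 2 + b / 2 * ‖xs - y‖ ^ 2 := by
  have hβ0 : 0 < 1 + b := by positivity
  have hw2 : (1 + b) • (wp - xs) = (x - xs) + b • (y - xs) := by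
    rw [hwp, smul_sub, smul_smul, mul_one_div_cancel hβ0.ne']; module
  have h1 : (1 + b) ^ 2 * ‖wp - xs‖ ^ 2 = ‖(x - xs) + b • (y - xs)‖ ^ 2 := by
    rw [← hw2, norm_smul, mul_pow, Real.norm_eq_abs, sq_abs]
  have h2 : ‖(x - xs) + b • (y - xs)‖ ^ 2 ≤ (1 + b) * (‖x - xs‖ ^ 2 + b * ‖y - xs‖ ^ 2) := by
    have h3 := norm_add_le (x - xs) (b • (y - xs))
    rw [norm_smul, Real.norm_of_nonneg hb.le] at h3
    refine (pow_le_pow_left₀ (norm_nonneg _) h3 2).trans ?_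
    have h5 := mul_nonneg hb.le (sq_nonneg (‖x - xs‖ - ‖y - xs‖))
    linarith
  rw [norm_sub_rev xs y]
  have h6 : (1 + b) * ((1 + b) * ‖wp - xs‖ ^ 2) ≤ (1 + b) * (‖x - xs‖ ^ 2 + b * ‖y - xs‖ ^ 2) := by
    rw [← mul_assoc, ← sq, h1]; exact h2
  have := le_of_mul_le_mul_left h6 hβ0
  linarith

/-- The direction α(wp - xs) splits into displacements from y towards xb, xt and xs. Convexity is
used at xb and strong convexity at xs; at xt the exact Bregman divergence is kept, and this negative
term later absorbs the variance. -/
theorem neg_inner_le_of_strongly_convex {φ : E → ℝ} {α γ τ : ℝ} {m wp y xb xt : E}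
    (hα : 0 < α) (hα2 : α ≤ 1 / 2) (hγ : 0 < γ) (hτ : 0 < τ)
    (hαwp : α • wp = y - (1 / 2 - α) • xb - (1 / 2 : ℝ) • xt) (xs : E)
    (hconv : ∀ z, φ y + inner ℝ m (z - y) + τ / 2 * ‖z - y‖ ^ 2 ≤ φ z) :
    -(γ * inner ℝ m (wp - xs))
      ≤ γ / α * ((1 / 2 - α) * (φ xb - φ xs) + 1 / 2 * (φ xt - φ xs)) - γ / α * (φ y - φ xs)
        - γ / α * (1 / 2 * (φ xt - φ y - inner ℝ m (xt - y))) - τ * γ / 2 * ‖xs - y‖ ^ 2 := by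
  have h1 : α • (wp - xs)
      = -((1 / 2 - α) • (xb - y) + (1 / 2 : ℝ) • (xt - y) + α • (xs - y)) := by
    rw [smul_sub, hαwp]; module
  have h2 : α * inner ℝ m (wp - xs) = -((1 / 2 - α) * inner ℝ m (xb - y)
      + 1 / 2 * inner ℝ m (xt - y) + α * inner ℝ m (xs - y)) := by
    rw [← inner_smul_right, h1, inner_neg_right, inner_add_right, inner_add_right,
      inner_smul_right, inner_smul_right, inner_smul_right]
  have haα : γ / α * α = γ := div_mul_cancel₀ _ hα.ne'
  have h3 : -(γ * inner ℝ m (wp - xs)) = γ / α * (-(α * inner ℝ m (wp - xs))) := by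
    linear_combination inner ℝ m (wp - xs) * haα
  have h4 := hconv xb
  have h5 : 0 ≤ τ / 2 * ‖xb - y‖ ^ 2 := by positivity
  have h6 := mul_le_mul_of_nonneg_left (show inner ℝ m (xb - y) ≤ φ xb - φ y by linarith)
    (show 0 ≤ 1 / 2 - α by linarith)
  have h7 := mul_le_mul_of_nonneg_left (show inner ℝ m (xs - y)
    ≤ φ xs - φ y - τ / 2 * ‖xs - y‖ ^ 2 by linarith [hconv xs]) hα.le
  have h8 : -(α * inner ℝ m (wp - xs)) ≤ (1 / 2 - α) * (φ xb - φ y)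
      + 1 / 2 * (φ xt - φ y - (φ xt - φ y - inner ℝ m (xt - y)))
      + α * (φ xs - φ y - τ / 2 * ‖xs - y‖ ^ 2) := by linarith
  rw [h3]
  refine (mul_le_mul_of_nonneg_left h8 (by positivity : 0 ≤ γ / α)).trans_eq ?_
  linear_combination (-(τ / 2) * ‖xs - y‖ ^ 2) * haα

/-- Expected decrease of the potential over one accelerated step with an inexact, variance-reduced
gradient estimate `Δ + gt`. -/
theorem integral_potential_le [CompleteSpace E] {Ω : Type*} [MeasurableSpace Ω] {Q : Measure Ω}
    [IsProbabilityMeasure Q] {φ : E → ℝ} {L α γ τ c V R : ℝ} {m mt gt x xb xt xs y wp : E}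
    {Δ : Ω → E} {xnew xbar : Ω → E}
    (hα : 0 < α) (hα2 : α ≤ 1 / 2) (hγ : 0 < γ) (hτ : 0 < τ) (hc : 0 < c) (hcτ : c ≤ τ) (hL : 0 < L)
    (hκ : L * α * γ ≤ 1)
    (hV : γ * α * (1 + L * α * γ) * V ≤ 1) (hV0 : 0 ≤ V) (hR0 : 0 ≤ R)
    (hφ : Continuous φ) (hmin : ∀ z, φ xs ≤ φ z)
    (hdesc : ∀ z, φ z ≤ φ y + inner ℝ m (z - y) + L / 2 * ‖z - y‖ ^ 2)
    (hconv : ∀ z, φ y + inner ℝ m (z - y) + τ / 2 * ‖z - y‖ ^ 2 ≤ φ z)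
    (hwp : wp = (1 / (1 + τ * γ)) • (x + (τ * γ) • y))
    (hαwp : α • wp = y - (1 / 2 - α) • xb - (1 / 2 : ℝ) • xt)
    (hΔ : Integrable Δ Q) (hΔ2 : Integrable (fun z => ‖Δ z‖ ^ 2) Q)
    (hmean : ∫ z, Δ z ∂Q = m - mt)
    (hsq : ∫ z, ‖Δ z‖ ^ 2 ∂Q ≤ V * (φ xt - φ y - inner ℝ m (xt - y)) + R)
    (hxbar : ∀ z, xbar z = y - (α * γ / (1 + τ * γ)) • (Δ z + gt))
    (hxnew : ∀ z, xnew z = wp - (γ / (1 + τ * γ)) • (Δ z + gt)) :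
    Integrable (fun z => γ / α * (φ (xbar z) - φ xs)
        + 1 / 2 * (1 + (τ - c) * γ) * ‖xnew z - xs‖ ^ 2) Q ∧
      ∫ z, (γ / α * (φ (xbar z) - φ xs) + 1 / 2 * (1 + (τ - c) * γ) * ‖xnew z - xs‖ ^ 2) ∂Q
        ≤ γ / α * ((1 / 2 - α) * (φ xb - φ xs) + 1 / 2 * (φ xt - φ xs)) + 1 / 2 * ‖x - xs‖ ^ 2
          + (γ * ‖gt - mt‖ ^ 2 / (2 * c) + γ ^ 2 * R) := by
  have hpt : ∀ z, _ := fun z => potential_le_quadratic (φs := φ xs) (e := gt - mt) (xs := xs)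
    hα hγ hτ hc (hxbar z) (hxnew z) (hdesc (xbar z))
  set β := 1 + τ * γ with hβ
  have hβ1 : 1 ≤ β := by rw [hβ]; linarith [mul_pos hτ hγ]
  have hβ0 : 0 < β := by linarith
  set e := gt - mt with he
  set w := wp - xs with hw
  set C0 := γ / α * (φ y - φ xs) + β / 2 * ‖w‖ ^ 2 + γ * inner ℝ e w + γ * ‖e‖ ^ 2 / (2 * c) with hC0
  set b := -(γ ^ 2 / β) • (m + e) - γ • w with hb
  set A := γ ^ 2 / (2 * β) * (1 + L * α * γ / β) with hA
  have hA0 : 0 ≤ A := by positivity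
  obtain ⟨hG2, hG2le⟩ := integral_norm_add_sq_le hΔ hΔ2 gt
  have hGint : Integrable (fun z => Δ z + gt) Q := hΔ.add (integrable_const _)
  have hin : Integrable (fun z => inner ℝ b (Δ z + gt)) Q := hGint.const_inner b
  have hCin : Integrable (fun z => C0 + inner ℝ b (Δ z + gt)) Q := (integrable_const _).add hin
  have hQ : Integrable (fun z => C0 + inner ℝ b (Δ z + gt) + A * ‖Δ z + gt‖ ^ 2) Q :=
    hCin.add (hG2.const_mul A)
  have hcoef : 0 ≤ 1 / 2 * (1 + (τ - c) * γ) := by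
    have : 0 ≤ (τ - c) * γ := mul_nonneg (by linarith) hγ.le
    linarith
  have hnn : ∀ z, 0 ≤ γ / α * (φ (xbar z) - φ xs)
      + 1 / 2 * (1 + (τ - c) * γ) * ‖xnew z - xs‖ ^ 2 := fun z => by
    have := sub_nonneg.2 (hmin (xbar z))
    positivity
  have hmeas : AEStronglyMeasurable (fun z => γ / α * (φ (xbar z) - φ xs)
      + 1 / 2 * (1 + (τ - c) * γ) * ‖xnew z - xs‖ ^ 2) Q := by
    have h1 : Continuous fun G : E => γ / α * (φ (y - (α * γ / β) • G) - φ xs)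
      + 1 / 2 * (1 + (τ - c) * γ) * ‖wp - (γ / β) • G - xs‖ ^ 2 := by fun_prop
    simp_rw [hxbar, hxnew]
    exact h1.comp_aestronglyMeasurable hGint.aestronglyMeasurable
  refine ⟨hQ.mono' hmeas (.of_forall fun z => ?_), ?_⟩
  · rw [Real.norm_of_nonneg (hnn z)]; exact hpt z
  have hle := integral_mono_of_nonneg (.of_forall hnn) hQ (.of_forall hpt)
  refine hle.trans ?_
  rw [integral_add hCin (hG2.const_mul A), integral_add (integrable_const _) hin,
    integral_const_mul, integral_inner hGint, integral_add hΔ (integrable_const _), hmean]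
  simp only [integral_const, probReal_univ, one_smul]
  rw [hmean] at hG2le
  have hge : m - mt + gt = m + e := by rw [he]; abel
  rw [hge] at hG2le ⊢
  set g := m + e with hg
  set D := φ xt - φ y - inner ℝ m (xt - y) with hD
  have hD0 : 0 ≤ D := by
    have := hconv xt
    have h2 : 0 ≤ τ / 2 * ‖xt - y‖ ^ 2 := by positivity
    rw [hD]; linarith
  have hbg : inner ℝ b g = -(γ ^ 2 / β) * ‖g‖ ^ 2 - γ * (inner ℝ m w + inner ℝ e w) := by
    rw [hb, inner_sub_left, real_inner_smul_left, real_inner_smul_left, real_inner_self_eq_norm_sq,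
      real_inner_comm g w, ← inner_add_left]
  have hκβ : L * α * γ / β ≤ L * α * γ := div_le_self (by positivity) hβ1
  have hAle : A ≤ γ ^ 2 / 2 * (1 + L * α * γ) := by
    rw [hA]
    have : γ ^ 2 / (2 * β) ≤ γ ^ 2 / 2 :=
      div_le_div_of_nonneg_left (by positivity) (by norm_num) (by linarith)
    gcongr
  -- With this, the A‖g‖² coming from the second moment is cancelled by the -(γ²/β)‖g‖² in the mean
  -- of the linear term (`hbg`).
  have hAβ : A ≤ γ ^ 2 / β := by
    rw [hA]
    calc γ ^ 2 / (2 * β) * (1 + L * α * γ / β) ≤ γ ^ 2 / (2 * β) * 2 := by gcongr; linarith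
      _ = γ ^ 2 / β := by field_simp
  have hAR : A * R ≤ γ ^ 2 * R := by
    refine mul_le_mul_of_nonneg_right (hAβ.trans (div_le_self (by positivity) hβ1)) hR0
  -- The variance is absorbed here: its Bregman part is at most the slack left by the weight 1/2 of
  -- the pivot.
  have hAV : A * (V * D) ≤ γ / α * (1 / 2 * D) := by
    have h1 : A * V ≤ γ / α * (1 / 2) := by
      calc A * V ≤ γ ^ 2 / 2 * (1 + L * α * γ) * V := by gcongr
        _ = γ / α * (1 / 2) * (γ * α * (1 + L * α * γ) * V) := by field_simp
        _ ≤ γ / α * (1 / 2) * 1 := by gcongr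
        _ = _ := by ring
    calc A * (V * D) = A * V * D := by ring
      _ ≤ γ / α * (1 / 2) * D := by gcongr
      _ = _ := by ring
  have hAG : A * ∫ z, ‖Δ z + gt‖ ^ 2 ∂Q ≤ γ ^ 2 / β * ‖g‖ ^ 2 + γ / α * (1 / 2 * D) + γ ^ 2 * R := by
    calc _ ≤ A * (‖g‖ ^ 2 + (V * D + R)) := by gcongr; linarith
      _ = A * ‖g‖ ^ 2 + A * (V * D) + A * R := by ring
      _ ≤ _ := by gcongr
  have hwβ : β / 2 * ‖w‖ ^ 2 ≤ 1 / 2 * ‖x - xs‖ ^ 2 + τ * γ / 2 * ‖xs - y‖ ^ 2 :=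
    prox_dist_sq_le (mul_pos hτ hγ) hwp xs
  have hmw := neg_inner_le_of_strongly_convex hα hα2 hγ hτ hαwp xs hconv
  rw [← hw, ← hD] at hmw
  rw [hbg, hC0]
  linarith

end Abstract

/-! ### The inner iteration of ZO-Varag as an instance of the abstract step. -/

section InnerStep

variable {d n : ℕ} {f : Fin n → Space d → ℝ} {L μ ν τ : ℝ}

/-- Expected decrease of the potential over one inner iteration of ZO-Varag. -/
theorem integral_innerStep_le (hn : 0 < n) (hL : 0 < L) (hτ : 0 < τ) (hμ : 0 < μ) (hν : 0 < ν)
    (hf : ∀ i, SmoothConvex L (f i))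
    (hs : ∀ x y, objective f x + inner ℝ (gradient (objective f) x) (y - x)
      + τ / 2 * ‖y - x‖ ^ 2 ≤ objective f y)
    {xs : Space d} (hmin : ∀ z, smoothed μ (objective f) xs ≤ smoothed μ (objective f) z)
    {α γ c : ℝ} (hα : 0 < α) (hα2 : α ≤ 1 / 2) (hγ : 0 < γ)
    (hαγ : 12 * ((d : ℝ) + 4) * L * (α * γ) = 1) (hc : 0 < c) (hcτ : c ≤ τ)
    (z : Space d × Space d) (xt : Space d) :
    Integrable (fun w : Space d × Fin n =>
      γ / α * (smoothed μ (objective f) (innerStep f τ μ α γ (1 / 2) xt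
          (coordEst ν (objective f) xt) z w.1 w.2).2 - smoothed μ (objective f) xs)
        + 1 / 2 * (1 + (τ - c) * γ) * ‖(innerStep f τ μ α γ (1 / 2) xt
          (coordEst ν (objective f) xt) z w.1 w.2).1 - xs‖ ^ 2) (sampleLaw d n) ∧
    ∫ w : Space d × Fin n, (γ / α * (smoothed μ (objective f) (innerStep f τ μ α γ (1 / 2) xt
          (coordEst ν (objective f) xt) z w.1 w.2).2 - smoothed μ (objective f) xs)
        + 1 / 2 * (1 + (τ - c) * γ) * ‖(innerStep f τ μ α γ (1 / 2) xt
          (coordEst ν (objective f) xt) z w.1 w.2).1 - xs‖ ^ 2) ∂(sampleLaw d n)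
      ≤ γ / α * ((1 / 2 - α) * (smoothed μ (objective f) z.2 - smoothed μ (objective f) xs)
          + 1 / 2 * (smoothed μ (objective f) xt - smoothed μ (objective f) xs))
        + 1 / 2 * ‖z.1 - xs‖ ^ 2
        + γ / α * (α * pivotErr d L μ ν / (2 * c) + errOne d L μ) := by
  have : Nonempty (Fin n) := ⟨⟨0, hn⟩⟩
  have hobj := smoothConvex_objective hn hf
  have hβ0 : 0 < 1 + τ * γ := by positivity
  have hD0 : 0 < 1 + τ * γ * (1 - α) := by
    have : 0 < 1 - α := by linarith
    positivity
  set y : Space d := (1 / (1 + τ * γ * (1 - α))) •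
    (((1 + τ * γ) * (1 - α - 1 / 2)) • z.2 + α • z.1 + ((1 + τ * γ) * (1 / 2)) • xt) with hy
  have hy' : α • z.1 = (1 + τ * γ * (1 - α)) • y
      - ((1 + τ * γ) * (1 / 2 - α)) • z.2 - ((1 + τ * γ) * (1 / 2)) • xt := by
    rw [hy, smul_smul, mul_one_div_cancel hD0.ne']; module
  -- The weights defining x_under are chosen for this: averaging the gradient-free proximal point
  -- with x̄ and the pivot returns y itself, so the new average is y minus a multiple of the
  -- gradient estimate.
  have hwp : α • ((1 / (1 + τ * γ)) • (z.1 + (τ * γ) • y))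
      = y - (1 / 2 - α) • z.2 - (1 / 2 : ℝ) • xt := by
    have h1 : α • ((1 / (1 + τ * γ)) • (z.1 + (τ * γ) • y))
        = (1 / (1 + τ * γ)) • (α • z.1 + (α * (τ * γ)) • y) := by module
    rw [h1, hy']
    have h2 : (1 + τ * γ * (1 - α)) • y - ((1 + τ * γ) * (1 / 2 - α)) • z.2
        - ((1 + τ * γ) * (1 / 2)) • xt + (α * (τ * γ)) • y
        = (1 + τ * γ) • (y - (1 / 2 - α) • z.2 - (1 / 2 : ℝ) • xt) := by module
    rw [h2, smul_smul, one_div_mul_cancel hβ0.ne', one_smul]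
  have hd0 : (0 : ℝ) ≤ d := by positivity
  have hκ : L * α * γ ≤ 1 / 48 := by
    have : 0 < L * (α * γ) := by positivity
    nlinarith [mul_nonneg hd0 this.le]
  have hxnew : ∀ w : Space d × Fin n, (innerStep f τ μ α γ (1 / 2) xt
      (coordEst ν (objective f) xt) z w.1 w.2).1
      = (1 / (1 + τ * γ)) • (z.1 + (τ * γ) • y)
        - (γ / (1 + τ * γ)) • (reducedEst f μ y xt w + coordEst ν (objective f) xt) := fun w => by
    simp only [innerStep, ← hy, reducedEst]
    rw [mul_comm γ τ]
    module
  have hxbar : ∀ w : Space d × Fin n, (innerStep f τ μ α γ (1 / 2) xt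
      (coordEst ν (objective f) xt) z w.1 w.2).2
      = y - (α * γ / (1 + τ * γ)) • (reducedEst f μ y xt w + coordEst ν (objective f) xt) :=
    fun w => by
      have h1 : (innerStep f τ μ α γ (1 / 2) xt (coordEst ν (objective f) xt) z w.1 w.2).2
        = (1 - α - 1 / 2) • z.2 + α • (innerStep f τ μ α γ (1 / 2) xt
          (coordEst ν (objective f) xt) z w.1 w.2).1 + (1 / 2 : ℝ) • xt := rfl
      rw [h1, hxnew, smul_sub, hwp]
      module
  have h := integral_potential_le (Q := sampleLaw d n) (φ := smoothed μ (objective f))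
    (V := 8 * L * (d + 2))
    (R := 16 * L ^ 2 * μ ^ 2 * d * (d + 2) + μ ^ 2 * L ^ 2 / 2 * (d * (d + 2) * (d + 4)))
    (x := z.1) (xs := xs) (L := L)
    hα hα2 hγ hτ hc hcτ hL (by linarith) (by
      have h1 : 0 < L * (α * γ) := by positivity
      have h2 : γ * α * (1 + L * α * γ) * (8 * L * (d + 2))
          = 8 * (d + 2) * (L * (α * γ)) * (1 + L * α * γ) := by ring
      rw [h2]
      -- Follows from 12(d+4)Lαγ = 1; together with Lαγ ≤ 1/48 the product is at most (2/3)(49/48) <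
      -- 1.
      have h3 : 8 * ((d : ℝ) + 2) * (L * (α * γ)) ≤ 2 / 3 := by nlinarith
      have h4 : 0 ≤ 8 * ((d : ℝ) + 2) * (L * (α * γ)) := by positivity
      nlinarith) (by positivity) (by positivity)
    (hobj.continuous_smoothed hL μ) hmin (hobj.smoothed_descent hL μ y)
    (hobj.smoothed_quadratic_le hL μ hs y) rfl hwp (integrable_reducedEst hn hL hf y xt)
    (integrable_reducedEst_sq hn hL hf y xt) (integral_reducedEst hn hL hμ hf y xt)
    (integral_reducedEst_sq_le hn hL hμ hf y xt) hxbar hxnew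
  refine ⟨h.1, h.2.trans ?_⟩
  have hE := hobj.norm_coordEst_sub_smoothedGradient_sq_le hL μ hν xt
  have h1 : γ * ‖coordEst ν (objective f) xt - smoothedGradient μ (objective f) xt‖ ^ 2 / (2 * c)
      ≤ γ / α * (α * pivotErr d L μ ν / (2 * c)) := by
    have : γ / α * (α * pivotErr d L μ ν / (2 * c)) = γ * pivotErr d L μ ν / (2 * c) := by
      field_simp
    rw [this]; gcongr
  have h2 : γ ^ 2 * (16 * L ^ 2 * μ ^ 2 * d * (d + 2) + μ ^ 2 * L ^ 2 / 2 * (d * (d + 2) * (d + 4)))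
      ≤ γ / α * errOne d L μ := by
    -- The factor 12(d+4)L is the one that turns γ² into γ/α.
    have h3 : (16 * L ^ 2 * μ ^ 2 * d * (d + 2) + μ ^ 2 * L ^ 2 / 2 * (d * (d + 2) * (d + 4)))
        ≤ 12 * (d + 4) * L * errOne d L μ := by
      rw [errOne]
      have h4 : (16 * (d : ℝ) * (d + 2) + 1 / 2 * (d * (d + 2) * (d + 4))) ≤ 12 * (d + 4) ^ 3 := by
        nlinarith [pow_nonneg hd0 3, pow_nonneg hd0 2]
      have h5 := mul_le_mul_of_nonneg_left h4 (by positivity : 0 ≤ L ^ 2 * μ ^ 2)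
      linarith
    calc _ ≤ γ ^ 2 * (12 * (d + 4) * L * errOne d L μ) := by gcongr
      _ = γ / α * errOne d L μ * (12 * (d + 4) * L * (α * γ)) := by field_simp
      _ = _ := by rw [hαγ, mul_one]
  have h3 := add_le_add h1 h2
  rw [← mul_add] at h3
  linarith

end InnerStep

/-! ### Fresh samples: conditioning, measurability and independence. -/

open ZOVarag (Params varag)

/-- Integrating out a fresh sample: a one-step bound on the conditional expectation gives a bound on
the expectation. -/
theorem integral_fresh_le {Ω S X : Type*} [MeasurableSpace Ω] [MeasurableSpace S]
    [MeasurableSpace X] {P : Measure Ω} [IsProbabilityMeasure P] {Q : Measure X}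
    [IsProbabilityMeasure Q] {Z : Ω → S} {ξ : Ω → X} (hZ : Measurable Z) (hξ : Measurable ξ)
    (hind : IndepFun Z ξ P) (hlaw : P.map ξ = Q) {Φ : S → X → ℝ}
    (hΦ : Measurable (Function.uncurry Φ)) (hΦ0 : ∀ s x, 0 ≤ Φ s x) {Ψ : S → ℝ} (hΨ : Measurable Ψ)
    (hstep : ∀ s, Integrable (Φ s) Q ∧ ∫ x, Φ s x ∂Q ≤ Ψ s)
    (hΨi : Integrable (fun ω => Ψ (Z ω)) P) :
    Integrable (fun ω => Φ (Z ω) (ξ ω)) P ∧ ∫ ω, Φ (Z ω) (ξ ω) ∂P ≤ ∫ ω, Ψ (Z ω) ∂P := by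
  have hmap : P.map (fun ω => (Z ω, ξ ω)) = (P.map Z).prod Q := by
    rw [← hlaw]
    exact (indepFun_iff_map_prod_eq_prod_map_map hZ.aemeasurable hξ.aemeasurable).1 hind
  have : IsProbabilityMeasure (P.map Z) := Measure.isProbabilityMeasure_map hZ.aemeasurable
  have hpair : Measurable fun ω => (Z ω, ξ ω) := hZ.prodMk hξ
  have hΨi' : Integrable Ψ (P.map Z) :=
    (integrable_map_measure hΨ.aestronglyMeasurable hZ.aemeasurable).2 hΨi
  have hmeas : StronglyMeasurable fun s => ∫ x, Φ s x ∂Q :=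
    hΦ.stronglyMeasurable.integral_prod_right
  have hI : Integrable (fun s => ∫ x, Φ s x ∂Q) (P.map Z) := by
    refine hΨi'.mono' hmeas.aestronglyMeasurable (.of_forall fun s => ?_)
    rw [Real.norm_of_nonneg (integral_nonneg (hΦ0 s))]
    exact (hstep s).2
  have hint : Integrable (Function.uncurry Φ) ((P.map Z).prod Q) := by
    refine (integrable_prod_iff hΦ.aestronglyMeasurable).2
      ⟨.of_forall fun s => (hstep s).1, ?_⟩
    refine hI.congr (.of_forall fun s => integral_congr_ae (.of_forall fun x => ?_))
    exact (Real.norm_of_nonneg (hΦ0 s x)).symm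
  refine ⟨?_, ?_⟩
  · rw [← hmap] at hint
    exact (integrable_map_measure hΦ.aestronglyMeasurable hpair.aemeasurable).1 hint
  · have h1 : ∫ ω, Φ (Z ω) (ξ ω) ∂P = ∫ w, Function.uncurry Φ w ∂((P.map Z).prod Q) := by
      rw [← hmap, integral_map hpair.aemeasurable hΦ.aestronglyMeasurable]
      rfl
    rw [h1, integral_prod _ hint, ← integral_map hZ.aemeasurable hΨ.aestronglyMeasurable]
    exact integral_mono hI hΨi' fun s => (hstep s).2

section Measurability

variable {d n : ℕ} {f : Fin n → Space d → ℝ}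

theorem continuous_coordEst {g : Space d → ℝ} (hg : Continuous g) (ν : ℝ) :
    Continuous (coordEst ν g) := by
  unfold coordEst
  fun_prop

theorem continuous_objective (hf : ∀ i, Continuous (f i)) : Continuous (objective f) := by
  unfold objective
  fun_prop

theorem measurable_innerStep (hf : ∀ i, Continuous (f i)) (τ μ ν α γ p : ℝ) :
    Measurable fun q : ((Space d × Space d) × Space d) × (Space d × Fin n) =>
      innerStep f τ μ α γ p q.1.2 (coordEst ν (objective f) q.1.2) q.1.1 q.2.1 q.2.2 := by
  let y : ((Space d × Space d) × Space d) × (Space d × Fin n) → Space d := fun q =>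
    (1 / (1 + τ * γ * (1 - α))) •
      (((1 + τ * γ) * (1 - α - p)) • q.1.1.2 + α • q.1.1.1 + ((1 + τ * γ) * p) • q.1.2)
  have hy : Measurable y := by fun_prop
  have hc := continuous_coordEst (continuous_objective hf) ν
  have hG : Measurable fun q : ((Space d × Space d) × Space d) × (Space d × Fin n) =>
      reducedEst f μ (y q) q.1.2 q.2 + coordEst ν (objective f) q.1.2 := by
    refine Measurable.add ?_ (hc.measurable.comp (by fun_prop))
    exact (measurable_reducedEst (μ := μ) hf).comp
      (f := fun q : ((Space d × Space d) × Space d) × (Space d × Fin n) => ((y q, q.1.2), q.2))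
      (by fun_prop)
  have hx : Measurable fun q : ((Space d × Space d) × Space d) × (Space d × Fin n) =>
      (1 / (1 + γ * τ)) • (q.1.1.1 + (γ * τ) • y q
        - γ • (reducedEst f μ (y q) q.1.2 q.2 + coordEst ν (objective f) q.1.2)) := by
    fun_prop
  have hb : Measurable fun q : ((Space d × Space d) × Space d) × (Space d × Fin n) =>
      (1 - α - p) • q.1.1.2 + α • ((1 / (1 + γ * τ)) • (q.1.1.1 + (γ * τ) • y q
        - γ • (reducedEst f μ (y q) q.1.2 q.2 + coordEst ν (objective f) q.1.2))) + p • q.1.2 := by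
    fun_prop
  exact hx.prodMk hb

/-- Only samples up to time t are assumed measurable, and the σ-algebra on Ω is arbitrary. The lemma
can therefore be applied with the σ-algebra generated by the past, which is how independence is
obtained; the same holds for `measurable_varag`. -/
theorem measurable_inner {Ω : Type*} [MeasurableSpace Ω] (hf : ∀ i, Continuous (f i))
    (τ μ ν α γ p : ℝ) {xt xstart : Ω → Space d} (hxt : Measurable xt) (hxs : Measurable xstart)
    {u : ℕ → Ω → Space d} {i : ℕ → Ω → Fin n} (t : ℕ)
    (hξ : ∀ b ≤ t, Measurable fun ω => (u b ω, i b ω)) :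
    Measurable fun ω => ZOVarag.inner f τ μ α γ p (xt ω) (coordEst ν (objective f) (xt ω))
      (xstart ω) (fun b => u b ω) (fun b => i b ω) t := by
  induction t with
  | zero => exact hxs.prodMk hxt
  | succ t ih =>
    have h1 := ih fun b hb => hξ b (by omega)
    have h2 := (h1.prodMk hxt).prodMk (hξ (t + 1) le_rfl)
    have h3 := (measurable_innerStep hf τ μ ν α γ p).comp h2
    simp only [Function.comp_def] at h3
    simp only [ZOVarag.inner]
    exact h3

theorem measurable_varag {Ω : Type*} [MeasurableSpace Ω] (hf : ∀ i, Continuous (f i))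
    (τ μ ν : ℝ) (Pm : Params) (x0 : Space d) {u : ℕ → ℕ → Ω → Space d} {i : ℕ → ℕ → Ω → Fin n}
    (s : ℕ) (hξ : ∀ a ≤ s, ∀ b, Measurable fun ω => (u a b ω, i a b ω)) :
    Measurable fun ω => varag f τ μ ν Pm x0 (fun a b => u a b ω) (fun a b => i a b ω) s := by
  induction s with
  | zero => exact measurable_const
  | succ s ih =>
    have h1 := ih fun a ha => hξ a (by omega)
    have h2 := fun t => measurable_inner hf τ μ ν (Pm.α (s + 1)) (Pm.γ (s + 1)) (Pm.p (s + 1))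
      h1.snd h1.fst (u := u (s + 1)) (i := i (s + 1)) t fun b _ => hξ (s + 1) le_rfl b
    have h3 := Finset.measurable_sum (Finset.Icc 1 (Pm.T (s + 1))) fun t _ =>
      (measurable_const_smul (Pm.θ (s + 1) t)).comp (h2 t).snd
    exact (h2 (Pm.T (s + 1))).fst.prodMk ((measurable_const_smul _).comp h3)

end Measurability

section Independence

variable {d n : ℕ} {f : Fin n → Space d → ℝ} {Ω : Type*} [MeasurableSpace Ω] {P : Measure Ω}
  {u : ℕ → ℕ → Ω → Space d} {i : ℕ → ℕ → Ω → Fin n}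

/-- The state before an inner iteration is independent of the sample drawn in that iteration. -/
theorem indepFun_state (hf : ∀ i, Continuous (f i)) (τ μ ν : ℝ) (Pm : Params) (x0 : Space d)
    (hξ : ∀ a b, Measurable fun ω => (u a b ω, i a b ω))
    (hindep : iIndepFun (fun (k : ℕ × ℕ) ω => (u k.1 k.2 ω, i k.1 k.2 ω)) P) (α γ p : ℝ) (s t : ℕ) :
    IndepFun (fun ω =>
      let z := varag f τ μ ν Pm x0 (fun a b => u a b ω) (fun a b => i a b ω) s
      (ZOVarag.inner f τ μ α γ p z.2 (coordEst ν (objective f) z.2) z.1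
        (fun b => u (s + 1) b ω) (fun b => i (s + 1) b ω) t, z.2))
      (fun ω => (u (s + 1) (t + 1) ω, i (s + 1) (t + 1) ω)) P := by
  let m : ℕ × ℕ → MeasurableSpace Ω := fun k =>
    MeasurableSpace.comap (fun ω => (u k.1 k.2 ω, i k.1 k.2 ω)) inferInstance
  -- The indices of the past. The state is measurable for the σ-algebra they generate, and the
  -- current index (s+1, t+1) lies outside. Indices with a zero epoch or iteration may belong to A
  -- although the algorithm never reads those samples.
  let A : Set (ℕ × ℕ) := {k | k.1 ≤ s ∨ (k.1 = s + 1 ∧ k.2 ≤ t)}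
  have hle : ∀ k, m k ≤ ‹MeasurableSpace Ω› := fun k => (hξ k.1 k.2).comap_le
  have hdisj : Disjoint A {(s + 1, t + 1)} := by
    rw [Set.disjoint_singleton_right]
    rintro (h | ⟨-, h⟩)
    · simp at h
    · simp at h
  have hI := indep_iSup_of_disjoint hle hindep hdisj
  have hmA : ∀ k ∈ A, Measurable[⨆ k ∈ A, m k] fun ω => (u k.1 k.2 ω, i k.1 k.2 ω) := fun k hk =>
    (comap_measurable _).mono (le_iSup₂ (f := fun k (_ : k ∈ A) => m k) k hk) le_rfl
  have hv : Measurable[⨆ k ∈ A, m k] fun ω =>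
      varag f τ μ ν Pm x0 (fun a b => u a b ω) (fun a b => i a b ω) s :=
    @measurable_varag d n f Ω (⨆ k ∈ A, m k) hf τ μ ν Pm x0 u i s
      fun a ha b => hmA (a, b) (Or.inl ha)
  have hz2 := @Measurable.snd _ _ _ (⨆ k ∈ A, m k) _ _ _ hv
  have hz1 := @Measurable.fst _ _ _ (⨆ k ∈ A, m k) _ _ _ hv
  have hin := @measurable_inner d n f Ω (⨆ k ∈ A, m k) hf τ μ ν α γ p _ _ hz2 hz1
    (u (s + 1)) (i (s + 1)) t fun b hb => hmA (s + 1, b) (Or.inr ⟨rfl, hb⟩)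
  have hZ := hin.prodMk hz2
  refine indep_of_indep_of_le_left (indep_of_indep_of_le_right hI ?_) (Measurable.comap_le hZ)
  exact le_iSup₂ (f := fun k (_ : k ∈ ({(s + 1, t + 1)} : Set (ℕ × ℕ))) => m k) (s + 1, t + 1) rfl

end Independence

/-! ### Expected recursion along one epoch. -/

section Epoch

variable {d n : ℕ} {f : Fin n → Space d → ℝ} {L μ ν τ : ℝ}

/-- Jensen's inequality: add up the tangent inequalities at the weighted mean, where the linear
terms cancel. -/
theorem SmoothConvex.smoothed_weighted_average_le {g : Space d → ℝ} (hL : 0 < L)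
    (hg : SmoothConvex L g) (μ : ℝ) {ι : Type*} (A : Finset ι) (θ : ι → ℝ) (x : ι → Space d)
    (hθ : ∀ t ∈ A, 0 ≤ θ t) (hpos : 0 < ∑ t ∈ A, θ t) (xs : Space d) :
    (∑ t ∈ A, θ t) * (smoothed μ g ((1 / ∑ t ∈ A, θ t) • ∑ t ∈ A, θ t • x t) - smoothed μ g xs)
      ≤ ∑ t ∈ A, θ t * (smoothed μ g (x t) - smoothed μ g xs) := by
  set S := ∑ t ∈ A, θ t with hS
  set w := (1 / S) • ∑ t ∈ A, θ t • x t with hw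
  have hsum : ∑ t ∈ A, θ t • (x t - w) = 0 := by
    simp_rw [smul_sub]
    rw [Finset.sum_sub_distrib, ← Finset.sum_smul, ← hS, hw, smul_smul, mul_one_div_cancel hpos.ne',
      one_smul, sub_self]
  have h1 : ∀ t ∈ A, θ t * (smoothed μ g w - smoothed μ g xs)
      + inner ℝ (smoothedGradient μ g w) (θ t • (x t - w))
      ≤ θ t * (smoothed μ g (x t) - smoothed μ g xs) := fun t ht => by
    rw [inner_smul_right, ← mul_add]
    refine mul_le_mul_of_nonneg_left ?_ (hθ t ht)
    linarith [hg.smoothed_gradient_le hL μ w (x t)]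
  have h2 := Finset.sum_le_sum h1
  rw [Finset.sum_add_distrib, ← inner_sum, hsum, inner_zero_right, add_zero, ← Finset.sum_mul,
    ← hS] at h2
  exact h2

variable {Ω : Type*} [MeasurableSpace Ω] {P : Measure Ω} [IsProbabilityMeasure P]
  {u : ℕ → ℕ → Ω → Space d} {i : ℕ → ℕ → Ω → Fin n}

/-- The expected gaps and squared distances along the inner iterations of one epoch satisfy the
one-step recursion. -/
theorem exists_epoch_sequences (hn : 0 < n) (hL : 0 < L) (hτ : 0 < τ) (hμ : 0 < μ) (hν : 0 < ν)
    (hf : ∀ i, SmoothConvex L (f i))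
    (hs : ∀ x y, objective f x + inner ℝ (gradient (objective f) x) (y - x)
      + τ / 2 * ‖y - x‖ ^ 2 ≤ objective f y)
    {xs : Space d} (hmin : ∀ z, smoothed μ (objective f) xs ≤ smoothed μ (objective f) z)
    (hξ : ∀ a b, Measurable fun ω => (u a b ω, i a b ω))
    (hlaw : ∀ a b, P.map (fun ω => (u a b ω, i a b ω)) = sampleLaw d n)
    (hindep : iIndepFun (fun (k : ℕ × ℕ) ω => (u k.1 k.2 ω, i k.1 k.2 ω)) P)
    (Pm : Params) (x0 : Space d) (s : ℕ) (hp : Pm.p (s + 1) = 1 / 2)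
    (hα : 0 < Pm.α (s + 1)) (hα2 : Pm.α (s + 1) ≤ 1 / 2) (hγ : 0 < Pm.γ (s + 1))
    (hαγ : 12 * ((d : ℝ) + 4) * L * (Pm.α (s + 1) * Pm.γ (s + 1)) = 1)
    (hθ : ∀ t ∈ Finset.Icc 1 (Pm.T (s + 1)), 0 ≤ Pm.θ (s + 1) t)
    (hθpos : 0 < ∑ t ∈ Finset.Icc 1 (Pm.T (s + 1)), Pm.θ (s + 1) t)
    {gap dist : ℕ → Ω → ℝ}
    (hgap : gap = fun a ω => smoothed μ (objective f)
      (varag f τ μ ν Pm x0 (fun a b => u a b ω) (fun a b => i a b ω) a).2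
        - smoothed μ (objective f) xs)
    (hdist : dist = fun a ω =>
      ‖(varag f τ μ ν Pm x0 (fun a b => u a b ω) (fun a b => i a b ω) a).1 - xs‖ ^ 2)
    (hgi : Integrable (gap s) P) (hdi : Integrable (dist s) P) :
    Integrable (gap (s + 1)) P ∧ Integrable (dist (s + 1)) P ∧
    ∃ G H : ℕ → ℝ, G 0 = ∫ ω, gap s ω ∂P ∧ H 0 = ∫ ω, dist s ω ∂P ∧ (∀ t, 0 ≤ G t) ∧ (∀ t, 0 ≤ H t) ∧
      H (Pm.T (s + 1)) = ∫ ω, dist (s + 1) ω ∂P ∧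
      (∑ t ∈ Finset.Icc 1 (Pm.T (s + 1)), Pm.θ (s + 1) t) * ∫ ω, gap (s + 1) ω ∂P
        ≤ ∑ t ∈ Finset.Icc 1 (Pm.T (s + 1)), Pm.θ (s + 1) t * G t ∧
      ∀ c, 0 < c → c ≤ τ → ∀ t,
        Pm.γ (s + 1) / Pm.α (s + 1) * G (t + 1)
            + 1 / 2 * (1 + (τ - c) * Pm.γ (s + 1)) * H (t + 1)
          ≤ Pm.γ (s + 1) / Pm.α (s + 1) * ((1 / 2 - Pm.α (s + 1)) * G t + 1 / 2 * G 0)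
            + 1 / 2 * H t
            + Pm.γ (s + 1) / Pm.α (s + 1)
              * (Pm.α (s + 1) * pivotErr d L μ ν / (2 * c) + errOne d L μ) := by
  set α := Pm.α (s + 1)
  set γ := Pm.γ (s + 1)
  have : Nonempty (Fin n) := ⟨⟨0, hn⟩⟩
  set φ := smoothed μ (objective f) with hφ
  have hobj := smoothConvex_objective hn hf
  have hφc : Continuous φ := hobj.continuous_smoothed hL μ
  have hfc : ∀ i, Continuous (f i) := fun i => (hf i).continuous
  let z : Ω → Space d × Space d := fun ω =>
    varag f τ μ ν Pm x0 (fun a b => u a b ω) (fun a b => i a b ω) s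
  have hz : Measurable z := measurable_varag hfc τ μ ν Pm x0 s fun a _ b => hξ a b
  let traj : ℕ → Ω → Space d × Space d := fun t ω =>
    ZOVarag.inner f τ μ α γ (1 / 2) (z ω).2 (coordEst ν (objective f) (z ω).2) (z ω).1
      (fun b => u (s + 1) b ω) (fun b => i (s + 1) b ω) t
  have htraj : ∀ t, Measurable (traj t) := fun t =>
    measurable_inner hfc τ μ ν α γ (1 / 2) hz.snd hz.fst t fun b _ => hξ (s + 1) b
  -- The pivot is random as well, so it is carried as part of the state.
  let Z : ℕ → Ω → (Space d × Space d) × Space d := fun t ω => (traj t ω, (z ω).2)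
  have hZ : ∀ t, Measurable (Z t) := fun t => (htraj t).prodMk hz.snd
  have hind : ∀ t, IndepFun (Z t) (fun ω => (u (s + 1) (t + 1) ω, i (s + 1) (t + 1) ω)) P :=
    fun t => indepFun_state hfc τ μ ν Pm x0 hξ hindep α γ (1 / 2) s t
  let a : ℝ := γ / α
  have ha : 0 < a := by positivity
  have key : ∀ c, 0 < c → c ≤ τ → ∀ t, Integrable (fun ω => φ (traj t ω).2 - φ xs) P →
      Integrable (fun ω => ‖(traj t ω).1 - xs‖ ^ 2) P →
      Integrable (fun ω => a * (φ (traj (t + 1) ω).2 - φ xs)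
        + 1 / 2 * (1 + (τ - c) * γ) * ‖(traj (t + 1) ω).1 - xs‖ ^ 2) P ∧
      ∫ ω, (a * (φ (traj (t + 1) ω).2 - φ xs)
        + 1 / 2 * (1 + (τ - c) * γ) * ‖(traj (t + 1) ω).1 - xs‖ ^ 2) ∂P
      ≤ a * ((1 / 2 - α) * (∫ ω, (φ (traj t ω).2 - φ xs) ∂P) + 1 / 2 * ∫ ω, gap s ω ∂P)
        + 1 / 2 * (∫ ω, ‖(traj t ω).1 - xs‖ ^ 2 ∂P)
        + a * (α * pivotErr d L μ ν / (2 * c) + errOne d L μ) := by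
    intro c hc hcτ t hI1 hI2
    have hcoef : 0 ≤ 1 / 2 * (1 + (τ - c) * γ) := by
      have : 0 ≤ (τ - c) * γ := mul_nonneg (by linarith) hγ.le
      linarith
    let step := fun q : ((Space d × Space d) × Space d) × (Space d × Fin n) =>
      innerStep f τ μ α γ (1 / 2) q.1.2 (coordEst ν (objective f) q.1.2) q.1.1 q.2.1 q.2.2
    have hstep : Measurable step := measurable_innerStep hfc τ μ ν α γ (1 / 2)
    let Φ : (Space d × Space d) × Space d → Space d × Fin n → ℝ := fun q w =>
      a * (φ (step (q, w)).2 - φ xs)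
        + 1 / 2 * (1 + (τ - c) * γ) * ‖(step (q, w)).1 - xs‖ ^ 2
    let Ψ : (Space d × Space d) × Space d → ℝ := fun q =>
      a * ((1 / 2 - α) * (φ q.1.2 - φ xs) + 1 / 2 * (φ q.2 - φ xs)) + 1 / 2 * ‖q.1.1 - xs‖ ^ 2
        + a * (α * pivotErr d L μ ν / (2 * c) + errOne d L μ)
    have hΦ : Measurable (Function.uncurry Φ) := by
      have h1 : Measurable fun q => φ (step q).2 := hφc.measurable.comp hstep.snd
      have h2 : Measurable fun q => ‖(step q).1 - xs‖ ^ 2 :=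
        ((hstep.fst.sub_const xs).norm).pow_const 2
      exact ((h1.sub_const _).const_mul a).add (h2.const_mul _)
    have hΨ : Measurable Ψ := by fun_prop
    have hΦ0 : ∀ q w, 0 ≤ Φ q w := fun q w => by
      have := sub_nonneg.2 (hmin (step (q, w)).2)
      have h1 := mul_nonneg ha.le this
      have h2 := mul_nonneg hcoef (sq_nonneg ‖(step (q, w)).1 - xs‖)
      exact add_nonneg h1 h2
    have hg' : Integrable (fun ω => φ (z ω).2 - φ xs) P := by rw [hgap] at hgi; exact hgi
    have i1 := (hI1.const_mul (1 / 2 - α))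
    have i2 := (hg'.const_mul (1 / 2))
    have i12 : Integrable (fun ω => (1 / 2 - α) * (φ (traj t ω).2 - φ xs)
        + 1 / 2 * (φ (z ω).2 - φ xs)) P := i1.add i2
    have i3 := i12.const_mul a
    have i4 := (hI2.const_mul (1 / 2))
    have i34 : Integrable (fun ω => a * ((1 / 2 - α) * (φ (traj t ω).2 - φ xs)
        + 1 / 2 * (φ (z ω).2 - φ xs)) + 1 / 2 * ‖(traj t ω).1 - xs‖ ^ 2) P := i3.add i4
    have hΨi : Integrable (fun ω => Ψ (Z t ω)) P := i34.add (integrable_const _)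
    have h := integral_fresh_le (hZ t) (hξ (s + 1) (t + 1)) (hind t) (hlaw (s + 1) (t + 1)) hΦ hΦ0
      hΨ (fun q => integral_innerStep_le hn hL hτ hμ hν hf hs hmin hα hα2 hγ hαγ hc hcτ q.1 q.2) hΨi
    refine ⟨h.1, h.2.trans_eq ?_⟩
    have e0 : ∫ ω, gap s ω ∂P = ∫ ω, (φ (z ω).2 - φ xs) ∂P := by rw [hgap]
    rw [e0, ← integral_const_mul, ← integral_const_mul (1 / 2), ← integral_add i1 i2,
      ← integral_const_mul, ← integral_const_mul, ← integral_add i3 i4]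
    have e1 : ∫ _ω, a * (α * pivotErr d L μ ν / (2 * c) + errOne d L μ) ∂P
        = a * (α * pivotErr d L μ ν / (2 * c) + errOne d L μ) := by simp
    conv_rhs => rw [← e1]
    rw [← integral_add i34 (integrable_const _)]
  have hnn1 : ∀ t ω, 0 ≤ φ (traj t ω).2 - φ xs := fun t ω => sub_nonneg.2 (hmin _)
  have hint : ∀ t, Integrable (fun ω => φ (traj t ω).2 - φ xs) P ∧
      Integrable (fun ω => ‖(traj t ω).1 - xs‖ ^ 2) P := by
    intro t
    induction t with
    | zero =>
      rw [hgap] at hgi; rw [hdist] at hdi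
      exact ⟨hgi, hdi⟩
    | succ t ih =>
      -- Any admissible c would do for integrability; c = τ reduces the distance coefficient to 1/2.
      -- Both summands are nonnegative, so each is dominated by the integrable potential.
      have h := (key τ hτ le_rfl t ih.1 ih.2).1
      simp only [sub_self, zero_mul, add_zero, mul_one] at h
      have m1 : Measurable fun ω => φ (traj (t + 1) ω).2 - φ xs :=
        (hφc.measurable.comp (htraj (t + 1)).snd).sub_const _
      have m2 : Measurable fun ω => ‖(traj (t + 1) ω).1 - xs‖ ^ 2 :=
        (((htraj (t + 1)).fst.sub_const xs).norm).pow_const 2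
      constructor
      · refine (h.const_mul a⁻¹).mono' m1.aestronglyMeasurable (.of_forall fun ω => ?_)
        rw [Real.norm_of_nonneg (hnn1 _ _), le_inv_mul_iff₀ ha]
        have : 0 ≤ 1 / 2 * ‖(traj (t + 1) ω).1 - xs‖ ^ 2 := by positivity
        linarith
      · refine (h.const_mul 2).mono' m2.aestronglyMeasurable (.of_forall fun ω => ?_)
        rw [Real.norm_of_nonneg (by positivity)]
        have := mul_nonneg ha.le (hnn1 (t + 1) ω)
        linarith
  have hvs : ∀ ω, varag f τ μ ν Pm x0 (fun a b => u a b ω) (fun a b => i a b ω) (s + 1)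
      = ((traj (Pm.T (s + 1)) ω).1, (1 / ∑ t ∈ Finset.Icc 1 (Pm.T (s + 1)), Pm.θ (s + 1) t) •
          ∑ t ∈ Finset.Icc 1 (Pm.T (s + 1)), Pm.θ (s + 1) t • (traj t ω).2) := fun ω => by
    simp only [traj, z, α, γ, ← hp]
    rfl
  set A := Finset.Icc 1 (Pm.T (s + 1))
  have hjen : ∀ ω, (∑ t ∈ A, Pm.θ (s + 1) t) * gap (s + 1) ω
      ≤ ∑ t ∈ A, Pm.θ (s + 1) t * (φ (traj t ω).2 - φ xs) := fun ω => by
    simp only [hgap, hvs]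
    exact hobj.smoothed_weighted_average_le hL μ A _ _ hθ hθpos xs
  have hsumi : Integrable (fun ω => ∑ t ∈ A, Pm.θ (s + 1) t * (φ (traj t ω).2 - φ xs)) P :=
    integrable_finsetSum _ fun t _ => (hint t).1.const_mul _
  have hgi' : Integrable (gap (s + 1)) P := by
    refine (hsumi.const_mul (∑ t ∈ A, Pm.θ (s + 1) t)⁻¹).mono' ?_ (.of_forall fun ω => ?_)
    · rw [hgap]
      exact ((hφc.measurable.comp (measurable_varag hfc τ μ ν Pm x0 (s + 1)
        fun a _ b => hξ a b).snd).sub_const _).aestronglyMeasurable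
    · rw [Real.norm_of_nonneg (by rw [hgap]; exact sub_nonneg.2 (hmin _)), le_inv_mul_iff₀ hθpos]
      exact hjen ω
  have hde : dist (s + 1) = fun ω => ‖(traj (Pm.T (s + 1)) ω).1 - xs‖ ^ 2 := by
    rw [hdist]; simp only [hvs]
  refine ⟨hgi', hde ▸ (hint _).2, fun t => ∫ ω, (φ (traj t ω).2 - φ xs) ∂P,
    fun t => ∫ ω, ‖(traj t ω).1 - xs‖ ^ 2 ∂P, by rw [hgap]; rfl, by rw [hdist]; rfl,
    fun t => integral_nonneg (hnn1 t), fun t => integral_nonneg fun ω => sq_nonneg _,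
    by rw [hde], ?_, ?_⟩
  · rw [← integral_const_mul]
    refine (integral_mono (hgi'.const_mul _) hsumi hjen).trans_eq ?_
    rw [integral_finsetSum _ fun t _ => (hint t).1.const_mul _]
    simp_rw [integral_const_mul]
  · intro c hc hcτ t
    have h := (key c hc hcτ t (hint t).1 (hint t).2).2
    rw [integral_add ((hint (t + 1)).1.const_mul a) ((hint (t + 1)).2.const_mul _),
      integral_const_mul, integral_const_mul] at h
    have e0 : ∫ ω, gap s ω ∂P = ∫ ω, (φ (traj 0 ω).2 - φ xs) ∂P := by rw [hgap]; rfl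
    rw [e0] at h
    exact h

end Epoch

/-! ### Deterministic recursions: summation within an epoch and rates across epochs. -/

theorem sum_weights_mul (ρ q : ℝ) (G : ℕ → ℝ) (k : ℕ) :
    ∑ t ∈ Finset.Icc 1 (k + 1),
        (if t < k + 1 then ρ ^ (t - 1) - q * ρ ^ t else ρ ^ (t - 1)) * G t
      = q * G 0 + ∑ t ∈ Finset.range (k + 1), ρ ^ t * (G (t + 1) - q * G t) := by
  have h1 : ∑ t ∈ Finset.Icc 1 (k + 1),
        (if t < k + 1 then ρ ^ (t - 1) - q * ρ ^ t else ρ ^ (t - 1)) * G t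
      = (∑ t ∈ Finset.range k, (ρ ^ t - q * ρ ^ (t + 1)) * G (t + 1)) + ρ ^ k * G (k + 1) := by
    rw [← Finset.Ico_add_one_right_eq_Icc, Finset.sum_Ico_eq_sum_range, Nat.add_sub_cancel,
      Finset.sum_range_succ, add_comm 1 k, if_neg (lt_irrefl _), Nat.add_sub_cancel]
    congr 1
    refine Finset.sum_congr rfl fun t ht => ?_
    rw [add_comm 1 t, if_pos (by simpa using ht), Nat.add_sub_cancel]
  have h2 : ∀ k, (∑ t ∈ Finset.range k, (ρ ^ t - q * ρ ^ (t + 1)) * G (t + 1)) + ρ ^ k * G (k + 1)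
      = q * G 0 + ∑ t ∈ Finset.range (k + 1), ρ ^ t * (G (t + 1) - q * G t) := fun k => by
    induction k with
    | zero => simp
    | succ k ih =>
      rw [Finset.sum_range_succ _ (k + 1), Finset.sum_range_succ _ k]
      linear_combination ih
  rw [h1, h2]

/-- Weighted summation of a one-step recursion. -/
theorem sum_recursion_le {a q ρ δ : ℝ} (hρ : 0 ≤ ρ) {G H : ℕ → ℝ}
    (h : ∀ t, a * G (t + 1) + 1 / 2 * ρ * H (t + 1)
      ≤ a * (q * G t + 1 / 2 * G 0) + 1 / 2 * H t + a * δ) (T : ℕ) :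
    a * ∑ t ∈ Finset.range T, ρ ^ t * (G (t + 1) - q * G t) + 1 / 2 * ρ ^ T * H T
      ≤ 1 / 2 * H 0 + a * (1 / 2 * G 0 + δ) * ∑ t ∈ Finset.range T, ρ ^ t := by
  induction T with
  | zero => simp
  | succ T ih =>
    rw [Finset.sum_range_succ, Finset.sum_range_succ]
    have h1 := mul_le_mul_of_nonneg_left (h T) (pow_nonneg hρ T)
    rw [pow_succ]
    linarith

/-- The epoch inequality obtained from the one-step recursion with the weights `θ`. -/
theorem epoch_le {a q ρ δ g h' : ℝ} (ha : 0 ≤ a) (hρ : 0 ≤ ρ) {G H : ℕ → ℝ} {k : ℕ}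
    (hstep : ∀ t, a * G (t + 1) + 1 / 2 * ρ * H (t + 1)
      ≤ a * (q * G t + 1 / 2 * G 0) + 1 / 2 * H t + a * δ)
    (hH : H (k + 1) = h')
    (hg : (∑ t ∈ Finset.Icc 1 (k + 1),
        (if t < k + 1 then ρ ^ (t - 1) - q * ρ ^ t else ρ ^ (t - 1))) * g
      ≤ ∑ t ∈ Finset.Icc 1 (k + 1),
        (if t < k + 1 then ρ ^ (t - 1) - q * ρ ^ t else ρ ^ (t - 1)) * G t) :
    a * ((1 - q) * (∑ t ∈ Finset.range (k + 1), ρ ^ t) + q) * g + 1 / 2 * ρ ^ (k + 1) * h'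
      ≤ a * (1 / 2 * (∑ t ∈ Finset.range (k + 1), ρ ^ t) + q) * G 0 + 1 / 2 * H 0
        + a * (∑ t ∈ Finset.range (k + 1), ρ ^ t) * δ := by
  have h1 := sum_recursion_le hρ hstep (k + 1)
  -- Taking G constant 1 evaluates the total weight as (1 - q)Σρ^t + q.
  have h2 := sum_weights_mul ρ q (fun _ => 1) k
  simp only [mul_one] at h2
  rw [← Finset.sum_mul] at h2
  rw [h2, sum_weights_mul] at hg
  have h3 := mul_le_mul_of_nonneg_left hg ha
  rw [hH] at h1
  linarith

/-- Telescoping: the coefficient a·2^s of the final gap of one epoch equals the coefficient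
a·2^(s+1)/2 of the initial gap of the next. -/
theorem doubling_recursion_le {a δ : ℝ} {g h : ℕ → ℝ} {m : ℕ}
    (hstep : ∀ s, s + 1 ≤ m → a * 2 ^ s * g (s + 1) + 1 / 2 * h (s + 1)
      ≤ a * (2 ^ s / 2) * g s + 1 / 2 * h s + a * 2 ^ s * δ) (s : ℕ) (hs : s + 1 ≤ m) :
    a * 2 ^ s * g (s + 1) + 1 / 2 * h (s + 1)
      ≤ a / 2 * g 0 + 1 / 2 * h 0 + (2 ^ (s + 1) - 1) * (a * δ) := by
  induction s with
  | zero => have := hstep 0 hs; simp only [pow_zero, zero_add, pow_one] at this ⊢; linarith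
  | succ s ih =>
    have h1 := hstep (s + 1) hs
    have h2 := ih (by omega)
    have e1 : (2 : ℝ) ^ (s + 1) / 2 = 2 ^ s := by rw [pow_succ]; ring
    rw [e1] at h1
    rw [pow_succ 2 (s + 1)]
    linarith

/-- The residual e/(r - 1) is the fixed point of the recursion. -/
theorem contraction_le {r e : ℝ} (hr : 1 < r) {W : ℕ → ℝ} (h : ∀ k, r * W (k + 1) ≤ W k + e) (k : ℕ)
    (he : 0 ≤ e) : W k ≤ (r ^ k)⁻¹ * W 0 + e / (r - 1) := by
  have hr0 : 0 < r := by linarith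
  have hr1 : 0 < r - 1 := by linarith
  induction k with
  | zero => simp only [pow_zero, inv_one, one_mul]; linarith [div_nonneg he hr1.le]
  | succ k ih =>
    have h1 : r * W (k + 1) ≤ r * ((r ^ (k + 1))⁻¹ * W 0 + e / (r - 1)) := by
      have e1 : r * ((r ^ (k + 1))⁻¹ * W 0 + e / (r - 1))
          = (r ^ k)⁻¹ * W 0 + e / (r - 1) + e := by
        rw [pow_succ]; field_simp; ring
      rw [e1]
      linarith [h k]
    exact le_of_mul_le_mul_left h1 hr0

theorem le_sum_pow {ρ : ℝ} (hρ : 1 ≤ ρ) (T : ℕ) : (T : ℝ) ≤ ∑ t ∈ Finset.range T, ρ ^ t := by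
  calc (T : ℝ) = ∑ _t ∈ Finset.range T, (1 : ℝ) := by simp
    _ ≤ _ := Finset.sum_le_sum fun t _ => one_le_pow₀ hρ

/-- Linear convergence of the epochs with `α = 1/2`. -/
theorem linear_rate_half {a S R δ : ℝ} (ha : 0 < a) (hS : 0 < S) (hR : 5 / 4 ≤ R) (hδ : 0 ≤ δ)
    {g h : ℕ → ℝ} (hg : ∀ k, 0 ≤ g k) (hh : ∀ k, 0 ≤ h k)
    (hstep : ∀ k, a * S * g (k + 1) + 1 / 2 * R * h (k + 1)
      ≤ a * (1 / 2 * S) * g k + 1 / 2 * h k + a * S * δ) (k : ℕ) :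
    g k ≤ (4 / 5) ^ k * (g 0 + 5 / 8 * h 0 / (a * S)) + 5 * δ := by
  have haS : 0 < a * S := by positivity
  -- Multiplying the step by 5/4 turns 1/2 into 5/8 on both the gap and the distance; the gap
  -- coefficient 5/8 ≤ 1 has room to spare, and R ≥ 5/4 supplies the factor on the distance.
  have h1 := contraction_le (r := 5 / 4) (e := 5 / 4 * (a * S * δ)) (by norm_num)
    (W := fun k => a * S * g k + 5 / 8 * h k) (fun k => by
      have h2 := hstep k
      have h3 := mul_le_mul_of_nonneg_right hR (hh (k + 1))
      have h4 := mul_nonneg haS.le (hg k)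
      linarith) k (by positivity)
  have e1 : ((5 / 4 : ℝ) ^ k)⁻¹ = (4 / 5) ^ k := by rw [← inv_pow]; norm_num
  rw [e1] at h1
  have h5 : a * S * g k ≤ a * S * ((4 / 5) ^ k * (g 0 + 5 / 8 * h 0 / (a * S)) + 5 * δ) := by
    have e2 : a * S * ((4 / 5) ^ k * (g 0 + 5 / 8 * h 0 / (a * S)) + 5 * δ)
        = (4 / 5) ^ k * (a * S * g 0 + 5 / 8 * h 0) + 5 / 4 * (a * S * δ) / (5 / 4 - 1) := by
      field_simp; ring
    rw [e2]
    linarith [hh k]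
  exact le_of_mul_le_mul_left h5 haS

/-- Linear convergence of the epochs with small `α`. -/
theorem linear_rate_small {a S R δ α : ℝ} (ha : 0 < a) (hS : 1 ≤ S) (hα : 0 < α) (hα2 : α ≤ 1 / 2)
    (hR : 1 + α / 2 ≤ R) (hδ : 0 ≤ δ) {g h : ℕ → ℝ} (hg : ∀ k, 0 ≤ g k) (hh : ∀ k, 0 ≤ h k)
    (hstep : ∀ k, a * ((1 - (1 / 2 - α)) * S + (1 / 2 - α)) * g (k + 1) + 1 / 2 * R * h (k + 1)
      ≤ a * (1 / 2 * S + (1 / 2 - α)) * g k + 1 / 2 * h k + a * S * δ) (k : ℕ) :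
    g k ≤ ((1 + α / 2) ^ k)⁻¹ * (g 0 + h 0 / (a * S)) + 4 / α * δ := by
  set B := 1 / 2 * S + (1 / 2 - α) with hB
  have hB0 : S / 2 ≤ B := by rw [hB]; linarith
  have hBpos : 0 < B := by linarith
  have haB : 0 < a * B := by positivity
  -- The right side exceeds B by αS, while (α/2)B is smaller than that once S ≥ 1.
  have hcoef : (1 + α / 2) * B ≤ (1 - (1 / 2 - α)) * S + (1 / 2 - α) := by
    rw [hB]; nlinarith [mul_le_mul_of_nonneg_left hS hα.le, mul_pos hα hα]
  have h1 := contraction_le (r := 1 + α / 2) (e := a * S * δ) (by linarith)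
    (W := fun k => a * B * g k + 1 / 2 * h k) (fun k => by
      have h2 := hstep k
      have h3 := mul_le_mul_of_nonneg_right hR (hh (k + 1))
      have h4 := mul_le_mul_of_nonneg_right (mul_le_mul_of_nonneg_left hcoef ha.le) (hg (k + 1))
      linarith) k (by positivity)
  have hr : 0 ≤ ((1 + α / 2) ^ k)⁻¹ := by positivity
  have h5 : a * B * g k ≤ a * B * (((1 + α / 2) ^ k)⁻¹ * (g 0 + h 0 / (a * S)) + 4 / α * δ) := by
    have e1 : 1 / 2 * h 0 ≤ a * B * (h 0 / (a * S)) := by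
      have : a * B * (h 0 / (a * S)) = B / S * h 0 := by field_simp
      rw [this]
      refine mul_le_mul_of_nonneg_right ?_ (hh 0)
      rw [le_div_iff₀ (by linarith)]; linarith
    have e2 : a * S * δ / (1 + α / 2 - 1) ≤ a * B * (4 / α * δ) := by
      have e3 : a * S * δ / (1 + α / 2 - 1) = a * (S / 2) * (4 / α * δ) := by
        rw [add_sub_cancel_left]; field_simp; norm_num
      rw [e3]; gcongr
    have e4 := mul_le_mul_of_nonneg_left e1 hr
    linarith [hh k]
  exact le_of_mul_le_mul_left h5 haB

open ZOVarag

/-! ### The concrete step sizes and averaging weights. -/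

section Parameters

variable {d n : ℕ} {L τ : ℝ}

theorem alphaSC_pos (hn : 0 < n) (hL : 0 < L) (hτ : 0 < τ) (s : ℕ) : 0 < alphaSC d n L τ s := by
  have hn' : (0 : ℝ) < n := by exact_mod_cast hn
  rw [alphaSC]
  split_ifs
  · norm_num
  · exact lt_min (Real.sqrt_pos.2 (by positivity)) (by norm_num)

theorem alphaSC_le_half (s : ℕ) : alphaSC d n L τ s ≤ 1 / 2 := by
  rw [alphaSC]
  split_ifs
  · exact le_rfl
  · exact min_le_right _ _

theorem gammaSC_pos (hn : 0 < n) (hL : 0 < L) (hτ : 0 < τ) (s : ℕ) : 0 < gammaSC d n L τ s := by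
  have := alphaSC_pos (d := d) hn hL hτ s
  rw [gammaSC]; positivity

theorem alphaSC_mul_gammaSC (hn : 0 < n) (hL : 0 < L) (hτ : 0 < τ) (s : ℕ) :
    12 * ((d : ℝ) + 4) * L * (alphaSC d n L τ s * gammaSC d n L τ s) = 1 := by
  have := alphaSC_pos (d := d) hn hL hτ s
  rw [gammaSC]; field_simp

/-- Needed for nonnegativity of the late weights, where (1/2 - α)(1 + τγ/2) must not exceed 1. The
square-root branch uses n ≥ 1 and τ ≤ L: (5Lα)² = (25/24) nLτ ≥ τ². -/
theorem tau_mul_gammaSC_le (hn : 0 < n) (hL : 0 < L) (hτ : 0 < τ) (hτL : τ ≤ L) (s : ℕ) :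
    τ * gammaSC d n L τ s ≤ 1 := by
  have hα := alphaSC_pos (d := d) hn hL hτ s
  have hn' : (1 : ℝ) ≤ n := by exact_mod_cast hn
  have h5 : τ ≤ 5 * L * alphaSC d n L τ s := by
    rw [alphaSC]
    split_ifs
    · linarith
    · rcases min_choice (√((n : ℝ) * τ / (24 * L))) (1 / 2) with h | h
      · rw [h]
        refine (sq_le_sq₀ hτ.le (by positivity)).1 ?_
        rw [mul_pow, Real.sq_sqrt (by positivity)]
        have e : (5 * L) ^ 2 * (n * τ / (24 * L)) = 25 / 24 * (n * (L * τ)) := by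
          field_simp; norm_num
        rw [e]
        have h1 : τ * τ ≤ L * τ := by gcongr
        have h2 : L * τ ≤ n * (L * τ) := le_mul_of_one_le_left (by positivity) hn'
        nlinarith
      · rw [h]; linarith
  rw [gammaSC, mul_one_div, div_le_one (by positivity)]
  have hd : (0 : ℝ) ≤ d := by positivity
  have : 0 ≤ L * alphaSC d n L τ s := by positivity
  nlinarith [mul_nonneg hd this]

/-- Early weights are the general ones with ρ = 1 and q = 0, up to the factor γ/α that cancels in
the average; note α + 1/2 = 1 here. -/
theorem thetaSC_of_le {s : ℕ} (hs : s ≤ sZero d n) (t : ℕ) :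
    thetaSC d n L τ s t = gammaSC d n L τ s / alphaSC d n L τ s *
      (if t < epochLength d n s then (1 : ℝ) ^ (t - 1) - 0 * 1 ^ t else 1 ^ (t - 1)) := by
  have hα : alphaSC d n L τ s = 1 / 2 := by rw [alphaSC, if_pos hs]
  rw [thetaSC, if_pos hs]
  split_ifs
  · rw [hα]; simp; norm_num
  · simp

/-- Late weights correspond to c = τ/2, written as τ - τ/2 to match the one-step recursion. -/
theorem thetaSC_of_lt {s : ℕ} (hs : sZero d n < s) (t : ℕ) :
    thetaSC d n L τ s t = 1 *
      (if t < epochLength d n s then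
        (1 + (τ - τ / 2) * gammaSC d n L τ s) ^ (t - 1)
          - (1 / 2 - alphaSC d n L τ s) * (1 + (τ - τ / 2) * gammaSC d n L τ s) ^ t
      else (1 + (τ - τ / 2) * gammaSC d n L τ s) ^ (t - 1)) := by
  have e : 1 + (τ - τ / 2) * gammaSC d n L τ s = 1 + τ * gammaSC d n L τ s / 2 := by ring
  rw [thetaSC, if_neg hs.not_ge, e]
  simp only [GammaSC]
  split_ifs <;> ring

end Parameters

/-! ### The inequality between consecutive epochs. -/

section Epoch

variable {d n : ℕ} {f : Fin n → Space d → ℝ} {L μ ν τ : ℝ} {Ω : Type*} [MeasurableSpace Ω]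
  {P : Measure Ω} [IsProbabilityMeasure P] {u : ℕ → ℕ → Ω → Space d} {i : ℕ → ℕ → Ω → Fin n}

/-- Integrability and the inequality between consecutive epochs. -/
theorem epoch_inequality (hn : 0 < n) (hL : 0 < L) (hτ : 0 < τ) (hμ : 0 < μ) (hν : 0 < ν)
    (hf : ∀ i, SmoothConvex L (f i))
    (hs : ∀ x y, objective f x + inner ℝ (gradient (objective f) x) (y - x)
      + τ / 2 * ‖y - x‖ ^ 2 ≤ objective f y)
    {xs : Space d} (hmin : ∀ z, smoothed μ (objective f) xs ≤ smoothed μ (objective f) z)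
    (hξ : ∀ a b, Measurable fun ω => (u a b ω, i a b ω))
    (hlaw : ∀ a b, P.map (fun ω => (u a b ω, i a b ω)) = sampleLaw d n)
    (hindep : iIndepFun (fun (k : ℕ × ℕ) ω => (u k.1 k.2 ω, i k.1 k.2 ω)) P)
    (x0 : Space d) (s k : ℕ) {κ ρ q c : ℝ} (hκ : 0 < κ) (hk : epochLength d n (s + 1) = k + 1)
    (hc : 0 < c) (hcτ : c ≤ τ) (hρ : ρ = 1 + (τ - c) * gammaSC d n L τ (s + 1))
    (hq : q = 1 / 2 - alphaSC d n L τ (s + 1)) (hqρ : q * ρ ≤ 1)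
    (hθ : ∀ t, thetaSC d n L τ (s + 1) t
      = κ * (if t < epochLength d n (s + 1) then ρ ^ (t - 1) - q * ρ ^ t else ρ ^ (t - 1)))
    {gap dist : ℕ → Ω → ℝ}
    (hgap : gap = fun a ω => smoothed μ (objective f)
      (varag f τ μ ν (paramsSC d n L τ) x0 (fun a b => u a b ω) (fun a b => i a b ω) a).2
        - smoothed μ (objective f) xs)
    (hdist : dist = fun a ω => ‖(varag f τ μ ν (paramsSC d n L τ) x0 (fun a b => u a b ω)
      (fun a b => i a b ω) a).1 - xs‖ ^ 2)
    (hgi : Integrable (gap s) P) (hdi : Integrable (dist s) P) :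
    Integrable (gap (s + 1)) P ∧ Integrable (dist (s + 1)) P ∧
      gammaSC d n L τ (s + 1) / alphaSC d n L τ (s + 1)
          * ((1 - q) * (∑ t ∈ Finset.range (k + 1), ρ ^ t) + q) * (∫ ω, gap (s + 1) ω ∂P)
          + 1 / 2 * ρ ^ (k + 1) * (∫ ω, dist (s + 1) ω ∂P)
        ≤ gammaSC d n L τ (s + 1) / alphaSC d n L τ (s + 1)
          * (1 / 2 * (∑ t ∈ Finset.range (k + 1), ρ ^ t) + q) * (∫ ω, gap s ω ∂P)
          + 1 / 2 * (∫ ω, dist s ω ∂P)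
          + gammaSC d n L τ (s + 1) / alphaSC d n L τ (s + 1)
            * (∑ t ∈ Finset.range (k + 1), ρ ^ t)
            * (alphaSC d n L τ (s + 1) * pivotErr d L μ ν / (2 * c) + errOne d L μ) := by
  have hα := alphaSC_pos (d := d) hn hL hτ (s + 1)
  have hα2 := alphaSC_le_half (d := d) (n := n) (L := L) (τ := τ) (s + 1)
  have hγ := gammaSC_pos (d := d) hn hL hτ (s + 1)
  have hq0 : 0 ≤ q := by rw [hq]; linarith
  have hρ1 : 1 ≤ ρ := by
    have : 0 ≤ (τ - c) * gammaSC d n L τ (s + 1) := mul_nonneg (by linarith) hγ.le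
    rw [hρ]; linarith
  have hρ0 : 0 ≤ ρ := by linarith
  rw [hk] at hθ
  -- For t ≥ 1 the weight factors as ρ^(t-1)(1 - qρ), so qρ ≤ 1 suffices.
  have hw : ∀ t ∈ Finset.Icc 1 (k + 1),
      0 ≤ (if t < k + 1 then ρ ^ (t - 1) - q * ρ ^ t else ρ ^ (t - 1)) := fun t ht => by
    split_ifs
    · obtain ⟨t, rfl⟩ : ∃ t', t = t' + 1 := ⟨t - 1, by have := (Finset.mem_Icc.1 ht).1; omega⟩
      have : ρ ^ (t + 1 - 1) - q * ρ ^ (t + 1) = ρ ^ t * (1 - q * ρ) := by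
        rw [Nat.add_sub_cancel]; ring
      rw [this]
      exact mul_nonneg (pow_nonneg hρ0 _) (by linarith)
    · positivity
  have hwsum : 0 < ∑ t ∈ Finset.Icc 1 (k + 1),
      (if t < k + 1 then ρ ^ (t - 1) - q * ρ ^ t else ρ ^ (t - 1)) := by
    have h2 := sum_weights_mul ρ q (fun _ => 1) k
    simp only [mul_one] at h2
    rw [h2, ← Finset.sum_mul]
    have h3 := le_sum_pow hρ1 (k + 1)
    have h4 : (1 : ℝ) ≤ ((k + 1 : ℕ) : ℝ) := by push_cast; linarith [Nat.cast_nonneg (α := ℝ) k]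
    have h5 : 1 / 2 ≤ 1 - q := by rw [hq]; linarith
    nlinarith
  have hT : (paramsSC d n L τ).T (s + 1) = k + 1 := hk
  have hθ' : ∀ t, (paramsSC d n L τ).θ (s + 1) t
      = κ * (if t < k + 1 then ρ ^ (t - 1) - q * ρ ^ t else ρ ^ (t - 1)) := hθ
  obtain ⟨h1, h2, G, H, hG0, hH0, -, -, hHT, hGs, hrec⟩ := exists_epoch_sequences hn hL hτ hμ hν hf
    hs hmin hξ hlaw hindep (paramsSC d n L τ) x0 s rfl hα hα2 hγ
    (alphaSC_mul_gammaSC hn hL hτ (s + 1))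
    (fun t ht => by rw [hT] at ht; rw [hθ']; exact mul_nonneg hκ.le (hw t ht))
    (by rw [hT]; simp_rw [hθ']; rw [← Finset.mul_sum]; exact mul_pos hκ hwsum)
    hgap hdist hgi hdi
  refine ⟨h1, h2, ?_⟩
  rw [hT] at hHT hGs
  simp_rw [hθ', mul_assoc κ] at hGs
  rw [← Finset.mul_sum, ← Finset.mul_sum, mul_assoc] at hGs
  have h3 := epoch_le (a := gammaSC d n L τ (s + 1) / alphaSC d n L τ (s + 1)) (q := q)
    (by positivity) hρ0 (fun t => by rw [hρ, hq]; exact hrec c hc hcτ t) hHT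
    (le_of_mul_le_mul_left hGs hκ)
  rw [hG0, hH0] at h3
  exact h3

end Epoch

/-! ### From the epoch inequalities to the three stated bounds. -/

section Rates

variable {d n m : ℕ} {L τ D0 ς₁ ς₂ a₁ : ℝ} {g h : ℕ → ℝ}

/-- The bound obtained during the epochs of doubling length. -/
theorem doubling_gap_le (ha₁0 : 0 < a₁) (hδ : 0 ≤ ς₂ / 4 + ς₁)
    (hA0 : a₁ / 2 * g 0 + 1 / 2 * h 0 = a₁ * (((d : ℝ) + 4) * D0 / 4))
    (early : ∀ s, s + 1 ≤ m + 1 → a₁ * 2 ^ s * g (s + 1) + 1 / 2 * h (s + 1)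
        ≤ a₁ * (2 ^ s / 2) * g s + 1 / 2 * h s + a₁ * 2 ^ s * (ς₂ / 4 + ς₁)) (k : ℕ)
    (hk : k + 1 ≤ m + 1) :
    g (k + 1) + 1 / 2 * h (k + 1) / (a₁ * 2 ^ k)
      ≤ ((d : ℝ) + 4) * D0 / 4 / 2 ^ k + 2 * (ς₂ / 4 + ς₁) := by
  have h1 := doubling_recursion_le early k hk
  rw [hA0] at h1
  set δ₁ := ς₂ / 4 + ς₁
  have hp : (0 : ℝ) < 2 ^ k := by positivity
  have h2 : a₁ * 2 ^ k * (g (k + 1) + 1 / 2 * h (k + 1) / (a₁ * 2 ^ k))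
      ≤ a₁ * 2 ^ k * (((d : ℝ) + 4) * D0 / 4 / 2 ^ k + 2 * δ₁) := by
    have e1 : a₁ * 2 ^ k * (g (k + 1) + 1 / 2 * h (k + 1) / (a₁ * 2 ^ k))
        = a₁ * 2 ^ k * g (k + 1) + 1 / 2 * h (k + 1) := by field_simp
    have e2 : a₁ * 2 ^ k * (((d : ℝ) + 4) * D0 / 4 / 2 ^ k + 2 * δ₁)
        = a₁ * (((d : ℝ) + 4) * D0 / 4) + 2 ^ (k + 1) * (a₁ * δ₁) := by
      rw [pow_succ]; field_simp
    rw [e1, e2]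
    have : 0 ≤ a₁ * δ₁ := by positivity
    linarith
  exact le_of_mul_le_mul_left h2 (by positivity)

theorem gap_le_of_doubling (ha₁0 : 0 < a₁) (hh : ∀ a, 0 ≤ h a) {k : ℕ}
    (hk : g (k + 1) + 1 / 2 * h (k + 1) / (a₁ * 2 ^ k)
      ≤ ((d : ℝ) + 4) * D0 / 4 / 2 ^ k + 2 * (ς₂ / 4 + ς₁)) :
    g (k + 1) ≤ 1 / 2 ^ (k + 1 + 1) * ((d : ℝ) + 4) * D0 + 2 * ς₁ + 1 / 2 * ς₂ := by
  have h2 : 0 ≤ 1 / 2 * h (k + 1) / (a₁ * 2 ^ k) := by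
    have := hh (k + 1); positivity
  have e1 : 1 / 2 ^ (k + 1 + 1) * ((d : ℝ) + 4) * D0 = ((d : ℝ) + 4) * D0 / 4 / 2 ^ k := by
    rw [pow_succ, pow_succ]; field_simp; norm_num
  rw [e1]
  linarith

/-- The choice of s₀ enters here: (d+4)n < 2^(m+1) turns (d+4)D₀/2^(m+2) into D₀/(2n). -/
theorem doubling_final_gap_le (hn' : (0 : ℝ) < n) (hD00 : 0 ≤ D0)
    (hNlt : ((d : ℝ) + 4) * n < 2 * 2 ^ m)
    (hk : g (m + 1) + 1 / 2 * h (m + 1) / (a₁ * 2 ^ m)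
      ≤ ((d : ℝ) + 4) * D0 / 4 / 2 ^ m + 2 * (ς₂ / 4 + ς₁)) :
    g (m + 1) + 1 / 2 * h (m + 1) / (a₁ * 2 ^ m) ≤ D0 / n / 2 + 2 * (ς₂ / 4 + ς₁) := by
  have h2 : ((d : ℝ) + 4) * D0 / 4 / 2 ^ m ≤ D0 / n / 2 := by
    rw [div_div, div_div, div_le_div_iff₀ (by positivity) (by positivity)]
    nlinarith [mul_le_mul_of_nonneg_left hNlt.le hD00]
  linarith

/-- When nτ ≥ 6L the minimum defining α is 1/2, so q = 0 and `linear_rate_half` applies. -/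
theorem gap_le_of_large_sample (hn' : (0 : ℝ) < n) (hL : 0 < L) (hτ : 0 < τ) (hD00 : 0 ≤ D0)
    (hς₁0 : 0 ≤ ς₁) (hς₂0 : 0 ≤ ς₂) {α γ ρ S : ℝ} (ha₁ : a₁ = 1 / (3 * ((d : ℝ) + 4) * L))
    (hα : α = min (√((n : ℝ) * τ / (24 * L))) (1 / 2))
    (hγ : γ = 1 / (12 * ((d : ℝ) + 4) * L * α)) (hρ : ρ = 1 + (τ - τ / 2) * γ)
    (hST : (2 : ℝ) ^ m ≤ S) (hNlt : ((d : ℝ) + 4) * n < 2 * 2 ^ m)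
    (hg : ∀ a, 0 ≤ g a) (hh : ∀ a, 0 ≤ h a)
    (hmid : g (m + 1) + 1 / 2 * h (m + 1) / (a₁ * 2 ^ m) ≤ D0 / n / 2 + 2 * (ς₂ / 4 + ς₁))
    (late : ∀ s, m + 1 ≤ s →
      γ / α * ((1 - (1 / 2 - α)) * S + (1 / 2 - α)) * g (s + 1) + 1 / 2 * ρ ^ (2 ^ m) * h (s + 1)
        ≤ γ / α * (1 / 2 * S + (1 / 2 - α)) * g s + 1 / 2 * h s
          + γ / α * S * (α * ς₂ + ς₁))
    (hnL : 6 * L / τ ≤ (n : ℝ)) (k : ℕ) :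
    g (m + 1 + (k + 1)) ≤ (4 / 5) ^ (k + 1) * (D0 / n) + 12 * ς₁ + 5 * ς₂ := by
  have hd4 : (0 : ℝ) < (d : ℝ) + 4 := by positivity
  have hpm : (0 : ℝ) < 2 ^ m := by positivity
  have ha₁0 : 0 < a₁ := by rw [ha₁]; positivity
  have hnτ : 6 * L ≤ n * τ := by rwa [div_le_iff₀ hτ] at hnL
  have hαh : α = 1 / 2 := by
    rw [hα]
    refine min_eq_right (Real.le_sqrt_of_sq_le ?_)
    rw [le_div_iff₀ (by positivity)]; linarith
  clear hα
  subst hαh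
  have hγ0 : 0 < γ := by rw [hγ]; positivity
  have ha : γ / (1 / 2) = a₁ := by rw [hγ, ha₁]; field_simp; norm_num
  -- Bernoulli gives an excess 2^m τγ/2; with 2^m > (d+4)n/2 and γ = 1/(6(d+4)L) it is at least
  -- nτ/(24L) ≥ 1/4.
  have hR : 5 / 4 ≤ ρ ^ (2 ^ m) := by
    have h0 : 0 ≤ (τ - τ / 2) * γ := mul_nonneg (by linarith) hγ0.le
    have h1 := one_add_mul_le_pow (a := (τ - τ / 2) * γ) (by linarith) (2 ^ m)
    rw [hρ]
    refine le_trans ?_ h1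
    push_cast
    have e1 : (2 : ℝ) ^ m * ((τ - τ / 2) * γ) = 2 ^ m * τ / (12 * (d + 4) * L) := by
      rw [hγ]; field_simp; ring
    rw [e1]
    have h2 : 1 / 4 ≤ 2 ^ m * τ / (12 * ((d : ℝ) + 4) * L) := by
      rw [le_div_iff₀ (by positivity)]
      nlinarith [mul_le_mul_of_nonneg_right hNlt.le hτ.le,
        mul_le_mul_of_nonneg_left hnτ hd4.le]
    linarith
  have h1 := linear_rate_half (g := fun k => g (m + 1 + k)) (h := fun k => h (m + 1 + k)) (S := S)
    (δ := 1 / 2 * ς₂ + ς₁) ha₁0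
    (by linarith) hR (by positivity) (fun k => hg _) (fun k => hh _) (fun k => by
      have h2 := late (m + 1 + k) (by omega)
      rw [ha] at h2
      simp only [sub_self, sub_zero, one_mul, add_zero] at h2
      exact h2) (k + 1)
  simp only [add_zero] at h1
  refine h1.trans ?_
  have h2 : 5 / 8 * h (m + 1) / (a₁ * S) ≤ 5 / 4 * (1 / 2 * h (m + 1) / (a₁ * 2 ^ m)) := by
    have := hh (m + 1)
    calc 5 / 8 * h (m + 1) / (a₁ * S) ≤ 5 / 8 * h (m + 1) / (a₁ * 2 ^ m) := by gcongr
      _ = _ := by ring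
  have h3 : g (m + 1) + 5 / 8 * h (m + 1) / (a₁ * S)
      ≤ 5 / 4 * (D0 / n / 2 + 2 * (ς₂ / 4 + ς₁)) := by
    linarith [hg (m + 1)]
  have h45 : (4 / 5 : ℝ) ^ (k + 1) ≤ 4 / 5 := by
    rw [pow_succ]
    have : (4 / 5 : ℝ) ^ k ≤ 1 := pow_le_one₀ (by norm_num) (by norm_num)
    linarith
  have hp : (0 : ℝ) ≤ (4 / 5) ^ (k + 1) := by positivity
  have h4 := mul_le_mul_of_nonneg_left h3 hp
  have h5 := mul_le_mul_of_nonneg_right h45 (by positivity : 0 ≤ ς₂ / 4 + ς₁)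
  have h6 : 0 ≤ (4 / 5) ^ (k + 1) * (D0 / n) := by positivity
  linarith

/-- Here α is the square root, and √(nτ/(6L)) = 2α turns the stated rate into 1 + α/2 and the stated
error factor into 4/α + 4. -/
theorem gap_le_of_small_sample (hn' : (0 : ℝ) < n) (hL : 0 < L) (hτ : 0 < τ)
    (hς₁0 : 0 ≤ ς₁) (hς₂0 : 0 ≤ ς₂) {α γ ρ S : ℝ} (ha₁ : a₁ = 1 / (3 * ((d : ℝ) + 4) * L))
    (hα : α = min (√((n : ℝ) * τ / (24 * L))) (1 / 2))
    (hγ : γ = 1 / (12 * ((d : ℝ) + 4) * L * α)) (hρ : ρ = 1 + (τ - τ / 2) * γ)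
    (hST : (2 : ℝ) ^ m ≤ S) (hNlt : ((d : ℝ) + 4) * n < 2 * 2 ^ m)
    (hg : ∀ a, 0 ≤ g a) (hh : ∀ a, 0 ≤ h a)
    (hmid : g (m + 1) + 1 / 2 * h (m + 1) / (a₁ * 2 ^ m) ≤ D0 / n / 2 + 2 * (ς₂ / 4 + ς₁))
    (late : ∀ s, m + 1 ≤ s →
      γ / α * ((1 - (1 / 2 - α)) * S + (1 / 2 - α)) * g (s + 1) + 1 / 2 * ρ ^ (2 ^ m) * h (s + 1)
        ≤ γ / α * (1 / 2 * S + (1 / 2 - α)) * g s + 1 / 2 * h s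
          + γ / α * S * (α * ς₂ + ς₁))
    (hnL : (n : ℝ) < 6 * L / τ) (k : ℕ) :
    g (m + 1 + k) ≤ ((1 + 1 / 4 * √((n : ℝ) * τ / (6 * L))) ^ k)⁻¹ * (D0 / n)
      + (8 * √(6 * L / ((n : ℝ) * τ)) + 4) * ς₁ + 5 * ς₂ := by
  have hd4 : (0 : ℝ) < (d : ℝ) + 4 := by positivity
  have hpm : (0 : ℝ) < 2 ^ m := by positivity
  have ha₁0 : 0 < a₁ := by rw [ha₁]; positivity
  have hα0 : 0 < α := by
    rw [hα]; exact lt_min (Real.sqrt_pos.2 (by positivity)) (by norm_num)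
  have hα2 : α ≤ 1 / 2 := by rw [hα]; exact min_le_right _ _
  have hγ0 : 0 < γ := by rw [hγ]; positivity
  have hnτ : n * τ < 6 * L := by rwa [lt_div_iff₀ hτ] at hnL
  have hαs : α = √((n : ℝ) * τ / (24 * L)) := by
    rw [hα]
    refine min_eq_left (Real.sqrt_le_iff.2 ⟨by norm_num, ?_⟩)
    rw [div_le_iff₀ (by positivity)]; linarith
  clear hα
  have hαsq : α ^ 2 = n * τ / (24 * L) := by rw [hαs, Real.sq_sqrt (by positivity)]
  have hsq1 : √((n : ℝ) * τ / (6 * L)) = 2 * α := by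
    rw [Real.sqrt_eq_iff_mul_self_eq_of_pos (by positivity)]
    have : 2 * α * (2 * α) = 4 * α ^ 2 := by ring
    rw [this, hαsq]; field_simp; norm_num
  have hsq2 : √(6 * L / ((n : ℝ) * τ)) = 1 / (2 * α) := by
    rw [← hsq1, one_div, ← Real.sqrt_inv, inv_div]
  have ha : a₁ ≤ γ / α := by
    rw [hγ, ha₁, div_div, div_le_div_iff₀ (by positivity) (by positivity)]
    have h1 : α * α ≤ 1 / 4 := by nlinarith
    have h2 := mul_le_mul_of_nonneg_left h1 (by positivity : 0 ≤ 12 * ((d : ℝ) + 4) * L)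
    linarith
  have hR : 1 + α / 2 ≤ ρ ^ (2 ^ m) := by
    have h0 : 0 ≤ (τ - τ / 2) * γ := mul_nonneg (by linarith) hγ0.le
    have h1 := one_add_mul_le_pow (a := (τ - τ / 2) * γ) (by linarith) (2 ^ m)
    rw [hρ]
    refine le_trans ?_ h1
    push_cast
    have e1 : (2 : ℝ) ^ m * ((τ - τ / 2) * γ) = 2 ^ m * τ / (24 * (d + 4) * L * α) := by
      rw [hγ]; field_simp; ring
    rw [e1]
    -- After clearing denominators, α² = nτ/(24L) reduces this to (d+4)n ≤ 2·2^m.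
    have h2 : α / 2 ≤ 2 ^ m * τ / (24 * ((d : ℝ) + 4) * L * α) := by
      rw [le_div_iff₀ (by positivity)]
      have e2 : α / 2 * (24 * ((d : ℝ) + 4) * L * α) = 12 * (d + 4) * L * α ^ 2 := by ring
      rw [e2, hαsq]
      have e3 : 12 * ((d : ℝ) + 4) * L * (n * τ / (24 * L)) = (d + 4) * n * τ / 2 := by
        field_simp; norm_num
      rw [e3]
      nlinarith [mul_le_mul_of_nonneg_right hNlt.le hτ.le]
    linarith
  have hS1 : 1 ≤ S := le_trans (one_le_pow₀ (by norm_num)) hST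
  have h1 := linear_rate_small (g := fun k => g (m + 1 + k)) (h := fun k => h (m + 1 + k)) (S := S)
    (δ := α * ς₂ + ς₁) (a := γ / α) (by positivity) hS1 hα0 hα2 hR (by positivity)
    (fun k => hg _) (fun k => hh _) (fun k => late (m + 1 + k) (by omega)) k
  simp only [add_zero] at h1
  rw [hsq1, hsq2]
  refine h1.trans ?_
  have e0 : 1 + 1 / 4 * (2 * α) = 1 + α / 2 := by ring
  rw [e0]
  have h2 : h (m + 1) / (γ / α * S) ≤ 2 * (1 / 2 * h (m + 1) / (a₁ * 2 ^ m)) := by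
    have := hh (m + 1)
    calc h (m + 1) / (γ / α * S) ≤ h (m + 1) / (a₁ * 2 ^ m) := by gcongr
      _ = _ := by ring
  have h3 : g (m + 1) + h (m + 1) / (γ / α * S) ≤ D0 / n + 4 * (ς₂ / 4 + ς₁) := by
    linarith [hg (m + 1)]
  have hr0 : 0 ≤ ((1 + α / 2) ^ k)⁻¹ := by positivity
  have hr1 : ((1 + α / 2) ^ k)⁻¹ ≤ 1 := inv_le_one_of_one_le₀ (one_le_pow₀ (by linarith))
  have h4 := mul_le_mul_of_nonneg_left h3 hr0
  have h5 := mul_le_mul_of_nonneg_right hr1 (by positivity : 0 ≤ ς₂ / 4 + ς₁)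
  have e1 : 4 / α * (α * ς₂ + ς₁) = 4 * ς₂ + 4 / α * ς₁ := by field_simp
  have e2 : 8 * (1 / (2 * α)) = 4 / α := by field_simp; norm_num
  rw [e1, e2]
  linarith

end Rates

/-! ### Convergence for measurable samples. -/

section MainMeasurable

variable {d n : ℕ} {f : Fin n → Space d → ℝ} {L μ ν τ : ℝ} {Ω : Type*} [MeasurableSpace Ω]
  {P : Measure Ω} [IsProbabilityMeasure P] {u : ℕ → ℕ → Ω → Space d} {i : ℕ → ℕ → Ω → Fin n}

/-- Convergence of ZO-Varag when the samples are measurable and `τ ≤ L`. -/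
theorem convergence_of_measurable (hn : 0 < n) (hL : 0 < L) (hτ : 0 < τ) (hτL : τ ≤ L)
    (hμ : 0 < μ) (hν : 0 < ν) (hf : ∀ i, SmoothConvex L (f i))
    (hs : ∀ x y, objective f x + inner ℝ (gradient (objective f) x) (y - x)
      + τ / 2 * ‖y - x‖ ^ 2 ≤ objective f y)
    {xs : Space d} (hmin : ∀ z, smoothed μ (objective f) xs ≤ smoothed μ (objective f) z)
    (hξ : ∀ a b, Measurable fun ω => (u a b ω, i a b ω))
    (hlaw : ∀ a b, P.map (fun ω => (u a b ω, i a b ω)) = sampleLaw d n)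
    (hindep : iIndepFun (fun (k : ℕ × ℕ) ω => (u k.1 k.2 ω, i k.1 k.2 ω)) P)
    (x0 : Space d) {gap : ℕ → Ω → ℝ}
    (hgap : gap = fun a ω => smoothed μ (objective f)
      (varag f τ μ ν (paramsSC d n L τ) x0 (fun a b => u a b ω) (fun a b => i a b ω) a).2
        - smoothed μ (objective f) xs) (s : ℕ) (hs1 : 1 ≤ s) :
    Integrable (gap s) P ∧
    (s ≤ sZero d n →
      ∫ ω, gap s ω ∂P ≤ 1 / 2 ^ (s + 1) * ((d : ℝ) + 4) * initialGap f L μ x0 xs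
        + 2 * errOne d L μ + 1 / 2 * errTwo d L τ μ ν) ∧
    (sZero d n < s → 6 * L / τ ≤ (n : ℝ) →
      ∫ ω, gap s ω ∂P ≤ (4 / 5) ^ (s - sZero d n) * (initialGap f L μ x0 xs / n)
        + 12 * errOne d L μ + 5 * errTwo d L τ μ ν) ∧
    (sZero d n < s → (n : ℝ) < 6 * L / τ →
      ∫ ω, gap s ω ∂P ≤
        ((1 + 1 / 4 * √((n : ℝ) * τ / (6 * L))) ^ (s - sZero d n))⁻¹
            * (initialGap f L μ x0 xs / n)
        + (8 * √(6 * L / ((n : ℝ) * τ)) + 4) * errOne d L μ + 5 * errTwo d L τ μ ν) := by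
  have hn' : (0 : ℝ) < n := by exact_mod_cast hn
  have hd4 : (0 : ℝ) < (d : ℝ) + 4 := by positivity
  set s0 := sZero d n with hs0
  set m := Nat.log 2 ((d + 4) * n) with hm
  have hs0m : s0 = m + 1 := rfl
  set D0 := initialGap f L μ x0 xs with hD0
  set ς₁ := errOne d L μ with hς₁
  set ς₂ := errTwo d L τ μ ν with hς₂
  have hς₁0 : 0 ≤ ς₁ := by rw [hς₁, errOne]; positivity
  have hE0 : 0 ≤ pivotErr d L μ ν := by rw [pivotErr]; positivity
  have hς₂0 : 0 ≤ ς₂ := by rw [hς₂, errTwo]; positivity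
  have hEς : pivotErr d L μ ν = τ * ς₂ := by rw [hς₂, errTwo]; field_simp
  let dist : ℕ → Ω → ℝ := fun a ω => ‖(varag f τ μ ν (paramsSC d n L τ) x0 (fun a b => u a b ω)
      (fun a b => i a b ω) a).1 - xs‖ ^ 2
  let g : ℕ → ℝ := fun a => ∫ ω, gap a ω ∂P
  let h : ℕ → ℝ := fun a => ∫ ω, dist a ω ∂P
  have hg : ∀ a, 0 ≤ g a := fun a => integral_nonneg fun ω => by
    rw [hgap]; exact sub_nonneg.2 (hmin _)
  have hh : ∀ a, 0 ≤ h a := fun a => integral_nonneg fun ω => sq_nonneg _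
  have hg0 : g 0 = smoothed μ (objective f) x0 - smoothed μ (objective f) xs := by
    simp [g, hgap, varag]
  have hh0 : h 0 = ‖x0 - xs‖ ^ 2 := by simp [h, dist, varag]
  set a₁ : ℝ := 1 / (3 * ((d : ℝ) + 4) * L) with ha₁
  have ha₁0 : 0 < a₁ := by positivity
  -- D₀ is a rescaling of the potential at the start of the first epoch; a₁ is the value of γ/α at α
  -- = 1/2.
  have hA0 : a₁ / 2 * g 0 + 1 / 2 * h 0 = a₁ * (((d : ℝ) + 4) * D0 / 4) := by
    rw [hg0, hh0, hD0, initialGap, ha₁]; field_simp; ring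
  have hA00 : 0 ≤ ((d : ℝ) + 4) * D0 / 4 := by
    have h1 : 0 ≤ a₁ * (((d : ℝ) + 4) * D0 / 4) := by
      rw [← hA0]
      have := hg 0
      have := hh 0
      positivity
    exact nonneg_of_mul_nonneg_right h1 ha₁0
  have hD00 : 0 ≤ D0 := by
    have h1 : D0 = (((d : ℝ) + 4) * D0 / 4) * (4 / (d + 4)) := by field_simp
    rw [h1]; positivity
  -- inequalities between epochs
  have early : ∀ s, s + 1 ≤ s0 → Integrable (gap s) P → Integrable (dist s) P →
      Integrable (gap (s + 1)) P ∧ Integrable (dist (s + 1)) P ∧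
      a₁ * 2 ^ s * g (s + 1) + 1 / 2 * h (s + 1)
        ≤ a₁ * (2 ^ s / 2) * g s + 1 / 2 * h s + a₁ * 2 ^ s * (ς₂ / 4 + ς₁) := by
    intro s hle hgi hdi
    have hlen : epochLength d n (s + 1) = (2 ^ s - 1) + 1 := by
      rw [epochLength, if_pos hle, Nat.add_sub_cancel, Nat.sub_add_cancel Nat.one_le_two_pow]
    have hαe : alphaSC d n L τ (s + 1) = 1 / 2 := by rw [alphaSC, if_pos hle]
    have ha : gammaSC d n L τ (s + 1) / alphaSC d n L τ (s + 1) = a₁ := by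
      rw [gammaSC, hαe, ha₁]; field_simp; norm_num
    have hgam := gammaSC_pos (d := d) hn hL hτ (s + 1)
    -- With c = τ all the strong convexity is spent on the bias, whose cost becomes αE/(2τ) = ς₂/4.
    obtain ⟨h1, h2, h3⟩ := epoch_inequality hn hL hτ hμ hν hf hs hmin hξ hlaw hindep x0 s (2 ^ s - 1)
      (κ := gammaSC d n L τ (s + 1) / alphaSC d n L τ (s + 1)) (ρ := 1) (q := 0) (c := τ)
      (by rw [ha]; exact ha₁0) hlen hτ le_rfl (by ring) (by rw [hαe]; ring) (by norm_num)
      (thetaSC_of_le hle) hgap (dist := dist) rfl hgi hdi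
    refine ⟨h1, h2, ?_⟩
    rw [ha, hαe, hEς, Nat.sub_add_cancel Nat.one_le_two_pow] at h3
    have e1 : 1 / 2 * (τ * ς₂) / (2 * τ) = ς₂ / 4 := by field_simp; ring
    rw [e1] at h3
    simp only [one_pow, Finset.sum_const, Finset.card_range, nsmul_eq_mul, mul_one, sub_zero,
      one_mul, add_zero, Nat.cast_pow, Nat.cast_ofNat] at h3
    have e2 : (1 : ℝ) / 2 * 2 ^ s = 2 ^ s / 2 := by ring
    rw [e2] at h3
    exact h3
  set α := min (√((n : ℝ) * τ / (24 * L))) (1 / 2) with hα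
  have hα0 : 0 < α := lt_min (Real.sqrt_pos.2 (by positivity)) (by norm_num)
  have hα2 : α ≤ 1 / 2 := min_le_right _ _
  set γ := 1 / (12 * ((d : ℝ) + 4) * L * α) with hγ
  have hγ0 : 0 < γ := by positivity
  set ρ := 1 + (τ - τ / 2) * γ with hρ
  set S := ∑ t ∈ Finset.range (2 ^ m), ρ ^ t with hS
  have hρ1 : 1 ≤ ρ := by
    have : 0 ≤ (τ - τ / 2) * γ := mul_nonneg (by linarith) hγ0.le
    rw [hρ]; linarith
  have hST : (2 : ℝ) ^ m ≤ S := by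
    have := le_sum_pow hρ1 (2 ^ m)
    push_cast at this
    exact this
  have late : ∀ s, s0 ≤ s → Integrable (gap s) P → Integrable (dist s) P →
      Integrable (gap (s + 1)) P ∧ Integrable (dist (s + 1)) P ∧
      γ / α * ((1 - (1 / 2 - α)) * S + (1 / 2 - α)) * g (s + 1) + 1 / 2 * ρ ^ (2 ^ m) * h (s + 1)
        ≤ γ / α * (1 / 2 * S + (1 / 2 - α)) * g s + 1 / 2 * h s
          + γ / α * S * (α * ς₂ + ς₁) := by
    intro s hle hgi hdi
    have hlt : ¬ s + 1 ≤ s0 := by omega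
    have hlen : epochLength d n (s + 1) = (2 ^ m - 1) + 1 := by
      rw [epochLength, if_neg hlt, ← hs0, hs0m, Nat.add_sub_cancel,
        Nat.sub_add_cancel Nat.one_le_two_pow]
    have hαe : alphaSC d n L τ (s + 1) = α := by rw [alphaSC, if_neg hlt]
    have hγe : gammaSC d n L τ (s + 1) = γ := by rw [gammaSC, hαe]
    have hτγ := tau_mul_gammaSC_le (d := d) hn hL hτ hτL (s + 1)
    rw [hγe] at hτγ
    -- With c = τ/2 half of the strong convexity remains to drive the contraction, and the bias
    -- costs αE/τ = ας₂.
    obtain ⟨h1, h2, h3⟩ := epoch_inequality hn hL hτ hμ hν hf hs hmin hξ hlaw hindep x0 s (2 ^ m - 1)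
      (κ := 1) (ρ := 1 + (τ - τ / 2) * gammaSC d n L τ (s + 1))
      (q := 1 / 2 - alphaSC d n L τ (s + 1)) (c := τ / 2)
      one_pos hlen (by positivity) (by linarith) rfl rfl (by
        rw [hαe, hγe]; nlinarith)
      (thetaSC_of_lt (by omega)) hgap (dist := dist) rfl hgi hdi
    refine ⟨h1, h2, ?_⟩
    rw [hγe, hαe, hEς, Nat.sub_add_cancel Nat.one_le_two_pow, ← hρ, ← hS] at h3
    have e1 : α * (τ * ς₂) / (2 * (τ / 2)) = α * ς₂ := by field_simp
    rw [e1] at h3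
    exact h3
  have hint : ∀ s, Integrable (gap s) P ∧ Integrable (dist s) P := by
    intro s
    induction s with
    | zero =>
      constructor
      · rw [hgap]
        exact integrable_const (smoothed μ (objective f) x0 - smoothed μ (objective f) xs)
      · exact integrable_const (‖x0 - xs‖ ^ 2)
    | succ s ih =>
      rcases le_or_gt (s + 1) s0 with hle | hlt
      · obtain ⟨h1, h2, -⟩ := early s hle ih.1 ih.2; exact ⟨h1, h2⟩
      · obtain ⟨h1, h2, -⟩ := late s (by omega) ih.1 ih.2; exact ⟨h1, h2⟩
  have hdoub := doubling_gap_le (m := m) ha₁0 (by positivity) hA0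
    fun s hle => (early s hle (hint s).1 (hint s).2).2.2
  have hNlt : ((d : ℝ) + 4) * n < 2 * 2 ^ m := by
    have h1 : (d + 4) * n < 2 ^ (m + 1) := Nat.lt_pow_succ_log_self (by norm_num) _
    have h2 : (((d + 4) * n : ℕ) : ℝ) < ((2 ^ (m + 1) : ℕ) : ℝ) := by exact_mod_cast h1
    push_cast at h2
    rw [pow_succ] at h2
    linarith
  have hmid := doubling_final_gap_le hn' hD00 hNlt (hdoub m le_rfl)
  have hlate := fun s hle => (late s hle (hint s).1 (hint s).2).2.2
  refine ⟨(hint s).1, fun hle => ?_, fun hlt hnL => ?_, fun hlt hnL => ?_⟩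
  · obtain ⟨k, rfl⟩ : ∃ k, s = k + 1 := ⟨s - 1, by omega⟩
    exact gap_le_of_doubling ha₁0 hh (hdoub k hle)
  · obtain ⟨k, rfl⟩ : ∃ k, s = s0 + (k + 1) := ⟨s - s0 - 1, by omega⟩
    rw [Nat.add_sub_cancel_left]
    exact gap_le_of_large_sample hn' hL hτ hD00 hς₁0 hς₂0 ha₁ hα hγ hρ hST hNlt hg hh hmid hlate
      hnL k
  · obtain ⟨k, rfl⟩ : ∃ k, s = s0 + k := ⟨s - s0, by omega⟩
    rw [Nat.add_sub_cancel_left]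
    exact gap_le_of_small_sample hn' hL hτ hς₁0 hς₂0 ha₁ hα hγ hρ hST hNlt hg hh hmid hlate hnL k

end MainMeasurable

/-! ### Existence of a minimizer, and the main theorem. -/

/-- The Gaussian smoothing of a strongly convex smooth function attains its minimum. -/
theorem exists_forall_smoothed_le {d : ℕ} {g : Space d → ℝ} {L τ : ℝ} (hL : 0 < L) (hτ : 0 < τ)
    (hg : SmoothConvex L g) (μ : ℝ)
    (hs : ∀ x y, g x + inner ℝ (gradient g x) (y - x) + τ / 2 * ‖y - x‖ ^ 2 ≤ g y) :
    ∃ xs, ∀ y, smoothed μ g xs ≤ smoothed μ g y := by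
  refine (hg.continuous_smoothed hL μ).exists_forall_le' 0 ?_
  -- Beyond this radius the quadratic term dominates the linear one, so the value is at least the
  -- one at 0.
  filter_upwards [(tendsto_norm_cocompact_atTop (E := Space d)).eventually_ge_atTop
    (2 * ‖smoothedGradient μ g 0‖ / τ)] with y hy
  have h1 := hg.smoothed_quadratic_le hL μ hs 0 y
  rw [sub_zero] at h1
  have h2 := neg_le_of_abs_le (abs_real_inner_le_norm (smoothedGradient μ g 0) y)
  rw [div_le_iff₀ hτ] at hy
  have h3 := mul_le_mul_of_nonneg_right hy (norm_nonneg y)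
  nlinarith

/-- The modulus of strong convexity is at most the smoothness constant. -/
theorem strongConvexity_le_smoothness {d : ℕ} (hd : 0 < d) {g : Space d → ℝ} {L τ : ℝ}
    (hg : SmoothConvex L g)
    (hs : ∀ x y, g x + inner ℝ (gradient g x) (y - x) + τ / 2 * ‖y - x‖ ^ 2 ≤ g y) : τ ≤ L := by
  have h1 := hs 0 (EuclideanSpace.single ⟨0, hd⟩ 1)
  have h2 := hg.descent 0 (EuclideanSpace.single ⟨0, hd⟩ 1)
  simp only [sub_zero, PiLp.norm_single, norm_one, one_pow, mul_one] at h1 h2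
  linarith

end ZerothOrder

end

open ZOVarag in
theorem theorem2 {d n : ℕ} (hn : 0 < n)
    (f : Fin n → Space d → ℝ) (L τ μ ν : ℝ)
    (hL : 0 < L) (hτ : 0 < τ) (hμ : 0 < μ) (hν : 0 < ν)
    -- each component is convex, differentiable and `L`-smooth
    (hconv : ∀ i, ConvexOn ℝ Set.univ (f i))
    (hdiff : ∀ i, Differentiable ℝ (f i))
    (hsmooth : ∀ i x y, ‖gradient (f i) x - gradient (f i) y‖ ≤ L * ‖x - y‖)
    -- the average is `τ`-strongly convex
    (hstrong : ∀ x y, objective f y ≥ objective f x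
      + inner ℝ (gradient (objective f) x) (y - x) + τ / 2 * ‖y - x‖ ^ 2)
    -- the starting point and the samples: the pairs `(u s t, i s t)` are independent, with
    -- `u s t` standard Gaussian, `i s t` uniform, and `u s t` independent of `i s t`
    (x0 : Space d)
    {Ω : Type*} [MeasurableSpace Ω] (P : Measure Ω) [IsProbabilityMeasure P]
    (u : ℕ → ℕ → Ω → Space d) (i : ℕ → ℕ → Ω → Fin n)
    (hlaw : ∀ s t, HasLaw (fun ω => (u s t ω, i s t ω))
      ((stdGaussian (Space d)).prod (uniformOn (Set.univ : Set (Fin n)))) P)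
    (hindep : iIndepFun (fun (k : ℕ × ℕ) ω => (u k.1 k.2 ω, i k.1 k.2 ω)) P) :
    -- the smoothed objective has a minimizer, and the bounds hold for every minimizer
    (∃ xs : Space d, ∀ y, smoothed μ (objective f) xs ≤ smoothed μ (objective f) y) ∧
    ∀ xs : Space d, (∀ y, smoothed μ (objective f) xs ≤ smoothed μ (objective f) y) →
      ∀ s : ℕ, 1 ≤ s →
        let gap : Ω → ℝ := fun ω =>
          smoothed μ (objective f)
            (varag f τ μ ν (paramsSC d n L τ) x0 (fun a b => u a b ω) (fun a b => i a b ω) s).2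
          - smoothed μ (objective f) xs
        Integrable gap P ∧
        (s ≤ sZero d n →
          ∫ ω, gap ω ∂P ≤ 1 / 2 ^ (s + 1) * ((d : ℝ) + 4) * initialGap f L μ x0 xs
            + 2 * errOne d L μ + 1 / 2 * errTwo d L τ μ ν) ∧
        (sZero d n < s → 6 * L / τ ≤ (n : ℝ) →
          ∫ ω, gap ω ∂P ≤ (4 / 5) ^ (s - sZero d n) * (initialGap f L μ x0 xs / n)
            + 12 * errOne d L μ + 5 * errTwo d L τ μ ν) ∧
        (sZero d n < s → (n : ℝ) < 6 * L / τ →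
          ∫ ω, gap ω ∂P ≤
            ((1 + 1 / 4 * √((n : ℝ) * τ / (6 * L))) ^ (s - sZero d n))⁻¹
                * (initialGap f L μ x0 xs / n)
            + (8 * √(6 * L / ((n : ℝ) * τ)) + 4) * errOne d L μ + 5 * errTwo d L τ μ ν) := by
  have hf : ∀ i, ZerothOrder.SmoothConvex L (f i) := fun i => ⟨hconv i, hdiff i, hsmooth i⟩
  have hF := ZerothOrder.smoothConvex_objective hn hf
  refine ⟨ZerothOrder.exists_forall_smoothed_le hL hτ hF μ hstrong, fun xs hxs s hs1 => ?_⟩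
  intro gap
  -- In dimension 0 strong convexity and smoothness do not force τ ≤ L, but the space is a point,
  -- the gap vanishes and the bounds are nonnegative.
  rcases Nat.eq_zero_or_pos d with rfl | hd
  · have hgap : gap = fun _ => 0 := by
      funext ω
      simp only [gap, sub_eq_zero]
      exact congrArg _ (Subsingleton.elim _ _)
    have hD : 0 ≤ initialGap f L μ x0 xs := by
      have := sub_nonneg.2 (hxs x0)
      rw [initialGap]; positivity
    have h1 : 0 ≤ errOne 0 L μ := by rw [errOne]; positivity
    have h2 : 0 ≤ errTwo 0 L τ μ ν := by rw [errTwo, pivotErr]; positivity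
    rw [hgap, integral_zero]
    exact ⟨integrable_zero _ _ _, fun _ => by positivity, fun _ _ => by positivity,
      fun _ _ => by positivity⟩
  -- `HasLaw` gives only a.e. measurability. The samples are replaced by measurable versions, which
  -- changes the gap only on a null set because the index set is countable.
  let ξ : ℕ → ℕ → Ω → Space d × Fin n := fun a b => (hlaw a b).aemeasurable.mk
  have hξ : ∀ a b, Measurable (ξ a b) := fun a b => (hlaw a b).aemeasurable.measurable_mk
  have hae : ∀ a b, (fun ω => (u a b ω, i a b ω)) =ᵐ[P] ξ a b := fun a b =>
    (hlaw a b).aemeasurable.ae_eq_mk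
  have hlaw' : ∀ a b, P.map (ξ a b) = ZerothOrder.sampleLaw d n := fun a b =>
    (Measure.map_congr (hae a b)).symm.trans (hlaw a b).map_eq
  have hindep' : iIndepFun (fun k : ℕ × ℕ => ξ k.1 k.2) P :=
    hindep.congr fun k => hae k.1 k.2
  obtain ⟨hint, h⟩ := ZerothOrder.convergence_of_measurable (u := fun a b ω => (ξ a b ω).1)
    (i := fun a b ω => (ξ a b ω).2) (P := P) hn hL hτ
    (ZerothOrder.strongConvexity_le_smoothness hd hF hstrong) hμ hν hf hstrong hxs hξ hlaw'
    hindep' x0 rfl s hs1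
  have hgap : gap =ᵐ[P] fun ω => smoothed μ (objective f)
      (varag f τ μ ν (paramsSC d n L τ) x0 (fun a b => (ξ a b ω).1) (fun a b => (ξ a b ω).2) s).2
        - smoothed μ (objective f) xs := by
    filter_upwards [ae_all_iff.2 fun a => ae_all_iff.2 fun b => hae a b] with ω hω
    simp only [gap, ← hω]
  rw [integrable_congr hgap, integral_congr_ae hgap]
  exact ⟨hint, h⟩
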